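/- **Setting.** Let $h:[0,1]\to(0,\infty)$ and $f:[0,\infty)\to[0,\infty)$ be $C^1$, and let $t_0\ge 0$ be such that $f>0$ on $[t_0,\infty)$ and $f\in C^2([t_0,\infty))$. Put $g=\log f$ on $[t_0,\infty)$. Let $q\in[1,2)$ and assume: (i) $g'>0$ and $g''>0$ on $[t_0,\infty)$, $\lim_{t\to\infty} g'(t)^2/(g(t)g''(t))=q$, and $\lim_{t\to\infty} t g'(t)/g(t)$ exists in $(0,\infty]$ and is finite if $q>1$; (ii) if $q=1$, then $t g'(t)/g(t)$ is nondecreasing on $[t_0,\infty)$, and there are an integer $m\ge1$ and $\hat g\in C^2([t_0,\infty))$ such that $f=\exp_m(\hat g)$ on $[t_0,\infty)$ ($\exp_m$ is the $m$-fold iterate of $\exp$) and $\hat g'/\hat g$ is nonincreasing on $[t_0,\infty)$. Let $(\lambda_n,\mu_n,u_n)\in(0,\infty)\times(0,\infty)\times C^2([0,1])$ satisfy, for all $n$, $$-u_n''-\tfrac1r u_n'=\lambda_n h f(u_n),\quad u_n>0\ \text{ in }(0,1),\qquad u_n(0)=\mu_n,\quad u_n'(0)=0=u_n(1),$$ and suppose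 $\mu_n\to\infty$. **Recurrence formulas.** Let $a_1=2$, $\delta_1=1$, $\eta_1=1$. If $q>1$, let $p=q/(q-1)$ and define, for $k\ge1$, $\delta_{k+1}\in(0,\delta_k)$ and $a_{k+1}$ by $$\frac{2p}{2+a_k}\Bigl(1-\frac{\delta_{k+1}}{\delta_k}\Bigr)-1+\Bigl(\frac{\delta_{k+1}}{\delta_k}\Bigr)^p=0,\qquad a_{k+1}=2-\Bigl(\frac{\delta_{k+1}}{\delta_k}\Bigr)^{p-1}(2+a_k).$$ If $q=1$, let $\delta_k=1$ for all $k$ and define $\eta_{k+1}\in(0,\eta_k)$ and $a_{k+1}$ by $$\frac{2}{2+a_k}\log\frac{\eta_k}{\eta_{k+1}}-1+\frac{\eta_{k+1}}{\eta_k}=0,\qquad a_{k+1}=2-\frac{\eta_{k+1}}{\eta_k}(2+a_k).$$ These sequences are well defined, and $a_k\in(0,2]$. Put $b_k=(\sqrt2/a_k)^{a_k}$ and $$z_k(r)=\log\frac{2a_k^2b_k}{r^{2-a_k}(1+b_kr^{a_k})^2},$$ for $r\ge0$ if $k=1$ and for $r>0$ if $k>1$. **Theorem.** For every $k\ge1$,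 $z_k$ satisfies $-z_k''-\frac1r z_k'=e^{z_k}$ in $(0,\infty)$ and $\int_0^\infty e^{z_k}r\,dr=2a_k$. Moreover, after passing to a subsequence of $(\lambda_n,\mu_n,u_n)$ (one subsequence for all $k$, still indexed by $n$), there are for every $k\ge1$ sequences $(r_{k,n})\subset(0,1)$, $(\gamma_{k,n})\subset(0,\infty)$, $(\rho_{k,n})\subset(0,1)$ and $(\bar\rho_{k,n})$, with $\bar\rho_{1,n}=0$ for all $n$ and $(\bar\rho_{k,n})\subset(0,1)$ for $k\ge2$, such that the following holds for every $k\ge1$ as $n\to\infty$. 1. $u_n(r_{k,n})/\mu_n\to\delta_k$ and $\lambda_n r_{k,n}^2h(r_{k,n})f'(u_n(r_{k,n}))\to a_k^2/2$. 2. $\lambda_nh(r_{k,n})f'(u_n(r_{k,n}))\gamma_{k,n}^2=1$ for all large $n$, and $\gamma_{k,n}\to0$. 3. $\rho_{k,n}\to0$, $\bar\rho_{k,n}/\gamma_{k,n}\to0$, $\rho_{k,n}/\gamma_{k,n}\to\infty$, $u_n(\bar\rho_{k,n})/\mu_n\to\delta_k$ and $u_n(\rho_{k,n})/\mu_n\to\delta_k$.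 4. With $z_{k,n}(r)=g'(u_n(r_{k,n}))\,(u_n(\gamma_{k,n}r)-u_n(r_{k,n}))$ for $r\in[0,1/\gamma_{k,n}]$, $$\|z_{k,n}-z_k\|_{C^2([\bar\rho_{k,n}/\gamma_{k,n},\,\rho_{k,n}/\gamma_{k,n}])}\to0.$$ 5. If $q=1$, then, for each of the sequences $(r_n)=(r_{k,n})$, $(\rho_{k,n})$ and $(\bar\rho_{k,n})$, $$u_n(r_n)=\mu_n-\Bigl(\log\frac1{\eta_k}+o(1)\Bigr)\frac{g(\mu_n)}{g'(\mu_n)}.$$ 6. $$\lim_{n\to\infty}g'(u_n(r_{k,n}))\int_{\bar\rho_{k,n}}^{\rho_{k,n}}\lambda_nhf(u_n)r\,dr=2a_k=\lim_{n\to\infty}\int_{\bar\rho_{k,n}}^{\rho_{k,n}}\lambda_nhf'(u_n)r\,dr.$$ 7. $$\lim_{n\to\infty}g'(\mu_n)\int_{\rho_{k,n}}^{\bar\rho_{k+1,n}}\lambda_nhf(u_n)r\,dr=0.$$ -/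

import Mathlib

open Set Filter Topology MeasureTheory

namespace InfConc

noncomputable section

/-! ### The nonlinearity -/

/-- The basic condition on the nonlinearity `h(r) f(t)`: `h : [0,1] → (0,∞)` and
`f : [0,∞) → [0,∞)` are `C^1`, and `f` is positive and `C^2` on `[t₀,∞)`.
Only the values of `h` on `[0,1]` and of `f` on `[0,∞)` matter. -/
structure H0 (h f : ℝ → ℝ) (t₀ : ℝ) : Prop where
  h_contDiff : ContDiffOn ℝ 1 h (Icc 0 1)
  h_pos : ∀ r ∈ Icc (0 : ℝ) 1, 0 < h r
  f_contDiff : ContDiffOn ℝ 1 f (Ici 0)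
  f_nonneg : ∀ t, 0 ≤ t → 0 ≤ f t
  t₀_nonneg : 0 ≤ t₀
  f_pos : ∀ t, t₀ ≤ t → 0 < f t
  f_contDiff_two : ContDiffOn ℝ 2 f (Ici t₀)

/-- The derivative `f'` of `f` on `[0,∞)` (one-sided at `0`). -/
def df (f : ℝ → ℝ) (t : ℝ) : ℝ := derivWithin f (Ici 0) t

/-- `g = log f`, used on `[t₀,∞)`. -/
def g (f : ℝ → ℝ) (t : ℝ) : ℝ := Real.log (f t)

/-- `g'` on `[t₀,∞)` (one-sided at `t₀`). -/
def dg (f : ℝ → ℝ) (t₀ t : ℝ) : ℝ := derivWithin (g f) (Ici t₀) t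

/-- `g''` on `[t₀,∞)` (one-sided at `t₀`). -/
def ddg (f : ℝ → ℝ) (t₀ t : ℝ) : ℝ := derivWithin (dg f t₀) (Ici t₀) t

/-- Generalized exponential growth with exponent `q`.
The iterate `Real.exp^[k]` is the `k`-fold exponential. -/
structure H1 (f : ℝ → ℝ) (t₀ q : ℝ) : Prop where
  one_le_q : 1 ≤ q
  dg_pos : ∀ t, t₀ ≤ t → 0 < dg f t₀ t
  ddg_pos : ∀ t, t₀ ≤ t → 0 < ddg f t₀ t
  tendsto_Q : Tendsto (fun t => dg f t₀ t ^ 2 / (g f t * ddg f t₀ t)) atTop (𝓝 q)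
  tendsto_P : ∃ p : EReal, 0 < p ∧ (1 < q → p ≠ ⊤) ∧
    Tendsto (fun t => ((t * dg f t₀ t / g f t : ℝ) : EReal)) atTop (𝓝 p)
  monotone_P : q = 1 → MonotoneOn (fun t => t * dg f t₀ t / g f t) (Ici t₀)
  multiple_exp : q = 1 → ∃ k : ℕ, 1 ≤ k ∧ ∃ gh : ℝ → ℝ, ContDiffOn ℝ 2 gh (Ici t₀) ∧
    (∀ t, t₀ ≤ t → f t = Real.exp^[k] (gh t)) ∧
    AntitoneOn (fun t => derivWithin gh (Ici t₀) t / gh t) (Ici t₀)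

/-! ### Solutions -/

/-- `u ∈ C^2([0,1])` is a radial solution, with parameter `lam` and height `mu`, of
`-u'' - u'/r = lam h f(u)`, `u > 0` in `(0,1)`, `u(0) = mu`, `u'(0) = 0 = u(1)`. -/
structure IsSolution (h f : ℝ → ℝ) (lam mu : ℝ) (u : ℝ → ℝ) : Prop where
  lam_pos : 0 < lam
  mu_pos : 0 < mu
  contDiff : ContDiffOn ℝ 2 u (Icc 0 1)
  pos : ∀ r ∈ Ioo (0 : ℝ) 1, 0 < u r
  eqn : ∀ r ∈ Ioo (0 : ℝ) 1,
    -(iteratedDerivWithin 2 u (Icc 0 1) r) - 1 / r * derivWithin u (Icc 0 1) r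
      = lam * h r * f (u r)
  apply_zero : u 0 = mu
  deriv_zero : derivWithin u (Icc 0 1) 0 = 0
  apply_one : u 1 = 0

/-! ### The energy recurrence formulas -/

/-- `x = δ_{k+1}/δ_k` is the root in `(0,1)` of this equation (case `q > 1`). -/
def IsDeltaRatio (p a x : ℝ) : Prop :=
  0 < x ∧ x < 1 ∧ 2 * p / (2 + a) * (1 - x) - 1 + x ^ p = 0

/-- `x = η_{k+1}/η_k` is the root in `(0,1)` of this equation (case `q = 1`). -/
def IsEtaRatio (a x : ℝ) : Prop :=
  0 < x ∧ x < 1 ∧ 2 / (2 + a) * Real.log (1 / x) - 1 + x = 0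

/-- The root in `IsDeltaRatio`; it exists and is unique, see `existsUnique_deltaRatio`. -/
def deltaRatio (p a : ℝ) : ℝ := Classical.epsilon (IsDeltaRatio p a)

/-- The root in `IsEtaRatio`; it exists and is unique, see `existsUnique_etaRatio`. -/
def etaRatio (a : ℝ) : ℝ := Classical.epsilon (IsEtaRatio a)

/-- The pair `(a_{k+1}, δ_{k+1})` at index `k`, for `p < ∞`. -/
def powState (p : ℝ) : ℕ → ℝ × ℝ
  | 0 => (2, 1)
  | k + 1 =>
    (2 - deltaRatio p (powState p k).1 ^ (p - 1) * (2 + (powState p k).1),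
      deltaRatio p (powState p k).1 * (powState p k).2)

/-- The pair `(a_{k+1}, η_{k+1})` at index `k`, for `q = 1`. -/
def expState : ℕ → ℝ × ℝ
  | 0 => (2, 1)
  | k + 1 =>
    (2 - etaRatio (expState k).1 * (2 + (expState k).1),
      etaRatio (expState k).1 * (expState k).2)

/-- The conjugate exponent `p` of `q > 1`. -/
def conjP (q : ℝ) : ℝ := q / (q - 1)

/-- `a_k`, `k ≥ 1`. -/
def aSeq (q : ℝ) (k : ℕ) : ℝ :=
  if q = 1 then (expState (k - 1)).1 else (powState (conjP q) (k - 1)).1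

/-- `δ_k`, `k ≥ 1`. -/
def deltaSeq (q : ℝ) (k : ℕ) : ℝ :=
  if q = 1 then 1 else (powState (conjP q) (k - 1)).2

/-- `η_k`, `k ≥ 1`. -/
def etaSeq (q : ℝ) (k : ℕ) : ℝ :=
  if q = 1 then (expState (k - 1)).2 else deltaSeq q k ^ conjP q

private lemma root_aux {φ : ℝ → ℝ} (hc : StrictConvexOn ℝ (Ioi 0) φ)
    (hcont : ContinuousOn φ (Ioi 0)) (h1 : φ 1 = 0) {d : ℝ} (hd : HasDerivAt φ d 1)
    (hd0 : 0 < d) {y : ℝ} (hy0 : 0 < y) (hy1 : y < 1) (hy : 0 < φ y) :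
    ∃! x, 0 < x ∧ x < 1 ∧ φ x = 0 := by
  have hex : ∃ w, y < w ∧ w < 1 ∧ φ w < 0 := by
    have hs := (hasDerivAt_iff_tendsto_slope.1 hd).eventually (lt_mem_nhds hd0)
    have hs' : ∀ᶠ w in 𝓝[<] (1 : ℝ), 0 < slope φ 1 w :=
      hs.filter_mono (nhdsWithin_mono _ fun w (hw : w < 1) => ne_of_lt hw)
    have hI : ∀ᶠ w in 𝓝[<] (1 : ℝ), w ∈ Ioo y 1 := Ioo_mem_nhdsLT hy1
    obtain ⟨w, hw, hw1⟩ := (hs'.and hI).exists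
    refine ⟨w, hw1.1, hw1.2, ?_⟩
    rw [slope_def_field, h1, sub_zero] at hw
    have : w - 1 < 0 := by linarith [hw1.2]
    by_contra hcon
    push Not at hcon
    exact absurd hw (not_lt.2 (div_nonpos_of_nonneg_of_nonpos hcon this.le))
  obtain ⟨w, hyw, hw1, hw⟩ := hex
  have hsub : Icc y w ⊆ Ioi 0 := fun t ht => lt_of_lt_of_le hy0 ht.1
  obtain ⟨x, hx, hx0⟩ := intermediate_value_Icc' hyw.le (hcont.mono hsub) ⟨hw.le, hy.le⟩
  refine ⟨x, ⟨lt_of_lt_of_le hy0 hx.1, lt_of_le_of_lt hx.2 hw1, hx0⟩, ?_⟩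
  have key : ∀ s t : ℝ, 0 < s → s < t → t < 1 → φ s = 0 → φ t = 0 → False := by
    intro s t hs hst ht h2 h3
    have hs1 : s < 1 := hst.trans ht
    have := hc.2 (show s ∈ Ioi (0 : ℝ) from hs) (show (1 : ℝ) ∈ Ioi (0 : ℝ) by simp) hs1.ne
      (show 0 < (1 - t) / (1 - s) from div_pos (by linarith) (by linarith))
      (show 0 < (t - s) / (1 - s) from div_pos (by linarith) (by linarith))
      (by rw [← add_div, div_eq_one_iff_eq (by linarith)]; ring)
    have e : ((1 - t) / (1 - s)) • s + ((t - s) / (1 - s)) • (1 : ℝ) = t := by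
      have : 1 - s ≠ 0 := by linarith
      simp only [smul_eq_mul]
      field_simp
      ring
    rw [e, h1, h2, h3] at this
    simp at this
  rintro z ⟨hz0, hz1, hz⟩
  rcases lt_trichotomy z x with h | h | h
  · exact (key z x hz0 h (lt_of_le_of_lt hx.2 hw1) hz hx0).elim
  · exact h
  · exact (key x z (lt_of_lt_of_le hy0 hx.1) h hz1 hx0 hz).elim

private lemma deriv_aux {φ : ℝ → ℝ} (hc : StrictConvexOn ℝ (Ioi 0) φ) (h1 : φ 1 = 0)
    {x d : ℝ} (hx0 : 0 < x) (hx1 : x < 1) (hx : φ x = 0) (hd : HasDerivAt φ d x) : d < 0 := by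
  have := hc.lt_slope_of_hasDerivAt (x := x) (y := 1) hx0 (by simp) hx1 hd
  rwa [slope_def_field, h1, hx, sub_zero, zero_div] at this

private lemma convex_delta {p : ℝ} (c : ℝ) (hp : 2 < p) :
    StrictConvexOn ℝ (Ioi 0) fun x : ℝ => c * (1 - x) - 1 + x ^ p := by
  have h1 : StrictConvexOn ℝ (Ioi 0) fun x : ℝ => x ^ p :=
    (strictConvexOn_rpow (by linarith)).subset Ioi_subset_Ici_self (convex_Ioi 0)
  have h2 : ConvexOn ℝ (Ioi 0) fun x : ℝ => c * (1 - x) - 1 :=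
    ⟨convex_Ioi 0, fun x _ y _ a b _ _ hab => by
      simp only [smul_eq_mul]
      have : b = 1 - a := by linarith
      subst this
      apply le_of_eq
      ring⟩
  exact h2.add_strictConvexOn h1

private lemma deriv_delta {p x : ℝ} (c : ℝ) (hx : 0 < x) :
    HasDerivAt (fun x : ℝ => c * (1 - x) - 1 + x ^ p) (-c + p * x ^ (p - 1)) x := by
  have h1 := Real.hasDerivAt_rpow_const (x := x) (p := p) (Or.inl hx.ne')
  have h2 : HasDerivAt (fun x : ℝ => c * (1 - x) - 1) (-c) x := by
    simpa using ((((hasDerivAt_id x).const_sub 1).const_mul c).sub_const 1)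
  exact h2.add h1

private lemma convex_eta {c : ℝ} (hc : 0 < c) :
    StrictConvexOn ℝ (Ioi 0) fun x : ℝ => c * Real.log (1 / x) - 1 + x := by
  have h1 : StrictConvexOn ℝ (Ioi 0) fun x : ℝ => -Real.log x :=
    strictConcaveOn_log_Ioi.neg
  refine ⟨convex_Ioi 0, fun x hx y hy hxy a b ha hb hab => ?_⟩
  have := h1.2 hx hy hxy ha hb hab
  simp only [smul_eq_mul, one_div, Real.log_inv] at this ⊢
  have hb' : b = 1 - a := by linarith
  nlinarith [mul_lt_mul_of_pos_left this hc]

private lemma deriv_eta {x : ℝ} (c : ℝ) (hx : 0 < x) :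
    HasDerivAt (fun x : ℝ => c * Real.log (1 / x) - 1 + x) (-(c / x) + 1) x := by
  have h1 : HasDerivAt (fun x : ℝ => c * -Real.log x - 1 + x) (c * -x⁻¹ + 1) x :=
    ((((Real.hasDerivAt_log hx.ne').neg.const_mul c).sub_const 1).add (hasDerivAt_id x))
  simp only [one_div, Real.log_inv]
  convert h1 using 1
  rw [div_eq_mul_inv]
  ring

theorem existsUnique_deltaRatio {p a : ℝ} (hp : 2 < p) (ha0 : 0 < a) (ha2 : a ≤ 2) :
    ∃! x, IsDeltaRatio p a x := by
  have hc := convex_delta (2 * p / (2 + a)) hp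
  have hy0 : 0 < (1 - 2 / p) / 2 := by
    have : 2 / p < 1 := (div_lt_one (by linarith)).2 hp
    linarith
  have hpp : 0 < 2 / p := by positivity
  refine root_aux hc (fun x hx => (deriv_delta _ hx).continuousAt.continuousWithinAt)
    (by simp) (deriv_delta _ one_pos) ?_ hy0 (by linarith) ?_
  · have : 2 * p / (2 + a) < p := by
      rw [div_lt_iff₀ (by linarith)]; nlinarith
    simp only [Real.one_rpow]
    linarith
  · have h1 : p / 2 ≤ 2 * p / (2 + a) := by
      rw [div_le_div_iff₀ (by norm_num) (by linarith)]; nlinarith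
    have h2 : 0 < ((1 - 2 / p) / 2) ^ p := Real.rpow_pos_of_pos hy0 p
    have h3 : p / 2 * (1 - (1 - 2 / p) / 2) = p / 4 + 1 / 2 := by
      field_simp
      ring
    have h4 : p / 2 * (1 - (1 - 2 / p) / 2) ≤ 2 * p / (2 + a) * (1 - (1 - 2 / p) / 2) :=
      mul_le_mul_of_nonneg_right h1 (by linarith)
    linarith

theorem existsUnique_etaRatio {a : ℝ} (ha0 : 0 < a) : ∃! x, IsEtaRatio a x := by
  have hc := convex_eta (c := 2 / (2 + a)) (by positivity)
  refine root_aux hc (fun x hx => (deriv_eta _ hx).continuousAt.continuousWithinAt)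
    (by simp) (deriv_eta _ one_pos) ?_ (Real.exp_pos (-((2 + a) / 2)))
    (by rw [← Real.exp_zero]; exact Real.exp_lt_exp.2 (by linarith)) ?_
  · have : 2 / (2 + a) < 1 := by
      rw [div_lt_one (by linarith)]; linarith
    simp only [div_one]
    linarith
  · have h2 := Real.exp_pos (-((2 + a) / 2))
    rw [one_div, Real.log_inv, Real.log_exp]
    have : 2 / (2 + a) * - -((2 + a) / 2) = 1 := by
      field_simp
    linarith

private lemma two_lt_conjP {q : ℝ} (h1 : 1 < q) (h2 : q < 2) : 2 < conjP q := by
  rw [conjP, lt_div_iff₀ (by linarith)]; linarith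

private lemma deltaRatio_spec {p a : ℝ} (hp : 2 < p) (ha0 : 0 < a) (ha2 : a ≤ 2) :
    IsDeltaRatio p a (deltaRatio p a) :=
  Classical.epsilon_spec (existsUnique_deltaRatio hp ha0 ha2).exists

private lemma etaRatio_spec {a : ℝ} (ha0 : 0 < a) : IsEtaRatio a (etaRatio a) :=
  Classical.epsilon_spec (existsUnique_etaRatio ha0).exists

private lemma powState_bounds {p : ℝ} (hp : 2 < p) (k : ℕ) :
    0 < (powState p k).1 ∧ (powState p k).1 ≤ 2 ∧ 0 < (powState p k).2 := by
  induction k with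
  | zero => simp [powState]
  | succ k ih =>
    obtain ⟨h0, h2, hδ⟩ := ih
    obtain ⟨hx0, hx1, hx⟩ := deltaRatio_spec hp h0 h2
    have hd := deriv_aux (convex_delta (2 * p / (2 + (powState p k).1)) hp) (by simp) hx0 hx1 hx
      (deriv_delta _ hx0)
    have hpos := Real.rpow_pos_of_pos hx0 (p - 1)
    simp only [powState]
    refine ⟨?_, ?_, mul_pos hx0 hδ⟩
    · have h3 : p * deltaRatio p (powState p k).1 ^ (p - 1) < 2 * p / (2 + (powState p k).1) := by
        linarith
      rw [lt_div_iff₀ (by linarith)] at h3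
      nlinarith
    · nlinarith

private lemma expState_bounds (k : ℕ) :
    0 < (expState k).1 ∧ (expState k).1 ≤ 2 ∧ 0 < (expState k).2 := by
  induction k with
  | zero => simp [expState]
  | succ k ih =>
    obtain ⟨h0, h2, hδ⟩ := ih
    obtain ⟨hx0, hx1, hx⟩ := etaRatio_spec h0
    have hd := deriv_aux (convex_eta (c := 2 / (2 + (expState k).1)) (by positivity)) (by simp)
      hx0 hx1 hx (deriv_eta _ hx0)
    simp only [expState]
    refine ⟨?_, ?_, mul_pos hx0 hδ⟩
    · have h3 : 1 < 2 / (2 + (expState k).1) / etaRatio (expState k).1 := by linarith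
      rw [lt_div_iff₀ hx0, lt_div_iff₀ (by linarith)] at h3
      linarith
    · nlinarith

/-- For `1 < q < 2` the sequences are well defined and satisfy the recurrence formulas. -/
theorem recurrence_pow {q : ℝ} (h1 : 1 < q) (h2 : q < 2) :
    aSeq q 1 = 2 ∧ deltaSeq q 1 = 1 ∧ ∀ k : ℕ, 1 ≤ k →
      0 < aSeq q k ∧ aSeq q k ≤ 2 ∧ 0 < deltaSeq q (k + 1) ∧ deltaSeq q (k + 1) < deltaSeq q k ∧
      2 * conjP q / (2 + aSeq q k) * (1 - deltaSeq q (k + 1) / deltaSeq q k) - 1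
        + (deltaSeq q (k + 1) / deltaSeq q k) ^ conjP q = 0 ∧
      aSeq q (k + 1) =
        2 - (deltaSeq q (k + 1) / deltaSeq q k) ^ (conjP q - 1) * (2 + aSeq q k) := by
  have hq : q ≠ 1 := h1.ne'
  refine ⟨by simp [aSeq, hq, powState], by simp [deltaSeq, hq, powState], ?_⟩
  intro k hk
  obtain ⟨k, rfl⟩ := Nat.exists_eq_add_of_le' hk
  have hp := two_lt_conjP h1 h2
  obtain ⟨b0, b2, bδ⟩ := powState_bounds hp k
  obtain ⟨hx0, hx1, hx⟩ := deltaRatio_spec hp b0 b2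
  simp only [aSeq, deltaSeq, hq, if_false, Nat.add_sub_cancel]
  have hr : (powState (conjP q) (k + 1)).2 / (powState (conjP q) k).2
      = deltaRatio (conjP q) (powState (conjP q) k).1 := by
    simp only [powState]
    field_simp
  rw [hr]
  refine ⟨b0, b2, (powState_bounds hp (k + 1)).2.2, ?_, hx, by simp only [powState]⟩
  simp only [powState]
  nlinarith

/-- For `q = 1` the sequences are well defined and satisfy the recurrence formulas. -/
theorem recurrence_one :
    aSeq 1 1 = 2 ∧ etaSeq 1 1 = 1 ∧ ∀ k : ℕ, 1 ≤ k →
      0 < aSeq 1 k ∧ aSeq 1 k ≤ 2 ∧ 0 < etaSeq 1 (k + 1) ∧ etaSeq 1 (k + 1) < etaSeq 1 k ∧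
      2 / (2 + aSeq 1 k) * Real.log (etaSeq 1 k / etaSeq 1 (k + 1)) - 1
        + etaSeq 1 (k + 1) / etaSeq 1 k = 0 ∧
      aSeq 1 (k + 1) = 2 - etaSeq 1 (k + 1) / etaSeq 1 k * (2 + aSeq 1 k) := by
  refine ⟨by simp [aSeq, expState], by simp [etaSeq, expState], ?_⟩
  intro k hk
  obtain ⟨k, rfl⟩ := Nat.exists_eq_add_of_le' hk
  obtain ⟨b0, b2, bδ⟩ := expState_bounds k
  obtain ⟨hx0, hx1, hx⟩ := etaRatio_spec b0
  simp only [aSeq, etaSeq, if_true, Nat.add_sub_cancel]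
  have hr : (expState (k + 1)).2 / (expState k).2 = etaRatio (expState k).1 := by
    simp only [expState]
    field_simp
  have hr' : (expState k).2 / (expState (k + 1)).2 = 1 / etaRatio (expState k).1 := by
    rw [← hr, one_div_div]
  rw [hr, hr']
  refine ⟨b0, b2, (expState_bounds (k + 1)).2.2, ?_, hx, by simp only [expState]⟩
  simp only [expState]
  nlinarith

/-! ### Limit profiles, scaling and convergence -/

/-- `b_k = (√2 / a_k)^{a_k}`. -/
def bSeq (q : ℝ) (k : ℕ) : ℝ := (Real.sqrt 2 / aSeq q k) ^ aSeq q k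

/-- The limit profile `z_k`, on `[0,∞)` if `k = 1` and on `(0,∞)` if `k > 1`. -/
def bubble (q : ℝ) (k : ℕ) (r : ℝ) : ℝ :=
  Real.log (2 * aSeq q k ^ 2 * bSeq q k /
    (r ^ (2 - aSeq q k) * (1 + bSeq q k * r ^ aSeq q k) ^ 2))

/-- The rescaling `s ↦ g'(u(c)) (u(γ s) - u(c))` of `u` around the centre `c` at scale `γ`. -/
def rescale (f : ℝ → ℝ) (t₀ : ℝ) (u : ℝ → ℝ) (c γ s : ℝ) : ℝ :=
  dg f t₀ (u c) * (u (γ * s) - u c)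

/-- The `C^2([A,B])` norm `∑_{i ≤ 2} sup_{[A,B]} |w^{(i)}|`, with values in `[0,∞]`. -/
def c2Norm (A B : ℝ) (w : ℝ → ℝ) : ENNReal :=
  ∑ i ∈ Finset.range 3, ⨆ s ∈ Icc A B, ‖iteratedDerivWithin i w (Icc A B) s‖ₑ

/-- The heights satisfy `y_n = μ_n - (c + o(1)) g(μ_n)/g'(μ_n)` as `n → ∞`. -/
def HasHeight (f : ℝ → ℝ) (t₀ : ℝ) (mu : ℕ → ℝ) (c : ℝ) (y : ℕ → ℝ) : Prop :=
  ∃ e : ℕ → ℝ, Tendsto e atTop (𝓝 0) ∧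
    ∀ᶠ n in atTop, y n = mu n - (c + e n) * (g f (mu n) / dg f t₀ (mu n))

end

end InfConc

open InfConc

namespace InfConc

/-! ### Calculus and sequence helpers -/

/-! In the variable τ = log r the equation reads -U'' = κ(τ) Λ e^{2τ} f(U), where κ → 1 as τ → -∞,
and ω = -U' = -r u'(r) is the energy accumulated up to r. Write N = g and D = g'. The hypothesis on
g'^2/(g g'') says that D, as a function of N, varies regularly with exponent 1/q. Moreover a
displacement of U that is o(N/D) changes neither N nor D to leading order (`Growth.slow`).

Inside a bubble. Near a height v one may therefore freeze D at D(v). The normalised mass m = D(v)ω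
and the normalised density K = D(v) Λ e^{2τ} f(U) then obey the Liouville system m' = K, K' = K(2 -
m) up to small errors, and (2 - m)^2/2 + K is almost conserved (`Family.energy_sub_le`). If the
solution reaches a region of negligible density with mass 2 - a, the first integral is a^2/2. The
mass is then driven through 2, where K is close to a^2/2 (`Family.exists_center`), up to 2 + a
(`Family.exists_quiet_exit`). The profile is z_k and the energy is 2a. A Gronwall comparison started
at the centre gives convergence (`Family.profile_tendsto`, and `Family.origin_tendsto` up to r = 0
for the first bubble).

Between two bubbles. The density is negligible, ω is almost constant, and U falls linearly in τ. By
regular variation the fall from N(v) to y N(v) takes a time close to N(v) `drop q y` / (2 + a),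
during which log K changes by about N(v) (2/(2+a) `drop q y` - 1 + y). This is negative until y
reaches the root of the bracket in (0,1), where the next bubble can start
(`Family.exists_quiet_next`). There D has been multiplied by y^{1/q}, so the normalised mass is
y^{1/q}(2 + a) = 2 - a', with a' the next value of a. These are the recurrence formulas, with
η_{k+1} = y η_k, and η_k = δ_k^p when q > 1 (`recurrence_eta`).

Induction on k gives all centres (`Family.exists_centers`). Windows around them whose logarithmic
size grows slowly with n provide the radii and the C^2 convergence (`concentration_of_window`). The
recurrence determines every limit, so the whole sequence converges and no compactness argument is
needed. -/

theorem le_of_hasDerivAt_nonneg {f f' : ℝ → ℝ} {a b : ℝ} (hab : a ≤ b)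
    (hc : ContinuousOn f (Icc a b)) (hd : ∀ x ∈ Ioo a b, HasDerivAt f (f' x) x)
    (h0 : ∀ x ∈ Ioo a b, 0 ≤ f' x) : f a ≤ f b := by
  have := monotoneOn_of_deriv_nonneg (convex_Icc a b) hc
    (fun x hx => by
      rw [interior_Icc] at hx
      exact (hd x hx).differentiableAt.differentiableWithinAt)
    (fun x hx => by
      rw [interior_Icc] at hx
      rw [(hd x hx).deriv]; exact h0 x hx)
  exact this (left_mem_Icc.2 hab) (right_mem_Icc.2 hab) hab

theorem abs_sub_le_of_hasDerivAt {f f' g g' : ℝ → ℝ} {a b : ℝ} (hab : a ≤ b)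
    (hfc : ContinuousOn f (Icc a b)) (hgc : ContinuousOn g (Icc a b))
    (hf : ∀ x ∈ Ioo a b, HasDerivAt f (f' x) x) (hg : ∀ x ∈ Ioo a b, HasDerivAt g (g' x) x)
    (h : ∀ x ∈ Ioo a b, |f' x| ≤ g' x) : |f b - f a| ≤ g b - g a := by
  have h1 := le_of_hasDerivAt_nonneg (f := fun x => g x - f x) hab (hgc.sub hfc)
    (fun x hx => (hg x hx).fun_sub (hf x hx)) (fun x hx => by linarith [(abs_le.1 (h x hx)).2])
  have h2 := le_of_hasDerivAt_nonneg (f := fun x => g x + f x) hab (hgc.add hfc)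
    (fun x hx => (hg x hx).fun_add (hf x hx)) (fun x hx => by linarith [(abs_le.1 (h x hx)).1])
  rw [abs_le]
  constructor <;> linarith

/-- Diagonal choice: `b m` exceeds m and the threshold of property m, and `M n` is the largest m ≤ n
with `b m ≤ n`. It lets a parameter that is fixed in an estimate, such as the size of a window, grow
slowly with n. -/
theorem exists_slow_of_eventually {P : ℕ → ℕ → Prop} (hP : ∀ m, ∀ᶠ n in atTop, P m n) :
    ∃ M : ℕ → ℕ, Tendsto M atTop atTop ∧ ∀ᶠ n in atTop, P (M n) n := by
  choose a ha using fun m => eventually_atTop.1 (hP m)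
  let b : ℕ → ℕ := fun m => m + ∑ i ∈ Finset.range (m + 1), a i
  have hab : ∀ m, a m ≤ b m := fun m =>
    (Finset.single_le_sum (f := a) (fun i _ => Nat.zero_le _)
      (Finset.mem_range.2 (Nat.lt_succ_self m))).trans (Nat.le_add_left _ _)
  classical
  let M : ℕ → ℕ := fun n => Nat.findGreatest (fun m => b m ≤ n) n
  refine ⟨M, ?_, ?_⟩
  · refine tendsto_atTop.2 fun m => ?_
    filter_upwards [eventually_ge_atTop (b m)] with n hn
    exact Nat.le_findGreatest ((Nat.le_add_right _ _).trans hn) hn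
  · filter_upwards [eventually_ge_atTop (b 0)] with n hn
    have : b (M n) ≤ n := Nat.findGreatest_spec (P := fun m => b m ≤ n) (Nat.zero_le n) hn
    exact ha _ _ ((hab _).trans this)

/-- The diagonal choice for iterated limits: n → ∞ at fixed m, followed by m → ∞, is replaced by one
limit along m = `M n`. -/
theorem exists_slow_tendsto {α : Type*} [PseudoMetricSpace α] {F : ℕ → ℕ → α} {l : ℕ → α} {L : α}
    {P : ℕ → ℕ → Prop} (hF : ∀ m, Tendsto (F m) atTop (𝓝 (l m))) (hl : Tendsto l atTop (𝓝 L))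
    (hP : ∀ m, ∀ᶠ n in atTop, P m n) :
    ∃ M : ℕ → ℕ, Tendsto M atTop atTop ∧ Tendsto (fun n => F (M n) n) atTop (𝓝 L) ∧
      ∀ᶠ n in atTop, P (M n) n := by
  have : ∀ m : ℕ, ∀ᶠ n in atTop, dist (F m n) (l m) < 1 / ((m : ℝ) + 1) ∧ P m n := fun m =>
    ((Metric.tendsto_nhds.1 (hF m)) _ (by positivity)).and (hP m)
  obtain ⟨M, hM, h⟩ := exists_slow_of_eventually this
  refine ⟨M, hM, ?_, h.mono fun n hn => hn.2⟩
  have h1 : Tendsto (fun n => dist (F (M n) n) (l (M n))) atTop (𝓝 0) :=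
    squeeze_zero' (Eventually.of_forall fun _ => dist_nonneg) (h.mono fun n hn => hn.1.le)
      (tendsto_one_div_add_atTop_nhds_zero_nat.comp hM)
  have h2 := hl.comp hM
  exact (tendsto_iff_of_dist (by simpa [dist_comm] using h1)).1 h2

theorem tendsto_of_abs_sub_le {ι : Type*} {l : Filter ι} {x e : ι → ℝ} {c : ℝ}
    (h : ∀ᶠ i in l, |x i - c| ≤ e i) (he : Tendsto e l (𝓝 0)) : Tendsto x l (𝓝 c) := by
  rw [tendsto_iff_dist_tendsto_zero]
  exact squeeze_zero' (Eventually.of_forall fun _ => dist_nonneg)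
    (by simpa [Real.dist_eq] using h) he

/-! ### Nonlinearities of generalized exponential growth -/

/-- `N = log f` with its derivatives `D`, `D2`, on a half-line `[T,∞)` on which `N` is already
in its asymptotic regime. -/
structure Growth (f N D D2 : ℝ → ℝ) (T q : ℝ) : Prop where
  one_le : 1 ≤ q
  T_pos : 0 < T
  hasDeriv : ∀ t, T ≤ t → HasDerivAt N (D t) t
  hasDeriv2 : ∀ t, T ≤ t → HasDerivAt D (D2 t) t
  N_pos : ∀ t, T ≤ t → 0 < N t
  D_pos : ∀ t, T ≤ t → 0 < D t
  D2_pos : ∀ t, T ≤ t → 0 < D2 t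
  exp_N : ∀ t, T ≤ t → f t = Real.exp (N t)
  ratio_le : ∀ t, T ≤ t → N t * D2 t / D t ^ 2 ≤ 2
  ratio_tendsto : Tendsto (fun t => N t * D2 t / D t ^ 2) atTop (𝓝 (1 / q))
  N_tendsto : Tendsto N atTop atTop
  f_nonneg : ∀ t, 0 ≤ t → 0 ≤ f t
  f_le : ∀ t v, 0 ≤ t → t ≤ v → T ≤ v → f t ≤ f v

/-- `∫_y^1 s^{-1/q} ds`. -/
noncomputable def drop (q y : ℝ) : ℝ :=
  if q = 1 then -Real.log y else (1 - y ^ (1 - 1 / q)) / (1 - 1 / q)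

theorem drop_one (q : ℝ) : drop q 1 = 0 := by
  unfold drop; split_ifs <;> simp

theorem hasDerivAt_drop {q y : ℝ} (hq : 1 ≤ q) (hy : 0 < y) :
    HasDerivAt (drop q) (-(y ^ (-(1 / q)))) y := by
  by_cases h : q = 1
  · subst h
    have : drop 1 = fun y => -Real.log y := by ext; simp [drop]
    rw [this]
    refine (Real.hasDerivAt_log hy.ne').fun_neg.congr_deriv ?_
    simp [Real.rpow_neg_one]
  · have hk : 1 - 1 / q ≠ 0 := by
      have : 1 < q := lt_of_le_of_ne hq (Ne.symm h)
      have : 1 / q < 1 := by rw [div_lt_one (by linarith)]; exact this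
      linarith
    have : drop q = fun y => (1 - y ^ (1 - 1 / q)) / (1 - 1 / q) := by ext; simp [drop, h]
    rw [this]
    refine (((Real.hasDerivAt_rpow_const (p := 1 - 1 / q) (Or.inl hy.ne')).const_sub 1).div_const
      (1 - 1 / q)).congr_deriv ?_
    rw [show 1 - 1 / q - 1 = -(1 / q) by ring]
    field_simp

theorem continuousAt_drop {q y : ℝ} (hq : 1 ≤ q) (hy : 0 < y) : ContinuousAt (drop q) y :=
  (hasDerivAt_drop hq hy).continuousAt

theorem drop_nonneg {q y : ℝ} (hq : 1 ≤ q) (hy : 0 < y) (h1 : y ≤ 1) : 0 ≤ drop q y := by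
  have := le_of_hasDerivAt_nonneg (f := fun x => -drop q x) h1
    (fun x hx => (continuousAt_drop hq (hy.trans_le hx.1)).continuousWithinAt.neg)
    (fun x hx => (hasDerivAt_drop hq (hy.trans hx.1)).fun_neg)
    (fun x hx => by simpa using Real.rpow_nonneg (hy.trans hx.1).le _)
  simp only [drop_one] at this
  linarith

theorem drop_pos {q y : ℝ} (hq : 1 ≤ q) (hy : 0 < y) (h1 : y < 1) : 0 < drop q y := by
  have hm : (y + 1) / 2 ≤ 1 := by linarith
  have hx := le_of_hasDerivAt_nonneg (f := fun x => -drop q x - x) h1.le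
    (fun x hx => ((continuousAt_drop hq (hy.trans_le hx.1)).continuousWithinAt.neg).sub
      continuousWithinAt_id)
    (fun x hx => ((hasDerivAt_drop hq (hy.trans hx.1)).fun_neg).fun_sub (hasDerivAt_id x))
    (fun x hx => by
      have : 1 ≤ x ^ (-(1 / q)) :=
        Real.one_le_rpow_of_pos_of_le_one_of_nonpos (hy.trans hx.1) hx.2.le
          (by simp; linarith)
      simpa using this)
  simp only [drop_one] at hx
  linarith

/-! ### Consequences of regular variation: local stability of N and D, and their change over long
ranges. -/

namespace Growth

variable {f N D D2 : ℝ → ℝ} {T q : ℝ}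

theorem mono_N (G : Growth f N D D2 T q) {s t : ℝ} (hs : T ≤ s) (hst : s ≤ t) : N s ≤ N t :=
  le_of_hasDerivAt_nonneg hst
    (fun x hx => (G.hasDeriv x (hs.trans hx.1)).continuousAt.continuousWithinAt)
    (fun x hx => G.hasDeriv x (hs.trans hx.1.le)) (fun x hx => (G.D_pos x (hs.trans hx.1.le)).le)

theorem mono_D (G : Growth f N D D2 T q) {s t : ℝ} (hs : T ≤ s) (hst : s ≤ t) : D s ≤ D t :=
  le_of_hasDerivAt_nonneg hst
    (fun x hx => (G.hasDeriv2 x (hs.trans hx.1)).continuousAt.continuousWithinAt)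
    (fun x hx => G.hasDeriv2 x (hs.trans hx.1.le)) (fun x hx => (G.D2_pos x (hs.trans hx.1.le)).le)

theorem sub_le_D_mul (G : Growth f N D D2 T q) {s t : ℝ} (hs : T ≤ s) (hst : s ≤ t) :
    N t - N s ≤ D t * (t - s) := by
  have := le_of_hasDerivAt_nonneg (f := fun x => D t * x - N x) (f' := fun x => D t - D x) hst
    (fun x hx => (continuous_const.mul continuous_id).continuousWithinAt.sub
      (G.hasDeriv x (hs.trans hx.1)).continuousAt.continuousWithinAt)
    (fun x hx => by simpa using ((hasDerivAt_id x).const_mul (D t)).fun_sub (G.hasDeriv x (hs.trans hx.1.le)))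
    (fun x hx => by linarith [G.mono_D (hs.trans hx.1.le) hx.2.le])
  linarith

theorem D_mul_le_sub (G : Growth f N D D2 T q) {s t : ℝ} (hs : T ≤ s) (hst : s ≤ t) :
    D s * (t - s) ≤ N t - N s := by
  have := le_of_hasDerivAt_nonneg (f := fun x => N x - D s * x) (f' := fun x => D x - D s) hst
    (fun x hx => (G.hasDeriv x (hs.trans hx.1)).continuousAt.continuousWithinAt.sub
      (continuous_const.mul continuous_id).continuousWithinAt)
    (fun x hx => by simpa using (G.hasDeriv x (hs.trans hx.1.le)).fun_sub ((hasDerivAt_id x).const_mul (D s)))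
    (fun x hx => by linarith [G.mono_D hs hx.1.le])
  linarith

theorem lt_of_N_lt (G : Growth f N D D2 T q) {s t : ℝ} (ht : T ≤ t) (hN : N s < N t) :
    s < t := by
  by_contra h
  exact absurd (G.mono_N ht (not_lt.1 h)) (not_le.2 hN)

theorem f_pos (G : Growth f N D D2 T q) {t : ℝ} (ht : T ≤ t) : 0 < f t := by
  rw [G.exp_N t ht]; exact Real.exp_pos _

/-- `N / D`. -/
theorem hasDerivAt_psi (G : Growth f N D D2 T q) {t : ℝ} (ht : T ≤ t) :
    HasDerivAt (fun x => N x / D x) (1 - N t * D2 t / D t ^ 2) t := by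
  have hD := (G.D_pos t ht).ne'
  refine ((G.hasDeriv t ht).fun_div (G.hasDeriv2 t ht) hD).congr_deriv ?_
  field_simp

theorem psi_pos (G : Growth f N D D2 T q) {t : ℝ} (ht : T ≤ t) : 0 < N t / D t :=
  div_pos (G.N_pos t ht) (G.D_pos t ht)

theorem abs_deriv_psi_le (G : Growth f N D D2 T q) {t : ℝ} (ht : T ≤ t) :
    |1 - N t * D2 t / D t ^ 2| ≤ 1 := by
  have h1 := G.ratio_le t ht
  have h2 : 0 ≤ N t * D2 t / D t ^ 2 :=
    div_nonneg (mul_nonneg (G.N_pos t ht).le (G.D2_pos t ht).le) (sq_nonneg _)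
  rw [abs_le]; constructor <;> linarith

/-- The constant 2 in `ratio_le` puts the derivative of N/D in [-1,1]. That N/D is 1-Lipschitz is
what makes a displacement o(N/D) negligible. -/
theorem abs_psi_sub_le (G : Growth f N D D2 T q) {s t : ℝ} (hs : T ≤ s) (hst : s ≤ t) :
    |N t / D t - N s / D s| ≤ t - s :=
  abs_sub_le_of_hasDerivAt (g := fun x => x) (g' := fun _ => 1) hst
    (fun x hx => (G.hasDerivAt_psi (hs.trans hx.1)).continuousAt.continuousWithinAt)
    continuousOn_id
    (fun x hx => G.hasDerivAt_psi (hs.trans hx.1.le)) (fun x _ => hasDerivAt_id x)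
    (fun x hx => G.abs_deriv_psi_le (hs.trans hx.1.le))

theorem hasDerivAt_log_N (G : Growth f N D D2 T q) {t : ℝ} (ht : T ≤ t) :
    HasDerivAt (fun x => Real.log (N x)) (D t / N t) t :=
  (G.hasDeriv t ht).log (G.N_pos t ht).ne'

theorem hasDerivAt_log_D (G : Growth f N D D2 T q) {t : ℝ} (ht : T ≤ t) :
    HasDerivAt (fun x => Real.log (D x)) (D2 t / D t) t :=
  (G.hasDeriv2 t ht).log (G.D_pos t ht).ne'

/-- If `min s t ≥ T` and `|t - s|` is smaller than `N/D` at `t`, the variation of `log N` is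
controlled. -/
theorem abs_log_N_sub_le (G : Growth f N D D2 T q) {s t : ℝ} (hs : T ≤ s) (ht : T ≤ t)
    (h : |t - s| < N t / D t) :
    |Real.log (N s) - Real.log (N t)| ≤ |t - s| / (N t / D t - |t - s|) := by
  have key : ∀ x, T ≤ x → |t - x| ≤ |t - s| → |D x / N x| ≤ 1 / (N t / D t - |t - s|) := by
    intro x hx hxs
    have h1 : |N x / D x - N t / D t| ≤ |t - x| := by
      rcases le_total x t with hxt | hxt
      · rw [abs_sub_comm, abs_of_nonneg (by linarith : 0 ≤ t - x)]; exact G.abs_psi_sub_le hx hxt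
      · rw [abs_sub_comm t x, abs_of_nonneg (by linarith : 0 ≤ x - t)]
        exact G.abs_psi_sub_le ht hxt
    have h2 : N t / D t - |t - s| ≤ N x / D x := by linarith [(abs_le.1 h1).1]
    rw [abs_of_pos (div_pos (G.D_pos x hx) (G.N_pos x hx)), ← one_div_div (N x)]
    exact one_div_le_one_div_of_le (by linarith) h2
  have hder : ∀ c : ℝ, ∀ x, HasDerivAt (fun y : ℝ => c * y) c x := fun c x => by
    simpa using (hasDerivAt_id x).const_mul c
  rcases le_total s t with hst | hst
  · rw [abs_sub_comm]
    refine (abs_sub_le_of_hasDerivAt (f := fun x => Real.log (N x))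
      (g := fun x => 1 / (N t / D t - |t - s|) * x) (g' := fun _ => 1 / (N t / D t - |t - s|)) hst
      (fun x hx => (G.hasDerivAt_log_N (hs.trans hx.1)).continuousAt.continuousWithinAt)
      (continuous_const.mul continuous_id).continuousOn
      (fun x hx => G.hasDerivAt_log_N (hs.trans hx.1.le)) (fun x _ => hder _ x)
      (fun x hx => key x (hs.trans hx.1.le) ?_)).trans (le_of_eq ?_)
    · rw [abs_of_nonneg (by linarith [hx.2]), abs_of_nonneg (by linarith)]; linarith [hx.1]
    · rw [abs_of_nonneg (by linarith : 0 ≤ t - s)]; ring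
  · refine (abs_sub_le_of_hasDerivAt (f := fun x => Real.log (N x))
      (g := fun x => 1 / (N t / D t - |t - s|) * x) (g' := fun _ => 1 / (N t / D t - |t - s|)) hst
      (fun x hx => (G.hasDerivAt_log_N (ht.trans hx.1)).continuousAt.continuousWithinAt)
      (continuous_const.mul continuous_id).continuousOn
      (fun x hx => G.hasDerivAt_log_N (ht.trans hx.1.le)) (fun x _ => hder _ x)
      (fun x hx => key x (ht.trans hx.1.le) ?_)).trans (le_of_eq ?_)
    · rw [abs_sub_comm t x, abs_sub_comm t s, abs_of_nonneg (by linarith [hx.1]),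
        abs_of_nonneg (by linarith)]; linarith [hx.2]
    · rw [abs_sub_comm t s, abs_of_nonneg (by linarith : 0 ≤ s - t)]; ring

/-- Displacements which are `o(N/D)` change neither `N` nor `D` to leading order. -/
theorem slow (G : Growth f N D D2 T q) {v w : ℕ → ℝ} (hv : Tendsto v atTop atTop)
    (hw : Tendsto (fun n => D (v n) * |w n - v n| / N (v n)) atTop (𝓝 0)) :
    Tendsto w atTop atTop ∧ Tendsto (fun n => N (w n) / N (v n)) atTop (𝓝 1) ∧
      Tendsto (fun n => D (w n) / D (v n)) atTop (𝓝 1) := by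
  set e : ℕ → ℝ := fun n => D (v n) * |w n - v n| / N (v n) with he
  have hvT : ∀ᶠ n in atTop, T ≤ v n := hv.eventually_ge_atTop T
  have hde : ∀ᶠ n in atTop, |w n - v n| = e n * (N (v n) / D (v n)) := by
    filter_upwards [hvT] with n hn
    have h1 := (G.D_pos _ hn).ne'
    have h2 := (G.N_pos _ hn).ne'
    simp only [he]; field_simp
  -- The Lipschitz bound gives N/D ≤ v + const at v, so a displacement of at most half of N/D leaves
  -- w ≥ v/2 - const.
  have hwinf : Tendsto w atTop atTop := by
    have h1 : Tendsto (fun n => v n / 2 - (|T| + N T / D T)) atTop atTop :=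
      tendsto_atTop_add_const_right _ _ (hv.atTop_div_const (by norm_num))
    refine tendsto_atTop_mono' _ ?_ h1
    filter_upwards [hvT, hde, hw.eventually (gt_mem_nhds (show (0:ℝ) < 1 / 2 by norm_num))]
      with n hn h2 h3
    have h4 := (abs_le.1 (G.abs_psi_sub_le le_rfl hn)).2
    have h5 := G.psi_pos hn
    have h6 := (abs_le.1 h2.le).1
    have h7 : e n * (N (v n) / D (v n)) ≤ 1 / 2 * (N (v n) / D (v n)) :=
      mul_le_mul_of_nonneg_right h3.le h5.le
    have h8 := neg_abs_le T
    have := G.psi_pos le_rfl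
    have := abs_nonneg T
    linarith
  have hwT : ∀ᶠ n in atTop, T ≤ w n := hwinf.eventually_ge_atTop T
  have hNlog : Tendsto (fun n => Real.log (N (w n) / N (v n))) atTop (𝓝 0) := by
    have h1 : Tendsto (fun n => e n / (1 - e n)) atTop (𝓝 0) := by
      have := hw.div (tendsto_const_nhds.sub hw : Tendsto (fun n => 1 - e n) atTop (𝓝 (1 - 0)))
        (by norm_num)
      simpa [Pi.div_def] using this
    refine tendsto_of_abs_sub_le ?_ h1
    filter_upwards [hvT, hwT, hde, hw.eventually (gt_mem_nhds (show (0:ℝ) < 1 / 2 by norm_num))]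
      with n hn hn' h2 h3
    have h5 := G.psi_pos hn
    have h3 : e n < 1 / 2 := h3
    have h4 : |v n - w n| = e n * (N (v n) / D (v n)) := by rw [abs_sub_comm]; exact h2
    have h6 := G.abs_log_N_sub_le hn' hn (by rw [h4]; nlinarith)
    rw [sub_zero, Real.log_div (G.N_pos _ hn').ne' (G.N_pos _ hn).ne']
    refine h6.trans (le_of_eq ?_)
    rw [h4]
    have : 1 - e n ≠ 0 := by linarith
    have h7 : N (v n) / D (v n) - e n * (N (v n) / D (v n)) = (1 - e n) * (N (v n) / D (v n)) := by
      ring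
    rw [h7, mul_div_mul_right _ _ h5.ne']
  have hN : Tendsto (fun n => N (w n) / N (v n)) atTop (𝓝 1) := by
    have := (Real.continuous_exp.tendsto 0).comp hNlog
    rw [Real.exp_zero] at this
    refine this.congr' ?_
    filter_upwards [hvT, hwT] with n hn hn'
    exact Real.exp_log (div_pos (G.N_pos _ hn') (G.N_pos _ hn))
  -- The relative change of N/D is at most `e n` by the Lipschitz bound. The ratio of the D's is
  -- then the ratio of the N's divided by this one.
  have hpsi : Tendsto (fun n => N (w n) / D (w n) / (N (v n) / D (v n))) atTop (𝓝 1) := by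
    refine tendsto_of_abs_sub_le ?_ hw
    filter_upwards [hvT, hwT, hde] with n hn hn' h2
    have h5 := G.psi_pos hn
    have h6 : |N (w n) / D (w n) - N (v n) / D (v n)| ≤ |w n - v n| := by
      rcases le_total (w n) (v n) with hh | hh
      · rw [abs_sub_comm, abs_sub_comm (w n), abs_of_nonneg (by linarith : 0 ≤ v n - w n)]
        exact G.abs_psi_sub_le hn' hh
      · rw [abs_of_nonneg (by linarith : 0 ≤ w n - v n)]
        exact G.abs_psi_sub_le hn hh
    rw [div_sub_one h5.ne', abs_div, abs_of_pos h5, div_le_iff₀ h5, ← h2]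
    exact h6
  refine ⟨hwinf, hN, ?_⟩
  have := hN.div hpsi one_ne_zero
  rw [div_one] at this
  refine this.congr' ?_
  filter_upwards [hvT, hwT] with n hn hn'
  have h1 := (G.D_pos _ hn).ne'
  have h2 := (G.N_pos _ hn).ne'
  have h3 := (G.D_pos _ hn').ne'
  have h4 := (G.N_pos _ hn').ne'
  simp only [Pi.div_apply]
  field_simp

theorem tendsto_of_N_tendsto (G : Growth f N D D2 T q) {w : ℕ → ℝ} (hw : ∀ᶠ n in atTop, T ≤ w n)
    (hN : Tendsto (fun n => N (w n)) atTop atTop) : Tendsto w atTop atTop := by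
  refine tendsto_atTop.2 fun B => ?_
  filter_upwards [hw, hN.eventually_gt_atTop (N (max B T))] with n h1 h2
  exact (le_max_left _ _).trans (G.lt_of_N_lt h1 h2).le

/-- `D` varies regularly as a function of `N`, with exponent `1/q`. -/
theorem log_D_sub (G : Growth f N D D2 T q) {ε : ℝ} (hε : 0 < ε) :
    ∃ T', T ≤ T' ∧ ∀ s t, T' ≤ s → s ≤ t →
      |Real.log (D t / D s) - 1 / q * Real.log (N t / N s)| ≤ ε * Real.log (N t / N s) := by
  obtain ⟨T', hT'⟩ := eventually_atTop.1
    ((Metric.tendsto_nhds.1 G.ratio_tendsto ε hε).and (eventually_ge_atTop T))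
  refine ⟨max T T', le_max_left _ _, fun s t hs hst => ?_⟩
  have hsT : T ≤ s := (le_max_left _ _).trans hs
  have htT : T ≤ t := hsT.trans hst
  have h := abs_sub_le_of_hasDerivAt
    (f := fun x => Real.log (D x) - 1 / q * Real.log (N x))
    (f' := fun x => D2 x / D x - 1 / q * (D x / N x))
    (g := fun x => ε * Real.log (N x)) (g' := fun x => ε * (D x / N x)) hst
    (fun x hx => ((G.hasDerivAt_log_D (hsT.trans hx.1)).sub
      ((G.hasDerivAt_log_N (hsT.trans hx.1)).const_mul _)).continuousAt.continuousWithinAt)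
    (fun x hx => ((G.hasDerivAt_log_N (hsT.trans hx.1)).const_mul _).continuousAt.continuousWithinAt)
    (fun x hx => (G.hasDerivAt_log_D (hsT.trans hx.1.le)).fun_sub
      ((G.hasDerivAt_log_N (hsT.trans hx.1.le)).const_mul _))
    (fun x hx => (G.hasDerivAt_log_N (hsT.trans hx.1.le)).const_mul _)
    (fun x hx => by
      have hxT := hsT.trans hx.1.le
      have h1 := G.D_pos x hxT
      have h2 := G.N_pos x hxT
      have h3 := (hT' x ((le_max_right _ _).trans (hs.trans hx.1.le))).1
      rw [Real.dist_eq] at h3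
      have h4 : D2 x / D x - 1 / q * (D x / N x)
          = (N x * D2 x / D x ^ 2 - 1 / q) * (D x / N x) := by
        field_simp
      rw [h4, abs_mul, abs_of_pos (div_pos h1 h2)]
      exact mul_le_mul_of_nonneg_right h3.le (div_pos h1 h2).le)
  rw [Real.log_div (G.D_pos t htT).ne' (G.D_pos s hsT).ne',
    Real.log_div (G.N_pos t htT).ne' (G.N_pos s hsT).ne']
  calc _ = |Real.log (D t) - 1 / q * Real.log (N t) - (Real.log (D s) - 1 / q * Real.log (N s))| := by
        congr 1; ring
    _ ≤ _ := h
    _ = _ := by ring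

/-- The error in `log_D_sub` is ε times the range of log N. That range stays bounded since y > 0, so
ε may be taken arbitrarily small before exponentiating. -/
theorem D_ratio_tendsto (G : Growth f N D D2 T q) {v w : ℕ → ℝ} {y : ℝ} (hy : 0 < y)
    (hv : Tendsto v atTop atTop) (hw : Tendsto w atTop atTop) (hwv : ∀ᶠ n in atTop, w n ≤ v n)
    (hN : Tendsto (fun n => N (w n) / N (v n)) atTop (𝓝 y)) :
    Tendsto (fun n => D (w n) / D (v n)) atTop (𝓝 (y ^ (1 / q))) := by
  have hlogN : Tendsto (fun n => Real.log (N (v n) / N (w n))) atTop (𝓝 (-Real.log y)) := by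
    have := ((Real.continuousAt_log hy.ne').tendsto.comp hN).neg
    refine this.congr fun n => ?_
    simp only [Function.comp]
    rw [← Real.log_inv, inv_div]
  have hlogD : Tendsto (fun n => Real.log (D (v n) / D (w n)) - 1 / q * Real.log (N (v n) / N (w n)))
      atTop (𝓝 0) := by
    rw [Metric.tendsto_nhds]
    intro ε hε
    have hc : 0 < |Real.log y| + 1 := by positivity
    obtain ⟨T', hT', h⟩ := G.log_D_sub (ε := ε / (|Real.log y| + 1)) (by positivity)
    have hlt : -Real.log y < |Real.log y| + 1 := by linarith [neg_le_abs (Real.log y)]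
    filter_upwards [hw.eventually_ge_atTop T', hwv, hlogN.eventually (gt_mem_nhds hlt)] with n h1 h2 h3
    rw [Real.dist_eq, sub_zero]
    refine (h _ _ h1 h2).trans_lt ?_
    calc ε / (|Real.log y| + 1) * Real.log (N (v n) / N (w n))
        < ε / (|Real.log y| + 1) * (|Real.log y| + 1) :=
          mul_lt_mul_of_pos_left h3 (by positivity)
      _ = ε := by field_simp
  have h1 := (hlogD.add (hlogN.const_mul (1 / q))).neg
  have h2 := (Real.continuous_exp.tendsto _).comp h1
  have e : Real.exp (-(0 + 1 / q * -Real.log y)) = y ^ (1 / q) := by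
    rw [Real.rpow_def_of_pos hy]; congr 1; ring
  rw [e] at h2
  refine h2.congr' ?_
  filter_upwards [hv.eventually_ge_atTop T, hw.eventually_ge_atTop T] with n hn hn'
  simp only [Function.comp, sub_add_cancel]
  rw [← Real.log_inv, inv_div, Real.exp_log (div_pos (G.D_pos _ hn') (G.D_pos _ hn))]

/-- The x-derivative of `drop q (N x / N v)` is -(N x/N v)^{-1/q} D x / N v. Regular variation makes
D x / D v close to (N x/N v)^{1/q}, so this derivative is nearly the constant -D v / N v.
Integration from w to v gives the limit. -/
theorem drop_tendsto (G : Growth f N D D2 T q) {v w : ℕ → ℝ} {y : ℝ} (hy : 0 < y)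
    (hw : Tendsto w atTop atTop) (hwv : ∀ᶠ n in atTop, w n ≤ v n)
    (hN : Tendsto (fun n => N (w n) / N (v n)) atTop (𝓝 y)) :
    Tendsto (fun n => D (v n) * (v n - w n) / N (v n)) atTop (𝓝 (drop q y)) := by
  set X : ℕ → ℝ := fun n => D (v n) * (v n - w n) / N (v n) with hX
  have hS : Tendsto (fun n => drop q (N (w n) / N (v n))) atTop (𝓝 (drop q y)) :=
    (continuousAt_drop G.one_le hy).tendsto.comp hN
  have key : ∀ ε : ℝ, 0 < ε → ε ≤ 1 / 2 → ∀ᶠ n in atTop,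
      |drop q (N (w n) / N (v n)) - X n| ≤ ε * X n := by
    intro ε hε hε2
    have hlt : -Real.log y < |Real.log y| + 1 := by linarith [neg_le_abs (Real.log y)]
    have hc : 0 < |Real.log y| + 1 := by positivity
    obtain ⟨T', hT', h⟩ := G.log_D_sub (ε := ε / 2 / (|Real.log y| + 1)) (by positivity)
    have hlogN : Tendsto (fun n => Real.log (N (v n) / N (w n))) atTop (𝓝 (-Real.log y)) := by
      have := ((Real.continuousAt_log hy.ne').tendsto.comp hN).neg
      refine this.congr fun n => ?_
      simp only [Function.comp]
      rw [← Real.log_inv, inv_div]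
    filter_upwards [hw.eventually_ge_atTop T', hwv, hlogN.eventually (gt_mem_nhds hlt)] with n h1 h2 h3
    have hwT := hT'.trans h1
    have hvT := hwT.trans h2
    have hNv := G.N_pos _ hvT
    have hDv := G.D_pos _ hvT
    have hdiv : ∀ x, w n ≤ x → 0 < N x / N (v n) := fun x hx =>
      div_pos (G.N_pos _ (hwT.trans hx)) hNv
    have hder : ∀ x, w n ≤ x → HasDerivAt (fun x => drop q (N x / N (v n)) - D (v n) / N (v n) * (v n - x))
        (D (v n) / N (v n) * (1 - (N x / N (v n)) ^ (-(1 / q)) * (D x / D (v n)))) x := by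
      intro x hx
      have a1 := (hasDerivAt_drop G.one_le (hdiv x hx)).comp x
        ((G.hasDeriv x (hwT.trans hx)).div_const (N (v n)))
      have a2 := ((hasDerivAt_id x).const_sub (v n)).const_mul (D (v n) / N (v n))
      refine (a1.sub a2).congr_deriv ?_
      field_simp
      ring
    have hb := abs_sub_le_of_hasDerivAt
      (g := fun x => D (v n) / N (v n) * ε * x) (g' := fun _ => D (v n) / N (v n) * ε) h2
      (fun x hx => (hder x hx.1).continuousAt.continuousWithinAt)
      (continuous_const.mul continuous_id).continuousOn
      (fun x hx => hder x hx.1.le)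
      (fun x _ => by simpa using (hasDerivAt_id x).const_mul (D (v n) / N (v n) * ε))
      (fun x hx => by
        rw [abs_mul, abs_of_pos (div_pos hDv hNv)]
        refine mul_le_mul_of_nonneg_left ?_ (div_pos hDv hNv).le
        have hxT := hwT.trans hx.1.le
        have b1 := h x (v n) (h1.trans hx.1.le) hx.2.le
        have b2 : Real.log (N (v n) / N x) ≤ |Real.log y| + 1 := by
          refine le_trans ?_ h3.le
          refine Real.log_le_log (div_pos hNv (G.N_pos _ hxT)) ?_
          exact div_le_div_of_nonneg_left hNv.le (G.N_pos _ hwT) (G.mono_N hwT hx.1.le)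
        have b3 : |Real.log (D (v n) / D x) - 1 / q * Real.log (N (v n) / N x)| ≤ ε / 2 := by
          refine b1.trans ?_
          calc _ ≤ ε / 2 / (|Real.log y| + 1) * (|Real.log y| + 1) :=
                mul_le_mul_of_nonneg_left b2 (by positivity)
            _ = ε / 2 := by field_simp
        set L := Real.log (D (v n) / D x) - 1 / q * Real.log (N (v n) / N x) with hL
        -- The factor that should be close to 1 is exp(-L), with L the error of regular variation on
        -- [x, v].
        have b4 : (N x / N (v n)) ^ (-(1 / q)) * (D x / D (v n)) = Real.exp (-L) := by
          rw [Real.rpow_def_of_pos (hdiv x hx.1.le), hL,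
            ← Real.exp_log (div_pos (G.D_pos _ hxT) hDv), ← Real.exp_add]
          congr 1
          rw [← inv_div (D x), ← inv_div (N x), Real.log_inv, Real.log_inv]
          ring
        rw [b4, abs_sub_comm]
        have b5 := Real.abs_exp_sub_one_le (x := -L) (by rw [abs_neg]; linarith)
        rw [abs_neg] at b5
        linarith)
    have hone : N (v n) / N (v n) = 1 := div_self hNv.ne'
    simp only [hone, drop_one, sub_self, mul_zero] at hb
    have hXe : D (v n) / N (v n) * (v n - w n) = X n := by simp only [hX]; ring
    rw [hXe, zero_sub, abs_neg] at hb
    refine hb.trans (le_of_eq ?_)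
    simp only [hX]; ring
  have hXb : ∀ᶠ n in atTop, |X n| ≤ 2 * (drop q y + 1) := by
    filter_upwards [key (1 / 2) (by norm_num) le_rfl,
      hS.eventually (gt_mem_nhds (lt_add_one (drop q y)))] with n h1 h2
    have h3 : 0 ≤ X n := by
      by_contra hneg
      have := (abs_nonneg _).trans h1
      linarith
    rw [abs_of_nonneg h3]
    linarith [(abs_le.1 h1).1]
  have hdiff : Tendsto (fun n => drop q (N (w n) / N (v n)) - X n) atTop (𝓝 0) := by
    rw [Metric.tendsto_nhds]
    intro ε hε
    have hy1 : y ≤ 1 := by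
      refine le_of_tendsto hN ?_
      filter_upwards [hwv, hw.eventually_ge_atTop T] with n h1 h2
      rw [div_le_one (G.N_pos _ (h2.trans h1))]
      exact G.mono_N h2 h1
    have hB : 0 < 2 * (drop q y + 1) + 1 := by linarith [drop_nonneg G.one_le hy hy1]
    have hmin : 0 < min (1 / 2) (ε / (2 * (drop q y + 1) + 1)) := by positivity
    filter_upwards [key _ hmin (min_le_left _ _), hXb] with n h1 h2
    rw [Real.dist_eq, sub_zero]
    refine h1.trans_lt ?_
    have h3 : 0 ≤ X n := by
      by_contra hneg
      have := (abs_nonneg _).trans h1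
      nlinarith
    have h4 : X n < 2 * (drop q y + 1) + 1 := by linarith [le_abs_self (X n)]
    calc _ ≤ ε / (2 * (drop q y + 1) + 1) * X n := mul_le_mul_of_nonneg_right (min_le_right _ _) h3
      _ < ε / (2 * (drop q y + 1) + 1) * (2 * (drop q y + 1) + 1) :=
        mul_lt_mul_of_pos_left h4 (by positivity)
      _ = ε := by field_simp
  simpa using hS.sub hdiff

/-- `N/(tD) → 1 - 1/q`. -/
theorem psi_div_tendsto (G : Growth f N D D2 T q) :
    Tendsto (fun t => N t / D t / t) atTop (𝓝 (1 - 1 / q)) := by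
  rw [Metric.tendsto_nhds]
  intro ε hε
  obtain ⟨T', hT'⟩ := eventually_atTop.1
    ((Metric.tendsto_nhds.1 G.ratio_tendsto (ε / 2) (by positivity)).and (eventually_ge_atTop T))
  set S := max T T' with hS
  have hST : T ≤ S := le_max_left _ _
  set C := |N S / D S - (1 - 1 / q) * S| with hC
  have hlim : Tendsto (fun t : ℝ => C / t) atTop (𝓝 0) := tendsto_const_nhds.div_atTop tendsto_id
  filter_upwards [eventually_ge_atTop S, hlim.eventually (gt_mem_nhds (half_pos hε))] with t ht hCt
  have htpos : 0 < t := G.T_pos.trans_le (hST.trans ht)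
  have h := abs_sub_le_of_hasDerivAt
    (f := fun x => N x / D x - (1 - 1 / q) * x)
    (f' := fun x => 1 - N x * D2 x / D x ^ 2 - (1 - 1 / q))
    (g := fun x => ε / 2 * x) (g' := fun x => ε / 2) ht
    (fun x hx => (G.hasDerivAt_psi (hST.trans hx.1)).continuousAt.continuousWithinAt.sub
      (continuous_const.mul continuous_id).continuousWithinAt)
    (continuous_const.mul continuous_id).continuousOn
    (fun x hx => by
      simpa using (G.hasDerivAt_psi (hST.trans hx.1.le)).fun_sub
        ((hasDerivAt_id x).const_mul (1 - 1 / q)))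
    (fun x _ => by simpa using (hasDerivAt_id x).const_mul (ε / 2))
    (fun x hx => by
      have h3 := (hT' x ((le_max_right _ _).trans hx.1.le)).1
      rw [Real.dist_eq, abs_sub_comm] at h3
      calc _ = |1 / q - N x * D2 x / D x ^ 2| := by congr 1; ring
        _ ≤ _ := h3.le)
  rw [Real.dist_eq]
  have h1 : N t / D t / t - (1 - 1 / q) = (N t / D t - (1 - 1 / q) * t) / t := by
    field_simp
  rw [h1, abs_div, abs_of_pos htpos]
  have h2 : |N t / D t - (1 - 1 / q) * t| ≤ C + ε / 2 * (t - S) := by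
    have := abs_sub_abs_le_abs_sub (N t / D t - (1 - 1 / q) * t) (N S / D S - (1 - 1 / q) * S)
    linarith
  have hSpos : 0 < S := G.T_pos.trans_le hST
  have h3 : |N t / D t - (1 - 1 / q) * t| / t ≤ C / t + ε / 2 := by
    rw [div_le_iff₀ htpos, add_mul, div_mul_cancel₀ _ htpos.ne']
    nlinarith
  linarith

end Growth

theorem le_of_hasDerivAt_nonneg_atBot {f f' : ℝ → ℝ} {b l : ℝ}
    (hc : ContinuousOn f (Iic b)) (hd : ∀ x < b, HasDerivAt f (f' x) x)
    (h0 : ∀ x < b, 0 ≤ f' x) (hl : Tendsto f atBot (𝓝 l)) : l ≤ f b := by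
  refine le_of_tendsto hl ?_
  filter_upwards [eventually_le_atBot b] with a hab
  exact le_of_hasDerivAt_nonneg hab (hc.mono Icc_subset_Iic_self) (fun x hx => hd x hx.2)
    (fun x hx => h0 x hx.2)

/-! ### Families of radial solutions in logarithmic coordinates -/

/-- The density `Λ e^{2τ} f(U(τ))`. -/
noncomputable def dens (f : ℝ → ℝ) (Λ : ℝ) (U : ℝ → ℝ) (τ : ℝ) : ℝ :=
  Λ * Real.exp (2 * τ) * f (U τ)

/-- A sequence of solutions of `-U'' = κ(τ) Λ e^{2τ} f(U)` on `(-∞,0]` with `U(0) = 0` and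
`U(-∞) = μ → ∞`; `ω = -U'`. -/
structure Family (f κ : ℝ → ℝ) (Λ mu : ℕ → ℝ) (U ω : ℕ → ℝ → ℝ) (c C : ℝ) : Prop where
  Λ_pos : ∀ n, 0 < Λ n
  mu_tendsto : Tendsto mu atTop atTop
  c_pos : 0 < c
  κ_ge : ∀ τ ≤ 0, c ≤ κ τ
  κ_le : ∀ τ ≤ 0, κ τ ≤ C
  κ_tendsto : Tendsto κ atBot (𝓝 1)
  hasDeriv_U : ∀ n, ∀ τ < 0, HasDerivAt (U n) (-ω n τ) τ
  hasDeriv_ω : ∀ n, ∀ τ < 0, HasDerivAt (ω n) (κ τ * dens f (Λ n) (U n) τ) τ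
  cont_U : ∀ n, ContinuousOn (U n) (Iic 0)
  cont_ω : ∀ n, ContinuousOn (ω n) (Iic 0)
  U_zero : ∀ n, U n 0 = 0
  U_nonneg : ∀ n, ∀ τ ≤ 0, 0 ≤ U n τ
  U_tendsto : ∀ n, Tendsto (U n) atBot (𝓝 (mu n))
  ω_tendsto : ∀ n, Tendsto (ω n) atBot (𝓝 0)

/-- A sequence of points outside of the bubbles: the density is small, but not exponentially so;
`x` is the height and `c` the accumulated mass. -/
structure Quiet (f N D : ℝ → ℝ) (Λ mu : ℕ → ℝ) (U ω : ℕ → ℝ → ℝ) (x c : ℝ) (τ : ℕ → ℝ) :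
    Prop where
  neg : ∀ᶠ n in atTop, τ n < 0
  top : Tendsto (fun n => U n (τ n)) atTop atTop
  height : Tendsto (fun n => N (U n (τ n)) / N (mu n)) atTop (𝓝 x)
  mass : Tendsto (fun n => D (U n (τ n)) * ω n (τ n)) atTop (𝓝 c)
  density : Tendsto (fun n => D (U n (τ n)) * dens f (Λ n) (U n) (τ n)) atTop (𝓝 0)
  log_density : Tendsto (fun n => Real.log (D (U n (τ n)) * dens f (Λ n) (U n) (τ n)) / N (mu n))
    atTop (𝓝 0)

/-- A sequence of centres of bubbles. -/
structure Center (f N D : ℝ → ℝ) (Λ mu : ℕ → ℝ) (U ω : ℕ → ℝ → ℝ) (x a : ℝ) (τ : ℕ → ℝ) :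
    Prop where
  neg : ∀ᶠ n in atTop, τ n < 0
  top : Tendsto (fun n => U n (τ n)) atTop atTop
  height : Tendsto (fun n => N (U n (τ n)) / N (mu n)) atTop (𝓝 x)
  mass : Tendsto (fun n => D (U n (τ n)) * ω n (τ n)) atTop (𝓝 2)
  density : Tendsto (fun n => D (U n (τ n)) * dens f (Λ n) (U n) (τ n)) atTop (𝓝 (a ^ 2 / 2))

namespace Family

variable {f N D D2 κ : ℝ → ℝ} {T q c C : ℝ} {Λ mu : ℕ → ℝ} {U ω : ℕ → ℝ → ℝ}

theorem C_pos (F : Family f κ Λ mu U ω c C) : 0 < C :=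
  F.c_pos.trans_le ((F.κ_ge 0 le_rfl).trans (F.κ_le 0 le_rfl))

theorem κ_pos (F : Family f κ Λ mu U ω c C) {τ : ℝ} (hτ : τ ≤ 0) : 0 < κ τ :=
  F.c_pos.trans_le (F.κ_ge τ hτ)

theorem dens_nonneg (F : Family f κ Λ mu U ω c C) (G : Growth f N D D2 T q) (n : ℕ) {τ : ℝ}
    (hτ : τ ≤ 0) : 0 ≤ dens f (Λ n) (U n) τ :=
  mul_nonneg (mul_nonneg (F.Λ_pos n).le (Real.exp_pos _).le) (G.f_nonneg _ (F.U_nonneg n τ hτ))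

theorem dens_pos (F : Family f κ Λ mu U ω c C) (G : Growth f N D D2 T q) (n : ℕ) {τ : ℝ}
    (hU : T ≤ U n τ) : 0 < dens f (Λ n) (U n) τ :=
  mul_pos (mul_pos (F.Λ_pos n) (Real.exp_pos _)) (G.f_pos hU)

theorem mono_ω (F : Family f κ Λ mu U ω c C) (G : Growth f N D D2 T q) (n : ℕ) {s t : ℝ}
    (hst : s ≤ t) (ht : t ≤ 0) : ω n s ≤ ω n t :=
  le_of_hasDerivAt_nonneg hst ((F.cont_ω n).mono fun _ hx => hx.2.trans ht)
    (fun x hx => F.hasDeriv_ω n x (hx.2.trans_le ht))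
    (fun x hx => mul_nonneg (F.κ_pos (hx.2.le.trans ht)).le (F.dens_nonneg G n (hx.2.le.trans ht)))

theorem ω_nonneg (F : Family f κ Λ mu U ω c C) (G : Growth f N D D2 T q) (n : ℕ) {t : ℝ}
    (ht : t ≤ 0) : 0 ≤ ω n t := by
  refine le_of_tendsto (F.ω_tendsto n) ?_
  filter_upwards [eventually_le_atBot t] with a hab
  exact F.mono_ω G n hab ht

theorem sub_le (F : Family f κ Λ mu U ω c C) (G : Growth f N D D2 T q) (n : ℕ) {s t : ℝ}
    (hst : s ≤ t) (ht : t ≤ 0) : U n s - U n t ≤ ω n t * (t - s) := by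
  have := le_of_hasDerivAt_nonneg (f := fun x => ω n t * x + U n x)
    (f' := fun x => ω n t + -ω n x) hst
    ((continuous_const.mul continuous_id).continuousOn.add
      ((F.cont_U n).mono fun _ hx => hx.2.trans ht))
    (fun x hx => by
      simpa using ((hasDerivAt_id x).const_mul (ω n t)).fun_add (F.hasDeriv_U n x (hx.2.trans_le ht)))
    (fun x hx => by linarith [F.mono_ω G n hx.2.le ht])
  linarith

theorem le_sub (F : Family f κ Λ mu U ω c C) (G : Growth f N D D2 T q) (n : ℕ) {s t : ℝ}
    (hst : s ≤ t) (ht : t ≤ 0) : ω n s * (t - s) ≤ U n s - U n t := by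
  have := le_of_hasDerivAt_nonneg (f := fun x => -(ω n s * x) - U n x)
    (f' := fun x => -ω n s - -ω n x) hst
    ((continuous_const.mul continuous_id).neg.continuousOn.sub
      ((F.cont_U n).mono fun _ hx => hx.2.trans ht))
    (fun x hx => by
      simpa using ((hasDerivAt_id x).const_mul (ω n s)).fun_neg.fun_sub
        (F.hasDeriv_U n x (hx.2.trans_le ht)))
    (fun x hx => by linarith [F.mono_ω G n hx.1.le (hx.2.le.trans ht)])
  linarith

theorem anti_U (F : Family f κ Λ mu U ω c C) (G : Growth f N D D2 T q) (n : ℕ) {s t : ℝ}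
    (hst : s ≤ t) (ht : t ≤ 0) : U n t ≤ U n s := by
  have h1 := F.le_sub G n hst ht
  have h2 := mul_nonneg (F.ω_nonneg G n (hst.trans ht)) (sub_nonneg.2 hst)
  linarith

theorem U_le (F : Family f κ Λ mu U ω c C) (G : Growth f N D D2 T q) (n : ℕ) {t : ℝ}
    (ht : t ≤ 0) : U n t ≤ mu n := by
  refine ge_of_tendsto (F.U_tendsto n) ?_
  filter_upwards [eventually_le_atBot t] with a hab
  exact F.anti_U G n hab ht

theorem dens_eq (G : Growth f N D D2 T q) (n : ℕ) {s t : ℝ}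
    (hs : T ≤ U n s) (ht : T ≤ U n t) : dens f (Λ n) (U n) t
      = dens f (Λ n) (U n) s * Real.exp (2 * (t - s) - (N (U n s) - N (U n t))) := by
  unfold dens
  rw [G.exp_N _ hs, G.exp_N _ ht]
  have : Real.exp (2 * t) * Real.exp (N (U n t)) = Real.exp (2 * s) * Real.exp (N (U n s)) *
      Real.exp (2 * (t - s) - (N (U n s) - N (U n t))) := by
    rw [← Real.exp_add, ← Real.exp_add, ← Real.exp_add]; congr 1; ring
  rw [mul_assoc, this]; ring

theorem dens_le (F : Family f κ Λ mu U ω c C) (G : Growth f N D D2 T q) (n : ℕ) {s t : ℝ}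
    (hst : s ≤ t) (ht : t ≤ 0) (hs : T ≤ U n s) : dens f (Λ n) (U n) t
      ≤ Real.exp (2 * (t - s)) * dens f (Λ n) (U n) s := by
  unfold dens
  have h1 := G.f_le _ _ (F.U_nonneg n t ht) (F.anti_U G n hst ht) hs
  have h2 : Real.exp (2 * t) = Real.exp (2 * (t - s)) * Real.exp (2 * s) := by
    rw [← Real.exp_add]; congr 1; ring
  rw [h2]
  have h3 : 0 ≤ Λ n * (Real.exp (2 * (t - s)) * Real.exp (2 * s)) :=
    mul_nonneg (F.Λ_pos n).le (by positivity)
  calc _ ≤ Λ n * (Real.exp (2 * (t - s)) * Real.exp (2 * s)) * f (U n s) :=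
        mul_le_mul_of_nonneg_left h1 h3
    _ = _ := by ring

theorem hasDerivAt_dens (F : Family f κ Λ mu U ω c C) (G : Growth f N D D2 T q) (n : ℕ) {t : ℝ}
    (ht : t < 0) (hU : T < U n t) : HasDerivAt (dens f (Λ n) (U n))
      (dens f (Λ n) (U n) t * (2 - D (U n t) * ω n t)) t := by
  have hcont := (F.hasDeriv_U n t ht).continuousAt
  have h1 : (fun s => Λ n * Real.exp (2 * s) * Real.exp (N (U n s))) =ᶠ[𝓝 t]
      dens f (Λ n) (U n) := by
    filter_upwards [hcont.eventually (lt_mem_nhds hU)] with s hs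
    unfold dens
    rw [G.exp_N _ (le_of_lt hs)]
  have h2 := (((hasDerivAt_id t).const_mul 2).exp.const_mul (Λ n)).mul
    ((G.hasDeriv _ hU.le).comp t (F.hasDeriv_U n t ht)).exp
  refine (h2.congr_of_eventuallyEq h1.symm).congr_deriv ?_
  unfold dens
  rw [G.exp_N _ hU.le]
  simp only [id, Function.comp]
  ring

/-- Since U decreases, the density grows by at most e^{2M} during time M. Hence the mass and the
fall of U stay bounded in units of 1/D(U), taken at the starting point. -/
theorem mul_dens_le_of_le {τ : ℕ → ℝ} (F : Family f κ Λ mu U ω c C) (G : Growth f N D D2 T q)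
    {B : ℝ} (hτ : ∀ᶠ n in atTop, τ n ≤ 0)
    (htop : Tendsto (fun n => U n (τ n)) atTop atTop)
    (hω : ∀ᶠ n in atTop, D (U n (τ n)) * ω n (τ n) ≤ B)
    (hK : ∀ᶠ n in atTop, D (U n (τ n)) * dens f (Λ n) (U n) (τ n) ≤ B) {M : ℝ} (hM : 0 ≤ M) :
    ∀ᶠ n in atTop, τ n + M < 0 ∧
      D (U n (τ n)) * ω n (τ n + M) ≤ B + M * (C * Real.exp (2 * M) * B) ∧
      D (U n (τ n)) * (U n (τ n) - U n (τ n + M)) ≤ M * (B + M * (C * Real.exp (2 * M) * B)) := by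
  set B' := B + M * (C * Real.exp (2 * M) * B) with hB'
  have hDT := G.D_pos T le_rfl
  filter_upwards [hτ, htop.eventually_gt_atTop (max T (M * B' / D T)), hω, hK] with n h1 h2 h3 h4
  have hUT : T ≤ U n (τ n) := (le_max_left _ _).trans h2.le
  have hD := G.D_pos _ hUT
  have hCp := F.C_pos
  have hBn : 0 ≤ B := (mul_nonneg hD.le (F.dens_nonneg G n h1)).trans h4
  have key : ∀ s, 0 ≤ s → s ≤ M → τ n + s ≤ 0 → D (U n (τ n)) * ω n (τ n + s) ≤ B' ∧
      D (U n (τ n)) * (U n (τ n) - U n (τ n + s)) ≤ M * B' := by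
    intro s hs0 hsM hs
    set K := dens f (Λ n) (U n) (τ n) with hKdef
    have hKn : 0 ≤ K := F.dens_nonneg G n h1
    have hle := le_of_hasDerivAt_nonneg (f := fun x => C * Real.exp (2 * M) * K * x - ω n x)
      (f' := fun x => C * Real.exp (2 * M) * K - κ x * dens f (Λ n) (U n) x)
      (show τ n ≤ τ n + s by linarith)
      ((continuous_const.mul continuous_id).continuousOn.sub
        ((F.cont_ω n).mono fun _ hx => hx.2.trans hs))
      (fun x hx => by
        simpa using ((hasDerivAt_id x).const_mul (C * Real.exp (2 * M) * K)).fun_sub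
          (F.hasDeriv_ω n x (hx.2.trans_le hs)))
      (fun x hx => by
        have hx0 : x ≤ 0 := hx.2.le.trans hs
        have a1 := F.dens_le G n hx.1.le hx0 hUT
        have a2 : Real.exp (2 * (x - τ n)) ≤ Real.exp (2 * M) :=
          Real.exp_le_exp.2 (by linarith [hx.2])
        have a3 : dens f (Λ n) (U n) x ≤ Real.exp (2 * M) * K :=
          a1.trans (mul_le_mul_of_nonneg_right a2 hKn)
        have a4 := mul_le_mul (F.κ_le x hx0) a3 (F.dens_nonneg G n hx0) hCp.le
        linarith)
    have e1 : ω n (τ n + s) ≤ ω n (τ n) + s * (C * Real.exp (2 * M) * K) := by linarith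
    have e2 : D (U n (τ n)) * ω n (τ n + s) ≤ B' := by
      have e3 : s * (C * Real.exp (2 * M) * (D (U n (τ n)) * K))
          ≤ M * (C * Real.exp (2 * M) * B) := by
        refine mul_le_mul hsM ?_ (by positivity) hM
        exact mul_le_mul_of_nonneg_left h4 (by positivity)
      have e4 := mul_le_mul_of_nonneg_left e1 hD.le
      rw [hB']; linarith
    refine ⟨e2, ?_⟩
    have e5 := F.sub_le G n (show τ n ≤ τ n + s by linarith) hs
    have e6 := mul_le_mul_of_nonneg_left e5 hD.le
    have e7 : s * (D (U n (τ n)) * ω n (τ n + s)) ≤ M * B' :=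
      mul_le_mul hsM e2 (mul_nonneg hD.le (F.ω_nonneg G n hs)) hM
    linarith
  -- Reaching τ = 0 within time M would mean a fall by the whole of U, since U vanishes there. But
  -- D(U) U → ∞, while the normalised fall is bounded.
  have hneg : τ n + M < 0 := by
    by_contra hcon
    push Not at hcon
    have h5 := (key (-τ n) (by linarith) (by linarith) (by linarith)).2
    rw [add_neg_cancel, F.U_zero, sub_zero] at h5
    have h6 : M * B' / D T < U n (τ n) := (le_max_right _ _).trans_lt h2
    rw [div_lt_iff₀ hDT] at h6
    have h7 := G.mono_D le_rfl hUT
    have h8 : 0 < U n (τ n) := G.T_pos.trans_le hUT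
    nlinarith
  exact ⟨hneg, key M hM le_rfl hneg.le⟩

/-- Points with bounded normalised mass and density are at distance more than any M from τ = 0. This
is where κ → 1 becomes available. -/
theorem tendsto_atBot_of_bounded {τ : ℕ → ℝ} (F : Family f κ Λ mu U ω c C)
    (G : Growth f N D D2 T q) {B : ℝ} (hτ : ∀ᶠ n in atTop, τ n ≤ 0)
    (htop : Tendsto (fun n => U n (τ n)) atTop atTop)
    (hω : ∀ᶠ n in atTop, D (U n (τ n)) * ω n (τ n) ≤ B)
    (hK : ∀ᶠ n in atTop, D (U n (τ n)) * dens f (Λ n) (U n) (τ n) ≤ B) :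
    Tendsto τ atTop atBot := by
  refine tendsto_atBot.2 fun b => ?_
  filter_upwards [F.mul_dens_le_of_le G hτ htop hω hK (abs_nonneg b)] with n hn
  linarith [hn.1, neg_abs_le b]

theorem N_mu_tendsto (F : Family f κ Λ mu U ω c C) (G : Growth f N D D2 T q) :
    Tendsto (fun n => N (mu n)) atTop atTop := G.N_tendsto.comp F.mu_tendsto

/-- The first quiet points lie just before the first bubble. -/
theorem exists_quiet_one (F : Family f κ Λ mu U ω c C) (G : Growth f N D D2 T q) :
    ∃ τ, Quiet f N D Λ mu U ω 1 0 τ := by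
  have hCp := F.C_pos
  have hmuT : ∀ᶠ n in atTop, T ≤ mu n := F.mu_tendsto.eventually_ge_atTop T
  have hN := F.N_mu_tendsto G
  set W : ℕ → ℝ := fun n => Λ n * f (mu n) * D (mu n) * N (mu n) with hW
  -- The choice makes Λ e^{2τ} f(μ) D(μ) equal to 1/N(μ): it tends to 0, and its logarithm -log N(μ)
  -- is o(N(μ)), as a quiet point requires.
  set τ : ℕ → ℝ := fun n => -(Real.log (W n)) / 2 with hτ
  have hWpos : ∀ᶠ n in atTop, 0 < W n := by
    filter_upwards [hmuT] with n hn
    exact mul_pos (mul_pos (mul_pos (F.Λ_pos n) (G.f_pos hn)) (G.D_pos _ hn)) (G.N_pos _ hn)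
  have hexp : ∀ᶠ n in atTop, Λ n * Real.exp (2 * τ n) * f (mu n) * (D (mu n) * N (mu n)) = 1 := by
    filter_upwards [hWpos] with n hn
    have : Real.exp (2 * τ n) = (W n)⁻¹ := by
      rw [hτ]; simp only
      rw [show 2 * (-Real.log (W n) / 2) = -Real.log (W n) by ring, Real.exp_neg, Real.exp_log hn]
    rw [this]
    have h2 : Λ n * f (mu n) * D (mu n) * N (mu n) = W n := rfl
    field_simp
    linarith
  -- estimates up to `min (τ n) 0`
  have hest : ∀ᶠ n in atTop, ∀ t, t ≤ τ n → t ≤ 0 →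
      D (mu n) * ω n t ≤ C / 2 * (N (mu n))⁻¹ ∧ D (mu n) * (mu n - U n t) ≤ C / 4 * (N (mu n))⁻¹ := by
    filter_upwards [hmuT, hexp] with n hn hex t htτ ht0
    have hD := G.D_pos _ hn
    have hNp := G.N_pos _ hn
    set A := Λ n * f (mu n) with hA
    have hAn : 0 < A := mul_pos (F.Λ_pos n) (G.f_pos hn)
    have hlim : Tendsto (fun x : ℝ => Real.exp (2 * x)) atBot (𝓝 0) :=
      Real.tendsto_exp_atBot.comp (tendsto_id.const_mul_atBot (by norm_num))
    have hdexp : ∀ x : ℝ, HasDerivAt (fun x : ℝ => Real.exp (2 * x)) (2 * Real.exp (2 * x)) x := by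
      intro x
      refine ((hasDerivAt_id x).const_mul 2).exp.congr_deriv ?_
      simp [mul_comm]
    have hcexp : Continuous fun x : ℝ => Real.exp (2 * x) := by fun_prop
    -- Up to such times f(U) ≤ f(μ), and the resulting bound on -U'' is integrated twice from -∞.
    have hω : ∀ s ≤ 0, ω n s ≤ C / 2 * A * Real.exp (2 * s) := by
      intro s hs
      have := le_of_hasDerivAt_nonneg_atBot (f := fun x => C / 2 * A * Real.exp (2 * x) - ω n x)
        (f' := fun x => C / 2 * A * (2 * Real.exp (2 * x)) - κ x * dens f (Λ n) (U n) x)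
        (b := s) (l := 0)
        ((continuous_const.mul hcexp).continuousOn.sub
          ((F.cont_ω n).mono (Iic_subset_Iic.2 hs)))
        (fun x hx => ((hdexp x).const_mul _).fun_sub (F.hasDeriv_ω n x (hx.trans_le hs)))
        (fun x hx => by
          have hx0 : x ≤ 0 := hx.le.trans hs
          have a1 : dens f (Λ n) (U n) x ≤ A * Real.exp (2 * x) := by
            unfold dens
            have := G.f_le _ _ (F.U_nonneg n x hx0) (F.U_le G n hx0) hn
            calc _ ≤ Λ n * Real.exp (2 * x) * f (mu n) :=
                  mul_le_mul_of_nonneg_left this (mul_nonneg (F.Λ_pos n).le (Real.exp_pos _).le)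
              _ = _ := by rw [hA]; ring
          have a2 := mul_le_mul (F.κ_le x hx0) a1 (F.dens_nonneg G n hx0) hCp.le
          linarith)
        (by simpa using (hlim.const_mul (C / 2 * A)).sub (F.ω_tendsto n))
      linarith
    have hU : mu n ≤ U n t + C / 4 * A * Real.exp (2 * t) :=
      le_of_hasDerivAt_nonneg_atBot (f := fun x => U n x + C / 4 * A * Real.exp (2 * x))
        (f' := fun x => -ω n x + C / 4 * A * (2 * Real.exp (2 * x)))
        (((F.cont_U n).mono (Iic_subset_Iic.2 ht0)).add (continuous_const.mul hcexp).continuousOn)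
        (fun x hx => (F.hasDeriv_U n x (hx.trans_le ht0)).fun_add ((hdexp x).const_mul _))
        (fun x hx => by linarith [hω x (hx.le.trans ht0)])
        (by simpa using (F.U_tendsto n).add (hlim.const_mul (C / 4 * A)))
    have hexp_le : D (mu n) * (A * Real.exp (2 * t)) ≤ (N (mu n))⁻¹ := by
      have h1 : Real.exp (2 * t) ≤ Real.exp (2 * τ n) := Real.exp_le_exp.2 (by linarith)
      have h2 : D (mu n) * (A * Real.exp (2 * τ n)) = (N (mu n))⁻¹ := by
        refine eq_inv_of_mul_eq_one_left ?_; rw [← hex, hA]; ring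
      rw [← h2]
      gcongr
    constructor
    · have := mul_le_mul_of_nonneg_left (hω t ht0) hD.le
      calc _ ≤ _ := this
        _ = C / 2 * (D (mu n) * (A * Real.exp (2 * t))) := by ring
        _ ≤ _ := mul_le_mul_of_nonneg_left hexp_le (by positivity)
    · have := mul_le_mul_of_nonneg_left (sub_le_iff_le_add'.2 hU) hD.le
      calc _ ≤ _ := this
        _ = C / 4 * (D (mu n) * (A * Real.exp (2 * t))) := by ring
        _ ≤ _ := mul_le_mul_of_nonneg_left hexp_le (by positivity)
  have hNinv : Tendsto (fun n => (N (mu n))⁻¹) atTop (𝓝 0) := hN.inv_tendsto_atTop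
  -- If τ ≥ 0, the estimate at time 0, where U = 0, would bound D(μ) μ by C/(4 N(μ)).
  have hneg : ∀ᶠ n in atTop, τ n < 0 := by
    have h1 : Tendsto (fun n => C / 4 * (N (mu n))⁻¹) atTop (𝓝 (C / 4 * 0)) := hNinv.const_mul _
    have hDT := G.D_pos T le_rfl
    rw [mul_zero] at h1
    filter_upwards [hest, hmuT, h1.eventually (gt_mem_nhds hDT),
      F.mu_tendsto.eventually_ge_atTop 1] with n h2 h3 h4 h5
    by_contra hcon
    have h6 := (h2 0 (not_lt.1 hcon) le_rfl).2
    rw [F.U_zero, sub_zero] at h6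
    have h7 := G.mono_D le_rfl h3
    have h4 : C / 4 * (N (mu n))⁻¹ < D T := h4
    nlinarith
  have hslow := G.slow F.mu_tendsto (w := fun n => U n (τ n)) (by
    have h1 : Tendsto (fun n => C / 4 * (N (mu n))⁻¹ * (N (mu n))⁻¹) atTop (𝓝 (C / 4 * 0 * 0)) :=
      (hNinv.const_mul _).mul hNinv
    simp only [mul_zero] at h1
    refine squeeze_zero' ?_ ?_ h1
    · filter_upwards [hmuT] with n h2
      exact div_nonneg (mul_nonneg (G.D_pos _ h2).le (abs_nonneg _)) (G.N_pos _ h2).le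
    · filter_upwards [hmuT, hneg, hest] with n h2 h3 h4
      rw [abs_sub_comm, abs_of_nonneg (sub_nonneg.2 (F.U_le G n h3.le)), div_eq_mul_inv]
      exact mul_le_mul_of_nonneg_right (h4 _ le_rfl h3.le).2 (inv_nonneg.2 (G.N_pos _ h2).le))
  obtain ⟨htop, hh, hDr⟩ := hslow
  have hX : Tendsto (fun n => D (U n (τ n)) * dens f (Λ n) (U n) (τ n) * N (mu n)) atTop (𝓝 1) := by
    have hdiff : Tendsto (fun n => N (U n (τ n)) - N (mu n)) atTop (𝓝 0) := by
      have h1 : Tendsto (fun n => C / 4 * (N (mu n))⁻¹) atTop (𝓝 (C / 4 * 0)) := hNinv.const_mul _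
      rw [mul_zero] at h1
      refine tendsto_of_abs_sub_le ?_ h1
      filter_upwards [hneg, hest, htop.eventually_ge_atTop T] with n h3 h4 h5
      have h6 := F.U_le G n h3.le
      rw [sub_zero, abs_sub_comm, abs_of_nonneg (sub_nonneg.2 (G.mono_N h5 h6))]
      exact (G.sub_le_D_mul h5 h6).trans (h4 _ le_rfl h3.le).2
    have := hDr.mul ((Real.continuous_exp.tendsto 0).comp hdiff)
    rw [Real.exp_zero, mul_one] at this
    refine this.congr' ?_
    filter_upwards [hmuT, hexp, htop.eventually_ge_atTop T] with n h1 h2 h3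
    simp only [Function.comp, dens]
    rw [G.exp_N _ h3, Real.exp_sub, ← G.exp_N _ h1]
    have h4 := (G.f_pos h1).ne'
    have h5 := (G.D_pos _ h1).ne'
    field_simp
    linear_combination (-D (U n (τ n))) * h2
  refine ⟨τ, hneg, htop, hh, ?_, ?_, ?_⟩
  · have h1 : Tendsto (fun n => C / 2 * (N (mu n))⁻¹) atTop (𝓝 (C / 2 * 0)) := hNinv.const_mul _
    rw [mul_zero] at h1
    refine squeeze_zero' ?_ ?_ h1
    · filter_upwards [hneg, htop.eventually_ge_atTop T] with n h2 h3
      exact mul_nonneg (G.D_pos _ h3).le (F.ω_nonneg G n h2.le)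
    · filter_upwards [hneg, htop.eventually_ge_atTop T, hest] with n h2 h3 h4
      exact (mul_le_mul_of_nonneg_right (G.mono_D h3 (F.U_le G n h2.le))
        (F.ω_nonneg G n h2.le)).trans (h4 _ le_rfl h2.le).1
  · have := hX.mul hNinv
    rw [mul_zero] at this
    refine this.congr' ?_
    filter_upwards [hmuT] with n h1
    have := (G.N_pos _ h1).ne'
    field_simp
  · have h1 : Tendsto (fun n => Real.log (N (mu n)) / N (mu n)) atTop (𝓝 0) :=
      (Real.isLittleO_log_id_atTop.tendsto_div_nhds_zero).comp hN
    have h2 := ((Real.continuousAt_log one_ne_zero).tendsto.comp hX).mul hNinv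
    have h3 := h2.sub h1
    rw [mul_zero, sub_zero] at h3
    refine h3.congr' ?_
    filter_upwards [hmuT, htop.eventually_ge_atTop T] with n h1 h4
    have h5 := (G.N_pos _ h1).ne'
    simp only [Function.comp]
    rw [Real.log_mul (mul_pos (G.D_pos _ h4) (F.dens_pos G n h4)).ne' h5]
    field_simp
    ring

end Family

/-! ### The passage between consecutive bubbles. -/

theorem Growth.chord {f N D D2 : ℝ → ℝ} {T q : ℝ} (G : Growth f N D D2 T q) {r s t : ℝ}
    (hr : T ≤ r) (hrs : r ≤ s) (hst : s ≤ t) :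
    (N t - N r) * (t - s) ≤ (N t - N s) * (t - r) := by
  have h1 := G.sub_le_D_mul hr hrs
  have h2 := G.D_mul_le_sub (hr.trans hrs) hst
  have h3 := mul_le_mul_of_nonneg_right h1 (sub_nonneg.2 hst)
  have h4 := mul_le_mul_of_nonneg_right h2 (sub_nonneg.2 hrs)
  linarith

/-- Between two bubbles the logarithm of the density is negative. -/
theorem transit_neg {q cc ys y : ℝ} (hq : 1 ≤ q) (hcc : 0 < cc) (h0 : 0 < ys)
    (hroot : 2 / cc * drop q ys - 1 + ys = 0) (hy : ys < y) (hy1 : y < 1) :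
    2 / cc * drop q y - 1 + y < 0 := by
  -- The function is strictly convex with zeros at `ys` and 1. A nonnegative value in between would
  -- give two mean-value slopes in the wrong order.
  by_contra hcon
  push Not at hcon
  have hder : ∀ z, 0 < z → HasDerivAt (fun y => 2 / cc * drop q y - 1 + y)
      (2 / cc * -(z ^ (-(1 / q))) + 1) z := fun z hz =>
    (((hasDerivAt_drop hq hz).const_mul _).sub_const 1).fun_add (hasDerivAt_id z)
  obtain ⟨a, ha, ha'⟩ := exists_hasDerivAt_eq_slope (fun y => 2 / cc * drop q y - 1 + y) _ hy
    (fun z hz => (hder z (h0.trans_le hz.1)).continuousAt.continuousWithinAt)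
    (fun z hz => hder z (h0.trans hz.1))
  obtain ⟨b, hb, hb'⟩ := exists_hasDerivAt_eq_slope (fun y => 2 / cc * drop q y - 1 + y) _ hy1
    (fun z hz => (hder z ((h0.trans hy).trans_le hz.1)).continuousAt.continuousWithinAt)
    (fun z hz => hder z ((h0.trans hy).trans hz.1))
  simp only [drop_one, hroot] at ha' hb'
  have h1 : 0 ≤ 2 / cc * -(a ^ (-(1 / q))) + 1 := by
    rw [ha']; exact div_nonneg (by linarith) (by linarith)
  have h2 : 2 / cc * -(b ^ (-(1 / q))) + 1 ≤ 0 := by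
    rw [hb']; exact div_nonpos_of_nonpos_of_nonneg (by linarith) (by linarith)
  have h3 : b ^ (-(1 / q)) < a ^ (-(1 / q)) :=
    Real.rpow_lt_rpow_of_neg (h0.trans ha.1) (ha.2.trans hb.1) (by simp; linarith)
  have h4 := mul_lt_mul_of_pos_left h3 (show 0 < 2 / cc by positivity)
  linarith

namespace Family

variable {f N D D2 κ : ℝ → ℝ} {T q c C : ℝ} {Λ mu : ℕ → ℝ} {U ω : ℕ → ℝ → ℝ}

/-- On the way from height `N₀` to `y N₀` the accumulated mass is almost constant. -/
theorem mass_growth_le (F : Family f κ Λ mu U ω c C) (G : Growth f N D D2 T q) (n : ℕ)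
    {s t m : ℝ} (hst : s ≤ t) (ht : t ≤ 0) (hT : T ≤ U n t) (hlt : U n t < U n s)
    (hω : 0 < ω n s) (hm : 0 < m)
    (hmeq : 2 / ω n s - (N (U n s) - N (U n t)) / (U n s - U n t) ≤ -m) :
    dens f (Λ n) (U n) t ≤ dens f (Λ n) (U n) s ∧
    ω n t ≤ ω n s + C * dens f (Λ n) (U n) s / (m * ω n s) := by
  have hsT : T ≤ U n s := hT.trans hlt.le
  have hs0 : s ≤ 0 := hst.trans ht
  set K := dens f (Λ n) (U n) s with hK
  have hKn : 0 ≤ K := F.dens_nonneg G n hs0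
  -- The elapsed time is at most the fall of U divided by ω(s). Convexity of N bounds its fall from
  -- below by the chord over the whole range. So the density decays exponentially in the fall of U,
  -- at rate m.
  have hdens : ∀ x, s ≤ x → x ≤ t →
      dens f (Λ n) (U n) x ≤ K * Real.exp (-(m * (U n s - U n x))) := by
    intro x hsx hxt
    have hUx := F.anti_U G n hxt ht
    have hUs := F.anti_U G n hsx (hxt.trans ht)
    rw [dens_eq G n hsT (hT.trans hUx)]
    refine mul_le_mul_of_nonneg_left (Real.exp_le_exp.2 ?_) hKn
    have h1 := F.le_sub G n hsx (hxt.trans ht)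
    have h2 : x - s ≤ (U n s - U n x) / ω n s := by rw [le_div_iff₀ hω]; linarith
    have h3 := G.chord hT hUx hUs
    have h4 : (N (U n s) - N (U n t)) / (U n s - U n t) * (U n s - U n x)
        ≤ N (U n s) - N (U n x) := by
      rw [div_mul_eq_mul_div, div_le_iff₀ (by linarith)]; exact h3
    have h5 := mul_le_mul_of_nonneg_right hmeq (sub_nonneg.2 hUs)
    have h6 : 2 / ω n s * (U n s - U n x) = 2 * ((U n s - U n x) / ω n s) := by ring
    linarith
  have hsub : Icc s t ⊆ Iic 0 := fun _ hx => hx.2.trans ht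
  have hderE : ∀ x ∈ Ioo s t, HasDerivAt (fun x => Real.exp (-(m * (U n s - U n x))))
      (Real.exp (-(m * (U n s - U n x))) * -(m * ω n x)) x := fun x hx => by
    refine ((((F.hasDeriv_U n x (hx.2.trans_le ht)).const_sub (U n s)).const_mul m).fun_neg.exp).congr_deriv ?_
    ring
  -- With U as variable, dτ = -dU/ω, and 1/ω ≤ 1/ω(s). The exponential bound therefore integrates to
  -- at most C K/(m ω(s)).
  have hmono := le_of_hasDerivAt_nonneg
    (f := fun x => -ω n x - C * K / (m * ω n s) * Real.exp (-(m * (U n s - U n x)))) hst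
    (((F.cont_ω n).mono hsub).neg.sub (continuousOn_const.mul
      (Real.continuous_exp.comp_continuousOn (continuousOn_const.mul
        (continuousOn_const.sub ((F.cont_U n).mono hsub))).neg)))
    (fun x hx => (F.hasDeriv_ω n x (hx.2.trans_le ht)).fun_neg.fun_sub
      ((hderE x hx).const_mul (C * K / (m * ω n s))))
    (fun x hx => by
      have hx0 : x ≤ 0 := hx.2.le.trans ht
      have h1 := mul_le_mul (F.κ_le x hx0) (hdens x hx.1.le hx.2.le) (F.dens_nonneg G n hx0) F.C_pos.le
      have h2 : 1 ≤ ω n x / ω n s := (one_le_div hω).2 (F.mono_ω G n hx.1.le hx0)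
      have h3 : 0 ≤ C * (K * Real.exp (-(m * (U n s - U n x)))) :=
        mul_nonneg F.C_pos.le (mul_nonneg hKn (Real.exp_pos _).le)
      have h4 := mul_le_mul_of_nonneg_left h2 h3
      have h5 : C * K / (m * ω n s) * (Real.exp (-(m * (U n s - U n x))) * -(m * ω n x))
          = -(C * (K * Real.exp (-(m * (U n s - U n x)))) * (ω n x / ω n s)) := by
        field_simp
      rw [h5]
      linarith)
  constructor
  · refine (hdens t hst le_rfl).trans ?_
    refine mul_le_of_le_one_right hKn (Real.exp_le_one_iff.2 ?_)
    have := mul_nonneg hm.le (sub_nonneg.2 hlt.le)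
    linarith
  · simp only [sub_self, mul_zero, neg_zero, Real.exp_zero, mul_one] at hmono
    have h1 : 0 ≤ C * K / (m * ω n s) * Real.exp (-(m * (U n s - U n t))) := by
      have := F.C_pos
      positivity
    linarith

/-- The point is found by the height N(U) = y N(v), using the intermediate value theorem twice.
Negativity of the exponent keeps the mass gained on the way negligible. The elapsed time, and with
it the change of log density, is then explicit. -/
theorem exists_transit_point (F : Family f κ Λ mu U ω c C) (G : Growth f N D D2 T q)
    {x cc y : ℝ} {τ : ℕ → ℝ} (Q : Quiet f N D Λ mu U ω x cc τ) (hcc : 0 < cc)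
    (hy : 0 < y) (hy1 : y < 1) (hneg : 2 / cc * drop q y - 1 + y < 0) :
    ∃ σ : ℕ → ℝ, (∀ᶠ n in atTop, σ n < 0 ∧ T ≤ U n (σ n)) ∧
      Tendsto (fun n => (N (U n (σ n)) / N (mu n), D (U n (σ n)) * ω n (σ n),
        D (U n (σ n)) * dens f (Λ n) (U n) (σ n),
        Real.log (D (U n (σ n)) * dens f (Λ n) (U n) (σ n)) / N (mu n))) atTop
        (𝓝 (x * y, y ^ (1 / q) * cc, 0, x * (2 / cc * drop q y - 1 + y))) := by
  set v : ℕ → ℝ := fun n => U n (τ n) with hv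
  have hNmu := F.N_mu_tendsto G
  have hvT : ∀ᶠ n in atTop, T ≤ v n := Q.top.eventually_ge_atTop T
  have hNv : Tendsto (fun n => N (v n)) atTop atTop := G.N_tendsto.comp Q.top
  have hex : ∀ᶠ n in atTop, ∃ t, τ n ≤ t ∧ t < 0 ∧ T ≤ U n t ∧ U n t < v n ∧
      N (U n t) = y * N (v n) := by
    filter_upwards [hvT, hNv.eventually_ge_atTop (N T / y), Q.neg] with n h1 h2 h3
    have hN0 := G.N_pos _ h1
    rw [div_le_iff₀ hy] at h2
    obtain ⟨w, hw, hwN⟩ := intermediate_value_Icc (f := N) h1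
      (fun z hz => (G.hasDeriv z hz.1).continuousAt.continuousWithinAt)
      (show y * N (v n) ∈ Icc (N T) (N (v n)) from ⟨by linarith, by nlinarith⟩)
    obtain ⟨t, ht, htw⟩ := intermediate_value_Icc' (f := U n) h3.le
      ((F.cont_U n).mono fun _ hz => hz.2)
      (show w ∈ Icc (U n 0) (U n (τ n)) from ⟨by
        rw [F.U_zero]; exact (G.T_pos.trans_le hw.1).le, hw.2⟩)
    refine ⟨t, ht.1, lt_of_le_of_ne ht.2 ?_, htw ▸ hw.1, ?_, htw ▸ hwN⟩
    · rintro rfl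
      rw [F.U_zero] at htw
      exact absurd (htw ▸ hw.1) (not_le.2 G.T_pos)
    · refine G.lt_of_N_lt h1 ?_
      rw [htw, hwN]; nlinarith
  obtain ⟨σ, hσ⟩ := hex.choice
  set w : ℕ → ℝ := fun n => U n (σ n) with hw
  have hratio : ∀ᶠ n in atTop, N (w n) / N (v n) = y := by
    filter_upwards [hσ, hvT] with n h1 h2
    have := (G.N_pos _ h2).ne'
    simp only [hw]
    rw [h1.2.2.2.2]; field_simp
  have hrt : Tendsto (fun n => N (w n) / N (v n)) atTop (𝓝 y) :=
    tendsto_const_nhds.congr' (hratio.mono fun n hn => hn.symm)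
  have hwtop : Tendsto w atTop atTop := by
    refine G.tendsto_of_N_tendsto (hσ.mono fun n hn => hn.2.2.1) ?_
    refine (hNv.const_mul_atTop hy).congr' (hσ.mono fun n hn => hn.2.2.2.2.symm)
  have hwv : ∀ᶠ n in atTop, w n ≤ v n := hσ.mono fun n hn => hn.2.2.2.1.le
  have hDr := G.D_ratio_tendsto hy Q.top hwtop hwv hrt
  have hX := G.drop_tendsto hy hwtop hwv hrt
  set X : ℕ → ℝ := fun n => D (v n) * (v n - w n) / N (v n) with hXdef
  have hdrop := drop_pos G.one_le hy hy1
  have hmass := Q.mass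
  -- the exponent
  have hh : Tendsto (fun n => 2 / (D (v n) * ω n (τ n)) * X n - (1 - y)) atTop
      (𝓝 (2 / cc * drop q y - (1 - y))) :=
    ((tendsto_const_nhds.div hmass hcc.ne').mul hX).sub tendsto_const_nhds
  set h : ℕ → ℝ := fun n => 2 / (D (v n) * ω n (τ n)) * X n - (1 - y) with hhdef
  have hm : Tendsto (fun n => -h n / X n) atTop
      (𝓝 (-(2 / cc * drop q y - (1 - y)) / drop q y)) := hh.neg.div hX hdrop.ne'
  -- This rate turns the hypothesis of `mass_growth_le` into an equality: 2/ω minus the slope of the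
  -- chord of N equals D(v) h/X.
  set m : ℕ → ℝ := fun n => D (v n) * (-h n / X n) with hmdef
  have hmm : 0 < -(2 / cc * drop q y - (1 - y)) / drop q y := div_pos (by linarith) hdrop
  have hω0 : ∀ᶠ n in atTop, 0 < ω n (τ n) := by
    filter_upwards [hmass.eventually (lt_mem_nhds hcc), hvT] with n h1 h2
    exact (pos_iff_pos_of_mul_pos h1).1 (G.D_pos _ h2)
  have hest : ∀ᶠ n in atTop, dens f (Λ n) (U n) (σ n) ≤ dens f (Λ n) (U n) (τ n) ∧
      ω n (σ n) ≤ ω n (τ n) + C * dens f (Λ n) (U n) (τ n) / (m n * ω n (τ n)) := by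
    filter_upwards [hσ, hvT, hω0, hm.eventually (lt_mem_nhds hmm)] with n h1 h2 h3 h4
    have hD := G.D_pos _ h2
    have hN := G.N_pos _ h2
    refine F.mass_growth_le G n h1.1 h1.2.1.le h1.2.2.1 h1.2.2.2.1 h3 (mul_pos hD h4) (le_of_eq ?_)
    rw [h1.2.2.2.2]
    have h5 : v n - w n ≠ 0 := (sub_pos.2 h1.2.2.2.1).ne'
    change 2 / ω n (τ n) - (N (v n) - y * N (v n)) / (v n - w n) = - m n
    simp only [hmdef, hhdef, hXdef]
    field_simp
  have hωr : Tendsto (fun n => ω n (σ n) / ω n (τ n)) atTop (𝓝 1) := by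
    have h1 : Tendsto (fun n => C * (D (v n) * dens f (Λ n) (U n) (τ n)) /
        ((-h n / X n) * (D (v n) * ω n (τ n)) ^ 2)) atTop (𝓝 (C * 0 /
        (-(2 / cc * drop q y - (1 - y)) / drop q y * cc ^ 2))) :=
      (Q.density.const_mul C).div (hm.mul (hmass.pow 2)) (by positivity)
    rw [mul_zero, zero_div] at h1
    refine tendsto_of_abs_sub_le ?_ h1
    filter_upwards [hest, hω0, hvT, hσ, hm.eventually (lt_mem_nhds hmm)] with n h2 h3 h4 h5 h6
    have h7 := F.mono_ω G n h5.1 h5.2.1.le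
    have hD := G.D_pos _ h4
    rw [div_sub_one h3.ne', abs_of_nonneg (div_nonneg (by linarith) h3.le), div_le_iff₀ h3]
    have h8 : C * (D (v n) * dens f (Λ n) (U n) (τ n)) /
        ((-h n / X n) * (D (v n) * ω n (τ n)) ^ 2) * ω n (τ n)
        = C * dens f (Λ n) (U n) (τ n) / (m n * ω n (τ n)) := by
      simp only [hmdef]
      have h9 : -h n / X n ≠ 0 := h6.ne'
      generalize -h n / X n = z at *
      field_simp
    rw [h8]; linarith [h2.2]
  -- the elapsed time
  have htime : Tendsto (fun n => (σ n - τ n) / N (v n)) atTop (𝓝 (drop q y / cc)) := by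
    have h1 : Tendsto (fun n => X n / (D (v n) * ω n (τ n))) atTop (𝓝 (drop q y / cc)) :=
      hX.div hmass hcc.ne'
    have h2 : Tendsto (fun n => X n / (D (v n) * ω n (τ n)) / (ω n (σ n) / ω n (τ n))) atTop
        (𝓝 (drop q y / cc / 1)) := h1.div hωr one_ne_zero
    rw [div_one] at h2
    -- As ω increases, the elapsed time lies between the fall of U divided by its final and by its
    -- initial value of ω. These have ratio tending to 1.
    refine tendsto_of_tendsto_of_tendsto_of_le_of_le' h2 h1 ?_ ?_
    · filter_upwards [hω0, hvT, hσ] with n h3 h4 h5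
      have h6 := F.mono_ω G n h5.1 h5.2.1.le
      have h7 := F.sub_le G n h5.1 h5.2.1.le
      have hD := G.D_pos _ h4
      have hN := G.N_pos _ h4
      have h8 : 0 < ω n (σ n) := h3.trans_le h6
      have h9 : X n / (D (v n) * ω n (τ n)) / (ω n (σ n) / ω n (τ n))
          = (v n - w n) / ω n (σ n) / N (v n) := by
        simp only [hXdef]; field_simp
      rw [h9]
      refine div_le_div_of_nonneg_right ?_ hN.le
      rw [div_le_iff₀ h8]; linarith
    · filter_upwards [hω0, hvT, hσ] with n h3 h4 h5
      have h7 := F.le_sub G n h5.1 h5.2.1.le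
      have hD := G.D_pos _ h4
      have hN := G.N_pos _ h4
      have h9 : X n / (D (v n) * ω n (τ n)) = (v n - w n) / ω n (τ n) / N (v n) := by
        simp only [hXdef]; field_simp
      rw [h9]
      refine div_le_div_of_nonneg_right ?_ hN.le
      rw [le_div_iff₀ h3]; linarith
  refine ⟨σ, hσ.mono fun n hn => ⟨hn.2.1, hn.2.2.1⟩, ?_⟩
  refine Tendsto.prodMk_nhds ?_ (Tendsto.prodMk_nhds ?_ (Tendsto.prodMk_nhds ?_ ?_))
  · refine (Q.height.mul hrt).congr' ?_
    filter_upwards [hvT] with n h1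
    have := (G.N_pos _ h1).ne'
    change N (v n) / N (mu n) * (N (w n) / N (v n)) = N (w n) / N (mu n)
    field_simp
  · have := (hDr.mul hωr).mul hmass
    rw [mul_one] at this
    refine this.congr' ?_
    filter_upwards [hvT, hω0] with n h1 h2
    have := (G.D_pos _ h1).ne'
    change D (w n) / D (v n) * (ω n (σ n) / ω n (τ n)) * (D (v n) * ω n (τ n)) = D (w n) * ω n (σ n)
    field_simp
  · refine squeeze_zero' ?_ ?_ Q.density
    · filter_upwards [hσ] with n h1
      exact mul_nonneg (G.D_pos _ h1.2.2.1).le (F.dens_nonneg G n h1.2.1.le)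
    · filter_upwards [hσ, hest] with n h1 h2
      exact mul_le_mul (G.mono_D h1.2.2.1 h1.2.2.2.1.le) h2.1 (F.dens_nonneg G n h1.2.1.le)
        (G.D_pos _ (h1.2.2.1.trans h1.2.2.2.1.le)).le
  · have hlogD : Tendsto (fun n => Real.log (D (w n) / D (v n)) / N (mu n)) atTop (𝓝 0) :=
      ((Real.continuousAt_log (Real.rpow_pos_of_pos hy _).ne').tendsto.comp hDr).div_atTop hNmu
    have h1 := (Q.log_density.add hlogD).add
      (Q.height.mul ((htime.const_mul 2).sub (tendsto_const_nhds (x := 1 - y))))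
    rw [show (0 : ℝ) + 0 + x * (2 * (drop q y / cc) - (1 - y)) =
      x * (2 / cc * drop q y - 1 + y) by ring] at h1
    refine h1.congr' ?_
    filter_upwards [hvT, hσ, hwtop.eventually_ge_atTop T] with n h2 h3 h4
    have hN := (G.N_pos _ h2).ne'
    have hDv := G.D_pos _ h2
    have hDw := G.D_pos _ h4
    have hK := F.dens_pos G n h2
    change Real.log (D (v n) * dens f (Λ n) (U n) (τ n)) / N (mu n)
      + Real.log (D (w n) / D (v n)) / N (mu n)
      + N (v n) / N (mu n) * (2 * ((σ n - τ n) / N (v n)) - (1 - y)) = _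
    rw [dens_eq G n h2 h4, ← mul_assoc, Real.log_mul (mul_pos hDw hK).ne' (Real.exp_pos _).ne',
      Real.log_exp, Real.log_mul hDw.ne' hK.ne', Real.log_mul hDv.ne' hK.ne',
      Real.log_div hDw.ne' hDv.ne', h3.2.2.2.2]
    field_simp
    ring

/-- From one bubble to the next one. -/
theorem exists_quiet_next (F : Family f κ Λ mu U ω c C) (G : Growth f N D D2 T q)
    {x cc y : ℝ} {τ : ℕ → ℝ} (Q : Quiet f N D Λ mu U ω x cc τ) (hx : 0 < x) (hcc : 0 < cc)
    (hy : 0 < y) (hy1 : y < 1) (hroot : 2 / cc * drop q y - 1 + y = 0) :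
    ∃ σ, Quiet f N D Λ mu U ω (x * y) (y ^ (1 / q) * cc) σ := by
  -- The transit estimate needs a strictly negative exponent, which fails at the root y. It is used
  -- at points z_m decreasing to y, and a diagonal choice makes the exponent tend to 0, which is the
  -- condition on the logarithm of the density.
  set z : ℕ → ℝ := fun m => y + (1 - y) / (m + 2) with hz
  have hzy : ∀ m, y < z m := fun m => by
    have : 0 < (1 - y) / ((m : ℝ) + 2) := div_pos (by linarith) (by positivity)
    simp only [hz]; linarith
  have hz1 : ∀ m, z m < 1 := fun m => by
    have : (1 - y) / ((m : ℝ) + 2) < 1 - y := by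
      rw [div_lt_iff₀ (by positivity)]
      have : (0 : ℝ) ≤ m := Nat.cast_nonneg m
      nlinarith
    simp only [hz]; linarith
  have hzlim : Tendsto z atTop (𝓝 y) := by
    have h1 : Tendsto (fun m : ℕ => (1 - y) / ((m : ℝ) + 2)) atTop (𝓝 0) :=
      tendsto_const_nhds.div_atTop (tendsto_atTop_add_const_right _ _ tendsto_natCast_atTop_atTop)
    simpa using h1.const_add y
  choose σ hσ1 hσ2 using fun m => F.exists_transit_point G Q hcc (hy.trans (hzy m)) (hz1 m)
    (transit_neg G.one_le hcc hy hroot (hzy m) (hz1 m))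
  have hpow : Tendsto (fun m => z m ^ (1 / q) * cc) atTop (𝓝 (y ^ (1 / q) * cc)) :=
    (((Real.continuousAt_rpow_const y (1 / q) (Or.inl hy.ne')).tendsto.comp hzlim)).mul_const cc
  have hdr : Tendsto (fun m => x * (2 / cc * drop q (z m) - 1 + z m)) atTop (𝓝 0) := by
    have := (((((continuousAt_drop G.one_le hy).tendsto.comp hzlim).const_mul (2 / cc)).sub_const
      1).add hzlim).const_mul x
    rw [hroot, mul_zero] at this
    exact this
  obtain ⟨M, -, hM, hP⟩ := exists_slow_tendsto hσ2
    ((hzlim.const_mul x).prodMk_nhds (hpow.prodMk_nhds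
      ((tendsto_const_nhds (x := (0 : ℝ))).prodMk_nhds hdr))) hσ1
  rw [nhds_prod_eq, nhds_prod_eq, nhds_prod_eq] at hM
  have e1 := hM.fst
  have e2 := hM.snd.fst
  have e3 := hM.snd.snd.fst
  have e4 := hM.snd.snd.snd
  refine ⟨fun n => σ (M n) n, hP.mono fun n hn => hn.1, ?_, e1, e2, e3, e4⟩
  refine G.tendsto_of_N_tendsto (hP.mono fun n hn => hn.2) ?_
  refine (Tendsto.pos_mul_atTop (mul_pos hx hy) e1 (F.N_mu_tendsto G)).congr' ?_
  filter_upwards [F.mu_tendsto.eventually_ge_atTop T] with n hn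
  have := (G.N_pos _ hn).ne'
  field_simp

end Family

/-! ### The almost conserved energy and the onset of a bubble. -/

/-- The first integral of the limiting equation, normalised by the constant `d`. -/
noncomputable def energy (d w K : ℝ) : ℝ := (2 - d * w) ^ 2 / 2 + d * K

namespace Family

variable {f N D D2 κ : ℝ → ℝ} {T q c C : ℝ} {Λ mu : ℕ → ℝ} {U ω : ℕ → ℝ → ℝ}

/-- The derivative of the energy is dK ((2 - dω)(1 - κ) + dω(1 - D(U)/d)), which vanishes for κ = 1
and frozen D. The factor dK is at most (dω)'/c, so the total variation is controlled by the mass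
gained. -/
theorem energy_sub_le (F : Family f κ Λ mu U ω c C) (G : Growth f N D D2 T q) (n : ℕ)
    {s t d e : ℝ} (hst : s ≤ t) (ht : t ≤ 0) (hT : T < U n t) (hd : 0 < d)
    (hω : d * ω n t ≤ 2) (hκ : ∀ x ∈ Icc s t, |1 - κ x| ≤ e)
    (hD : ∀ x ∈ Icc s t, |1 - D (U n x) / d| ≤ e) :
    |energy d (ω n t) (dens f (Λ n) (U n) t) - energy d (ω n s) (dens f (Λ n) (U n) s)|
      ≤ 4 * e / c * (d * ω n t) - 4 * e / c * (d * ω n s) := by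
  have hsub : Icc s t ⊆ Iic 0 := fun _ hx => hx.2.trans ht
  have hTx : ∀ x ∈ Icc s t, T < U n x := fun x hx => hT.trans_le (F.anti_U G n hx.2 ht)
  have hNcont : ContinuousOn (dens f (Λ n) (U n)) (Icc s t) := by
    have h1 : ContinuousOn (fun x => Λ n * Real.exp (2 * x) * Real.exp (N (U n x))) (Icc s t) := by
      have h2 : ContinuousOn (fun x => N (U n x)) (Icc s t) := by
        intro x hx
        exact ((G.hasDeriv _ (hTx x hx).le).continuousAt).comp_continuousWithinAt
          (((F.cont_U n).mono hsub) x hx)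
      have h3 : Continuous fun x : ℝ => Λ n * Real.exp (2 * x) := by fun_prop
      exact h3.continuousOn.mul (Real.continuous_exp.comp_continuousOn h2)
    refine h1.congr fun x hx => ?_
    simp only [dens]
    rw [G.exp_N _ (hTx x hx).le]
  have hcω := (F.cont_ω n).mono hsub
  refine abs_sub_le_of_hasDerivAt (f := fun x => energy d (ω n x) (dens f (Λ n) (U n) x))
    (g := fun x => 4 * e / c * (d * ω n x))
    (f' := fun x => d * dens f (Λ n) (U n) x * ((2 - d * ω n x) * (1 - κ x)
      + d * ω n x * (1 - D (U n x) / d)))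
    (g' := fun x => 4 * e / c * (d * (κ x * dens f (Λ n) (U n) x))) hst ?_ ?_ ?_ ?_ ?_
  · unfold energy
    exact (((continuousOn_const.sub (continuousOn_const.mul hcω)).pow 2).div_const 2).add
      (continuousOn_const.mul hNcont)
  · exact continuousOn_const.mul (continuousOn_const.mul hcω)
  · intro x hx
    have hx0 : x < 0 := hx.2.trans_le ht
    have h1 := (F.hasDeriv_ω n x hx0).const_mul d
    have h2 := (F.hasDerivAt_dens G n hx0 (hTx x ⟨hx.1.le, hx.2.le⟩)).const_mul d
    unfold energy
    refine ((((h1.const_sub 2).fun_pow 2).div_const 2).fun_add h2).congr_deriv ?_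
    field_simp
    ring
  · intro x hx
    exact ((F.hasDeriv_ω n x (hx.2.trans_le ht)).const_mul d).const_mul _
  · intro x hx
    have hx' : x ∈ Icc s t := ⟨hx.1.le, hx.2.le⟩
    have hx0 : x ≤ 0 := hsub hx'
    have h1 : 0 ≤ d * ω n x := mul_nonneg hd.le (F.ω_nonneg G n hx0)
    have h2 : d * ω n x ≤ 2 :=
      (mul_le_mul_of_nonneg_left (F.mono_ω G n hx.2.le ht) hd.le).trans hω
    have hK := F.dens_nonneg G n hx0
    have he : 0 ≤ e := (abs_nonneg _).trans (hκ x hx')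
    rw [abs_mul, abs_of_nonneg (mul_nonneg hd.le hK)]
    have h3 : |(2 - d * ω n x) * (1 - κ x) + d * ω n x * (1 - D (U n x) / d)| ≤ 4 * e := by
      refine (abs_add_le _ _).trans ?_
      rw [abs_mul, abs_mul, abs_of_nonneg h1, abs_of_nonneg (by linarith : 0 ≤ 2 - d * ω n x)]
      have a1 := mul_le_mul (by linarith : 2 - d * ω n x ≤ 2) (hκ x hx') (abs_nonneg _) (by norm_num)
      have a2 := mul_le_mul h2 (hD x hx') (abs_nonneg _) (by norm_num)
      linarith
    have h4 : 1 ≤ κ x / c := (one_le_div F.c_pos).2 (F.κ_ge x hx0)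
    have h5 : 0 ≤ d * dens f (Λ n) (U n) x * (4 * e) := by positivity
    calc _ ≤ d * dens f (Λ n) (U n) x * (4 * e) :=
          mul_le_mul_of_nonneg_left h3 (mul_nonneg hd.le hK)
      _ ≤ d * dens f (Λ n) (U n) x * (4 * e) * (κ x / c) := le_mul_of_one_le_right h5 h4
      _ = _ := by ring

/-- Each quiet point with accumulated mass `2 - a` is followed by a bubble. -/
theorem exists_center (F : Family f κ Λ mu U ω c C) (G : Growth f N D D2 T q)
    {x a : ℝ} {τ : ℕ → ℝ} (Q : Quiet f N D Λ mu U ω x (2 - a) τ) (hx : 0 < x) (ha : 0 < a)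
    (ha2 : a ≤ 2) : ∃ σ, Center f N D Λ mu U ω x a σ := by
  set v : ℕ → ℝ := fun n => U n (τ n) with hv
  set K : ℕ → ℝ → ℝ := fun n => dens f (Λ n) (U n) with hK
  have hNmu := F.N_mu_tendsto G
  have hvT : ∀ᶠ n in atTop, T ≤ v n := Q.top.eventually_ge_atTop T
  have hcp := F.c_pos
  have hCp := F.C_pos
  -- A crude energy bound: the initial energy is near a^2/2 ≤ 2, and `energy_sub_le` with e = 1 + C
  -- and mass at most 2 adds 8(1 + C)/c.
  set B : ℝ := 3 + 8 * (1 + C) / c with hB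
  have hB3 : 3 ≤ B := by
    have : 0 ≤ 8 * (1 + C) / c := by positivity
    linarith
  -- The time in which growth at rate a/2 would lift the normalised density from its initial value
  -- to e B.
  set T1 : ℕ → ℝ := fun n => 2 / a * (-Real.log (D (v n) * K n (τ n)) + Real.log B + 1) with hT1
  -- The extra time 64/a^2 is long enough for the mass to exceed 2 once it is at least 2 - a/2.
  set Tn : ℕ → ℝ := fun n => T1 n + 64 / a ^ 2 with hTn
  have hT1top : Tendsto T1 atTop atTop := by
    have h1 : Tendsto (fun n => Real.log (D (v n) * K n (τ n))) atTop atBot := by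
      refine Real.tendsto_log_nhdsGT_zero.comp (tendsto_nhdsWithin_iff.2 ⟨Q.density, ?_⟩)
      filter_upwards [hvT] with n hn
      exact mul_pos (G.D_pos _ hn) (F.dens_pos G n hn)
    have h2 := tendsto_neg_atBot_atTop.comp h1
    exact ((tendsto_atTop_add_const_right _ 1 (tendsto_atTop_add_const_right _ (Real.log B) h2))).const_mul_atTop
      (by positivity)
  have hTnN : Tendsto (fun n => Tn n / N (v n)) atTop (𝓝 0) := by
    have h1 : Tendsto (fun n => (2 / a * (Real.log B + 1) + 64 / a ^ 2) / N (mu n)) atTop (𝓝 0) :=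
      tendsto_const_nhds.div_atTop hNmu
    have h2 := (h1.sub (Q.log_density.const_mul (2 / a))).div Q.height hx.ne'
    simp only [mul_zero, sub_zero, zero_div] at h2
    refine h2.congr' ?_
    filter_upwards [hvT, F.mu_tendsto.eventually_ge_atTop T] with n h3 h4
    have h5 := (G.N_pos _ h3).ne'
    have h6 := (G.N_pos _ h4).ne'
    change ((2 / a * (Real.log B + 1) + 64 / a ^ 2) / N (mu n) -
      2 / a * (Real.log (D (v n) * K n (τ n)) / N (mu n))) / (N (v n) / N (mu n)) = Tn n / N (v n)
    simp only [hTn, hT1]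
    field_simp
    ring
  -- the end of the bubble, or of the observation time
  have hex : ∀ᶠ n in atTop, ∃ R, τ n ≤ R ∧ R ≤ τ n + Tn n ∧ R ≤ 0 ∧ D (v n) * ω n R ≤ 2 ∧
      (D (v n) * ω n R = 2 ∨ R = min (τ n + Tn n) 0) := by
    filter_upwards [Q.neg, hT1top.eventually_ge_atTop 0,
      Q.mass.eventually (gt_mem_nhds (show 2 - a < 2 by linarith))] with n h1 h2 h3
    have h4 : 0 < 64 / a ^ 2 := by positivity
    have h5 : τ n ≤ min (τ n + Tn n) 0 := le_min (by simp only [hTn]; linarith) h1.le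
    rcases le_total (D (v n) * ω n (min (τ n + Tn n) 0)) 2 with h6 | h6
    · exact ⟨_, h5, min_le_left _ _, min_le_right _ _, h6, Or.inr rfl⟩
    · obtain ⟨R, hR, hR2⟩ := intermediate_value_Icc (f := fun t => D (v n) * ω n t) h5
        (continuousOn_const.mul ((F.cont_ω n).mono fun z hz => hz.2.trans (min_le_right _ _)))
        (show (2 : ℝ) ∈ Icc _ _ from ⟨le_of_lt h3, h6⟩)
      exact ⟨R, hR.1, hR.2.trans (min_le_left _ _), hR.2.trans (min_le_right _ _), hR2.le,
        Or.inl hR2⟩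
  obtain ⟨R, hR⟩ := hex.choice
  -- While the mass is at most 2, U falls by at most 2 Tn/D(v). This is o(N/D), as Tn is of the
  -- order of the logarithm of the density, so D can be frozen over the whole observation.
  have hslow := G.slow Q.top (w := fun n => U n (R n)) (by
    have h1 := hTnN.const_mul 2
    rw [mul_zero] at h1
    refine squeeze_zero' ?_ ?_ h1
    · filter_upwards [hvT] with n h2
      exact div_nonneg (mul_nonneg (G.D_pos _ h2).le (abs_nonneg _)) (G.N_pos _ h2).le
    · filter_upwards [hvT, hR] with n h2 h3
      have h4 := F.anti_U G n h3.1 h3.2.2.1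
      rw [abs_sub_comm, abs_of_nonneg (sub_nonneg.2 h4), ← mul_div_assoc]
      refine div_le_div_of_nonneg_right ?_ (G.N_pos _ h2).le
      have h5 := mul_le_mul_of_nonneg_left (F.sub_le G n h3.1 h3.2.2.1) (G.D_pos _ h2).le
      have h6 := mul_le_mul h3.2.2.2.1 (show R n - τ n ≤ Tn n by linarith [h3.2.1])
        (sub_nonneg.2 h3.1) (by norm_num)
      linarith)
  obtain ⟨hRtop, hNr, hDr⟩ := hslow
  have hRT : ∀ᶠ n in atTop, T < U n (R n) := hRtop.eventually_gt_atTop T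
  have hRneg : ∀ᶠ n in atTop, R n < 0 := by
    filter_upwards [hRT, hR] with n h1 h2
    refine lt_of_le_of_ne h2.2.2.1 fun h0 => ?_
    rw [h0, F.U_zero] at h1
    exact absurd h1 (not_lt.2 G.T_pos.le)
  set E : ℕ → ℝ → ℝ := fun n t => energy (D (v n)) (ω n t) (K n t) with hE
  have hE0 : Tendsto (fun n => E n (τ n)) atTop (𝓝 (a ^ 2 / 2)) := by
    have := (((tendsto_const_nhds (x := (2 : ℝ))).sub Q.mass).pow 2).div_const 2 |>.add Q.density
    rw [show (2 - (2 - a)) ^ 2 / 2 + 0 = a ^ 2 / 2 by ring] at this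
    exact this
  have hE0' : ∀ᶠ n in atTop, E n (τ n) ≤ 3 := by
    filter_upwards [hE0.eventually (gt_mem_nhds (show a ^ 2 / 2 < 3 by nlinarith))] with n hn
    exact hn.le
  have hbd : ∀ᶠ n in atTop, ∀ t ∈ Icc (τ n) (R n), T < U n t ∧ D (v n) * ω n t ≤ 2 ∧
      0 ≤ D (v n) * ω n t ∧ |1 - D (U n t) / D (v n)| ≤ 1 - D (U n (R n)) / D (v n) := by
    filter_upwards [hRT, hR, hvT] with n h1 h2 h3 t ht
    have hD := G.D_pos _ h3
    have ht0 := ht.2.trans h2.2.2.1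
    have h4 : T < U n t := h1.trans_le (F.anti_U G n ht.2 h2.2.2.1)
    refine ⟨h4, (mul_le_mul_of_nonneg_left (F.mono_ω G n ht.2 h2.2.2.1) hD.le).trans
      h2.2.2.2.1, mul_nonneg hD.le (F.ω_nonneg G n ht0), ?_⟩
    have h5 := G.mono_D h4.le (F.anti_U G n ht.1 ht0)
    have h6 := G.mono_D h1.le (F.anti_U G n ht.2 h2.2.2.1)
    have h7 : D (U n t) / D (v n) ≤ 1 := (div_le_one hD).2 h5
    rw [abs_of_nonneg (by linarith)]
    have h8 := div_le_div_of_nonneg_right h6 hD.le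
    linarith
  have hEe : ∀ {e : ℝ} {n : ℕ}, 0 ≤ e → R n ≤ 0 → T ≤ v n →
      (∀ t ∈ Icc (τ n) (R n), T < U n t ∧ D (v n) * ω n t ≤ 2 ∧ 0 ≤ D (v n) * ω n t ∧
        |1 - D (U n t) / D (v n)| ≤ e) → (∀ t ∈ Icc (τ n) (R n), |1 - κ t| ≤ e) →
      ∀ t ∈ Icc (τ n) (R n), |E n t - E n (τ n)| ≤ 8 * e / c := by
    intro e n he hRn hvn h1 h2 t ht
    have h3 := F.energy_sub_le G n ht.1 (ht.2.trans hRn) (h1 t ht).1 (G.D_pos _ hvn) (h1 t ht).2.1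
      (fun z hz => h2 z ⟨hz.1, hz.2.trans ht.2⟩) (fun z hz => (h1 z ⟨hz.1, hz.2.trans ht.2⟩).2.2.2)
    refine h3.trans ?_
    have h4 := (h1 (τ n) ⟨le_rfl, ht.1.trans ht.2⟩).2.2.1
    have h5 := (h1 t ht).2.1
    have h6 : 0 ≤ 4 * e / c := by positivity
    have h7 : 8 * e / c = 4 * e / c * 2 := by ring
    rw [h7]
    nlinarith
  -- At this stage κ is known only to be bounded. The crude bound forces R → -∞, and then κ → 1
  -- yields the sharp energy estimate `hfine`.
  have hcrude : ∀ᶠ n in atTop, ∀ t ∈ Icc (τ n) (R n), E n t ≤ B := by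
    filter_upwards [hbd, hR, hvT, hE0', hRT] with n h1 h2 h3 h4 h5 t ht
    have h6 := hEe (e := 1 + C) (by linarith) h2.2.2.1 h3 (fun z hz => by
      obtain ⟨b1, b2, b3, b4⟩ := h1 z hz
      refine ⟨b1, b2, b3, b4.trans ?_⟩
      have := div_pos (G.D_pos _ h5.le) (G.D_pos _ h3)
      linarith) (fun z hz => by
      have hz0 := hz.2.trans h2.2.2.1
      have := F.κ_le z hz0
      have := F.κ_pos hz0
      rw [abs_le]; constructor <;> linarith) t ht
    linarith [(abs_le.1 h6).2]
  have hA_le : ∀ {n t}, D (v n) * K n t ≤ E n t := fun {n t} => by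
    simp only [hE, energy]
    linarith [sq_nonneg (2 - D (v n) * ω n t)]
  have hRbot : Tendsto R atTop atBot := by
    refine F.tendsto_atBot_of_bounded G (B := B) (hRneg.mono fun n hn => hn.le) hRtop ?_ ?_
    · filter_upwards [hR, hRT, hvT] with n h2 h3 h4
      have h5 := F.anti_U G n h2.1 h2.2.2.1
      have h6 := mul_le_mul_of_nonneg_right (G.mono_D h3.le h5) (F.ω_nonneg G n h2.2.2.1)
      linarith [h2.2.2.2.1]
    · filter_upwards [hR, hRT, hvT, hcrude] with n h2 h3 h4 h7
      have h5 := F.anti_U G n h2.1 h2.2.2.1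
      have h6 := mul_le_mul_of_nonneg_right (G.mono_D h3.le h5) (F.dens_nonneg G n h2.2.2.1)
      exact h6.trans (hA_le.trans (h7 _ ⟨h2.1, le_rfl⟩))
  have hκ : ∀ ε > 0, ∀ᶠ n in atTop, ∀ t ≤ R n, |1 - κ t| ≤ ε := by
    intro ε hε
    obtain ⟨b, hb⟩ := eventually_atBot.1 (Metric.tendsto_nhds.1 F.κ_tendsto ε hε)
    filter_upwards [hRbot.eventually_le_atBot b] with n hn t ht
    have := hb t (ht.trans hn)
    rw [Real.dist_eq, abs_sub_comm] at this
    exact this.le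
  have hfine : ∀ ε > 0, ∀ᶠ n in atTop, ∀ t ∈ Icc (τ n) (R n), |E n t - a ^ 2 / 2| ≤ ε := by
    intro ε hε
    have he : 0 < ε * c / 16 := by positivity
    filter_upwards [hbd, hR, hvT, hκ _ he, Metric.tendsto_nhds.1 hE0 (ε / 2) (half_pos hε),
      hDr.eventually (lt_mem_nhds (show 1 - ε * c / 16 < 1 by linarith))] with n h1 h2 h3 h4 h5 h6 t ht
    have h7 := hEe he.le h2.2.2.1 h3 (fun z hz => by
      obtain ⟨b1, b2, b3, b4⟩ := h1 z hz
      refine ⟨b1, b2, b3, b4.trans ?_⟩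
      change 1 - ε * c / 16 < D (U n (R n)) / D (v n) at h6
      linarith) (fun z hz => h4 z hz.2) t ht
    have h8 : 8 * (ε * c / 16) / c = ε / 2 := by field_simp; norm_num
    rw [h8] at h7
    rw [Real.dist_eq] at h5
    calc |E n t - a ^ 2 / 2| = |(E n t - E n (τ n)) + (E n (τ n) - a ^ 2 / 2)| := by ring_nf
      _ ≤ _ := abs_add_le _ _
      _ ≤ ε := by linarith
  -- It remains to exclude that the observation time runs out before the mass reaches 2.
  have htwo : ∀ᶠ n in atTop, D (v n) * ω n (R n) = 2 := by
    have ha2pos : 0 < a ^ 2 := by positivity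
    filter_upwards [hbd, hR, hvT, hκ (1 / 2) (by norm_num), hfine (a ^ 2 / 16) (by positivity),
      hcrude, hRneg, hRT, hT1top.eventually_gt_atTop 0] with n h1 h2 h3 h4 h5 h6 h7 h8 h9
    by_contra hne
    have hReq : R n = τ n + Tn n := by
      rcases h2.2.2.2.2 with h | h
      · exact absurd h hne
      · rcases min_choice (τ n + Tn n) 0 with h' | h'
        · rw [h, h']
        · rw [h'] at h; linarith
    have h64 : 0 < 64 / a ^ 2 := by positivity
    have hD := G.D_pos _ h3
    set t1 := τ n + T1 n with ht1
    have ht1R : t1 ∈ Icc (τ n) (R n) := ⟨by linarith, by rw [hReq]; simp only [hTn]; linarith⟩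
    -- As long as the mass is below 2 - a/2, log density grows at rate at least a/2; up to `t1` this
    -- would push the density above the energy bound B.
    have hΩ1 : 2 - a / 2 ≤ D (v n) * ω n t1 := by
      by_contra hlt
      push Not at hlt
      have ht10 := ht1R.2.trans h7.le
      have b1 := G.sub_le_D_mul (h1 t1 ht1R).1.le (F.anti_U G n ht1R.1 ht10)
      have b2 := mul_le_mul_of_nonneg_left (F.sub_le G n ht1R.1 ht10) hD.le
      have b3 : D (v n) * ω n t1 * (t1 - τ n) ≤ (2 - a / 2) * (t1 - τ n) :=
        mul_le_mul_of_nonneg_right hlt.le (by linarith [ht1R.1])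
      have b4 : N (v n) - N (U n t1) ≤ (2 - a / 2) * T1 n := by
        have : t1 - τ n = T1 n := by rw [ht1]; ring
        rw [this] at b3 b2
        change N (v n) - N (U n t1) ≤ D (v n) * (v n - U n t1) at b1
        change D (v n) * (v n - U n t1) ≤ D (v n) * (ω n t1 * T1 n) at b2
        linarith
      have b5 : D (v n) * K n t1 = D (v n) * K n (τ n) *
          Real.exp (2 * (t1 - τ n) - (N (v n) - N (U n t1))) := by
        simp only [hK]
        rw [dens_eq G n h3 (h1 t1 ht1R).1.le]
        ring
      have hA0 : 0 < D (v n) * K n (τ n) := mul_pos hD (F.dens_pos G n h3)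
      have b6 : Real.log (D (v n) * K n t1) ≥ Real.log B + 1 := by
        rw [b5, Real.log_mul hA0.ne' (Real.exp_pos _).ne', Real.log_exp]
        have : t1 - τ n = T1 n := by rw [ht1]; ring
        rw [this]
        have b7 : a / 2 * T1 n = -Real.log (D (v n) * K n (τ n)) + Real.log B + 1 := by
          simp only [hT1]; field_simp
        linarith
      have b8 : D (v n) * K n t1 ≤ B := hA_le.trans (h6 t1 ht1R)
      have b9 := Real.log_le_log (by rw [b5]; positivity) b8
      linarith
    -- For mass in [2 - a/2, 2] the kinetic term is at most a^2/8, so the density is at least a^2/4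
    -- and, with κ ≥ 1/2, the mass grows at rate at least a^2/8. During 64/a^2 it would gain 8.
    have hgrow := le_of_hasDerivAt_nonneg (f := fun t => D (v n) * ω n t - a ^ 2 / 8 * t)
      (f' := fun t => D (v n) * (κ t * K n t) - a ^ 2 / 8 * 1) ht1R.2
      ((continuousOn_const.mul ((F.cont_ω n).mono fun z hz => hz.2.trans h7.le)).sub
        (continuousOn_const.mul continuousOn_id))
      (fun z hz => ((F.hasDeriv_ω n z (hz.2.trans h7)).const_mul _).fun_sub
        ((hasDerivAt_id z).const_mul _))
      (fun z hz => by
        have hz' : z ∈ Icc (τ n) (R n) := ⟨ht1R.1.trans hz.1.le, hz.2.le⟩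
        have hz0 := hz'.2.trans h7.le
        have b1 := (abs_le.1 (h5 z hz')).1
        have b2 := (abs_le.1 (h4 z hz'.2)).2
        have b3 := (h1 z hz').2.1
        have b4 : 2 - a / 2 ≤ D (v n) * ω n z :=
          hΩ1.trans (mul_le_mul_of_nonneg_left (F.mono_ω G n hz.1.le hz0) hD.le)
        simp only [hE, energy] at b1
        have b5 : (2 - D (v n) * ω n z) ^ 2 ≤ (a / 2) ^ 2 :=
          pow_le_pow_left₀ (by linarith) (by linarith) 2
        have b6 : a ^ 2 / 4 ≤ D (v n) * K n z := by nlinarith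
        have b7 : 1 / 2 * (a ^ 2 / 4) ≤ κ z * (D (v n) * K n z) :=
          mul_le_mul (by linarith) b6 (by positivity) (F.κ_pos hz0).le
        linarith)
    have h10 : R n - t1 = 64 / a ^ 2 := by rw [hReq, ht1]; simp only [hTn]; ring
    have h11 : a ^ 2 / 8 * (R n - t1) = 8 := by rw [h10]; field_simp; norm_num
    linarith [h2.2.2.2.1]
  refine ⟨R, hRneg, hRtop, ?_, ?_, ?_⟩
  · have := hNr.mul Q.height
    rw [one_mul] at this
    refine this.congr' ?_
    filter_upwards [hvT] with n h1
    have := (G.N_pos _ h1).ne'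
    change N (U n (R n)) / N (v n) * (N (v n) / N (mu n)) = _
    field_simp
  · have := hDr.mul_const 2
    rw [one_mul] at this
    refine this.congr' ?_
    filter_upwards [hvT, htwo] with n h1 h2
    have := (G.D_pos _ h1).ne'
    rw [← h2]
    change D (U n (R n)) / D (v n) * (D (v n) * ω n (R n)) = _
    field_simp
  · have hER : Tendsto (fun n => E n (R n)) atTop (𝓝 (a ^ 2 / 2)) := by
      rw [Metric.tendsto_nhds]
      intro ε hε
      filter_upwards [hfine (ε / 2) (half_pos hε), hR] with n h1 h2
      rw [Real.dist_eq]
      linarith [h1 _ ⟨h2.1, le_rfl⟩]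
    have := hDr.mul hER
    rw [one_mul] at this
    refine this.congr' ?_
    filter_upwards [hvT, htwo] with n h1 h2
    have := (G.D_pos _ h1).ne'
    simp only [hE, energy]
    rw [h2]
    change D (U n (R n)) / D (v n) * ((2 - 2) ^ 2 / 2 + D (v n) * K n (R n)) = D (U n (R n)) * K n (R n)
    field_simp
    ring

end Family

/-! ### Limit profiles in logarithmic coordinates -/

/-- `b = (√2/a)^a`. -/
noncomputable def profB (a : ℝ) : ℝ := (Real.sqrt 2 / a) ^ a

/-- The limit profile in logarithmic coordinates. -/
noncomputable def prof (a s : ℝ) : ℝ :=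
  Real.log (2 * a ^ 2 * profB a) - (2 - a) * s - 2 * Real.log (1 + profB a * Real.exp (a * s))

/-- The mass accumulated by the limit profile, increasing from `2 - a` to `2 + a`. -/
noncomputable def profMass (a s : ℝ) : ℝ :=
  2 + a - 2 * a / (1 + profB a * Real.exp (a * s))

theorem profB_pos {a : ℝ} (ha : 0 < a) : 0 < profB a :=
  Real.rpow_pos_of_pos (div_pos (Real.sqrt_pos.2 two_pos) ha) a

theorem one_add_profB_pos {a : ℝ} (ha : 0 < a) (s : ℝ) : 0 < 1 + profB a * Real.exp (a * s) := by
  have := profB_pos ha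
  positivity

theorem hasDerivAt_profB_exp (a s : ℝ) : HasDerivAt (fun s => 1 + profB a * Real.exp (a * s))
    (a * (profB a * Real.exp (a * s))) s := by
  refine ((((hasDerivAt_id s).const_mul a).exp.const_mul (profB a)).const_add 1).congr_deriv ?_
  simp only [id]; ring

theorem hasDerivAt_prof {a : ℝ} (ha : 0 < a) (s : ℝ) :
    HasDerivAt (prof a) (-profMass a s) s := by
  have hp := (one_add_profB_pos ha s).ne'
  refine ((((hasDerivAt_id s).const_mul (2 - a)).const_sub
    (Real.log (2 * a ^ 2 * profB a))).fun_sub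
    (((hasDerivAt_profB_exp a s).log hp).const_mul 2)).congr_deriv ?_
  unfold profMass
  field_simp
  ring

theorem exp_prof {a : ℝ} (ha : 0 < a) (s : ℝ) : Real.exp (2 * s + prof a s)
    = 2 * a * (a * (profB a * Real.exp (a * s))) / (1 + profB a * Real.exp (a * s)) ^ 2 := by
  have hp := one_add_profB_pos ha s
  have hb := profB_pos ha
  unfold prof
  rw [show 2 * s + (Real.log (2 * a ^ 2 * profB a) - (2 - a) * s
      - 2 * Real.log (1 + profB a * Real.exp (a * s)))
    = Real.log (2 * a ^ 2 * profB a) + a * s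
      - Real.log ((1 + profB a * Real.exp (a * s)) ^ 2) by
    rw [Real.log_pow]; push_cast; ring, Real.exp_sub, Real.exp_add, Real.exp_log (by positivity),
    Real.exp_log (by positivity)]
  ring

theorem hasDerivAt_profMass {a : ℝ} (ha : 0 < a) (s : ℝ) :
    HasDerivAt (profMass a) (Real.exp (2 * s + prof a s)) s := by
  have hp := (one_add_profB_pos ha s).ne'
  rw [exp_prof ha]
  refine (((hasDerivAt_const s (2 * a)).fun_div (hasDerivAt_profB_exp a s) hp).const_sub
    (2 + a)).congr_deriv ?_
  ring

theorem continuous_prof {a : ℝ} (ha : 0 < a) : Continuous (prof a) :=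
  continuous_iff_continuousAt.2 fun s => (hasDerivAt_prof ha s).continuousAt

theorem continuous_profMass {a : ℝ} (ha : 0 < a) : Continuous (profMass a) :=
  continuous_iff_continuousAt.2 fun s => (hasDerivAt_profMass ha s).continuousAt

/-- The constant b is chosen for this: at s = log(a/√2) the profile vanishes and its mass is 2,
which matches the normalisation at the centre of a bubble. -/
theorem profB_mul_exp_center {a : ℝ} (ha : 0 < a) :
    profB a * Real.exp (a * (Real.log (a ^ 2 / 2) / 2)) = 1 := by
  have h2 : (0 : ℝ) < Real.sqrt 2 := Real.sqrt_pos.2 two_pos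
  have h3 : Real.log (Real.sqrt 2) = Real.log 2 / 2 := Real.log_sqrt two_pos.le
  unfold profB
  rw [Real.rpow_def_of_pos (div_pos h2 ha), ← Real.exp_add, Real.log_div h2.ne' ha.ne', h3,
    Real.log_div (by positivity) two_ne_zero, Real.log_pow, Real.exp_eq_one_iff]
  push_cast
  ring

theorem prof_center {a : ℝ} (ha : 0 < a) : prof a (Real.log (a ^ 2 / 2) / 2) = 0 := by
  have h1 := exp_prof ha (Real.log (a ^ 2 / 2) / 2)
  rw [profB_mul_exp_center ha, Real.exp_add, show 2 * (Real.log (a ^ 2 / 2) / 2)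
    = Real.log (a ^ 2 / 2) by ring, Real.exp_log (by positivity)] at h1
  have h2 : Real.exp (prof a (Real.log (a ^ 2 / 2) / 2)) = 1 := by
    have : a ^ 2 ≠ 0 := by positivity
    field_simp at h1
    linarith
  rwa [Real.exp_eq_one_iff] at h2

theorem profMass_center {a : ℝ} (ha : 0 < a) : profMass a (Real.log (a ^ 2 / 2) / 2) = 2 := by
  unfold profMass
  rw [profB_mul_exp_center ha]
  ring

theorem abs_exp_sub_exp_le {x y b : ℝ} (hx : x ≤ b) (hy : y ≤ b) :
    |Real.exp x - Real.exp y| ≤ Real.exp b * |x - y| := by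
  have key : ∀ x y : ℝ, y ≤ x → x ≤ b → |Real.exp x - Real.exp y| ≤ Real.exp b * |x - y| := by
    intro x y hyx hxb
    rw [abs_of_nonneg (sub_nonneg.2 (Real.exp_le_exp.2 hyx)), abs_of_nonneg (sub_nonneg.2 hyx)]
    have h1 := Real.add_one_le_exp (y - x)
    have h2 : Real.exp y = Real.exp x * Real.exp (y - x) := by rw [← Real.exp_add]; ring_nf
    have h3 := mul_le_mul_of_nonneg_left h1 (Real.exp_pos x).le
    have h4 := mul_le_mul_of_nonneg_right (Real.exp_le_exp.2 hxb) (sub_nonneg.2 hyx)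
    nlinarith
  rcases le_total y x with h | h
  · exact key x y h hx
  · rw [abs_sub_comm, abs_sub_comm x]; exact key y x h hy

/-- A two-sided Gronwall estimate. -/
theorem norm_le_of_norm_deriv_le {E : Type*} [NormedAddCommGroup E] [NormedSpace ℝ E]
    {y y' : ℝ → E} {M p δ K ε : ℝ} (hp : p ∈ Icc (-M) M) (hK : 1 ≤ K) (hε : 0 ≤ ε)
    (hy : ∀ s ∈ Icc (-M) M, HasDerivAt y (y' s) s) (hδ : ‖y p‖ ≤ δ)
    (hb : ∀ s ∈ Icc (-M) M, ‖y' s‖ ≤ K * ‖y s‖ + ε) :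
    ∀ s ∈ Icc (-M) M, ‖y s‖ ≤ (δ + ε) * Real.exp (K * (2 * M)) := by
  have hgb : ∀ t, 0 ≤ t → t ≤ 2 * M → gronwallBound δ K ε t ≤ (δ + ε) * Real.exp (K * (2 * M)) := by
    intro t ht htM
    rw [gronwallBound_of_K_ne_0 (by linarith)]
    have hδ0 : 0 ≤ δ := (norm_nonneg _).trans hδ
    have h1 : Real.exp (K * t) ≤ Real.exp (K * (2 * M)) :=
      Real.exp_le_exp.2 (mul_le_mul_of_nonneg_left htM (by linarith))
    have h2 : ε / K ≤ ε := div_le_self hε hK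
    have h3 : 1 ≤ Real.exp (K * t) := Real.one_le_exp (by positivity)
    have h4 : ε / K * (Real.exp (K * t) - 1) ≤ ε * (Real.exp (K * (2 * M))) :=
      mul_le_mul h2 (by linarith) (by linarith) hε
    have h5 := mul_le_mul_of_nonneg_left h1 hδ0
    linarith
  intro s hs
  rcases le_total p s with h | h
  · have := norm_le_gronwallBound_of_norm_deriv_right_le (f := y) (f' := y') (δ := δ) (K := K)
      (ε := ε) (a := p) (b := s)
      (fun t ht => (hy t ⟨hp.1.trans ht.1, ht.2.trans hs.2⟩).continuousAt.continuousWithinAt)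
      (fun t ht => (hy t ⟨hp.1.trans ht.1, ht.2.le.trans hs.2⟩).hasDerivWithinAt) hδ
      (fun t ht => hb t ⟨hp.1.trans ht.1, ht.2.le.trans hs.2⟩) s ⟨h, le_rfl⟩
    exact this.trans (hgb _ (by linarith) (by linarith [hp.1, hs.2]))
  · have hd : ∀ t ∈ Icc (-p) (-s), HasDerivAt (fun t => y (-t)) (-y' (-t)) t := fun t ht => by
      have h1 := hy (-t) ⟨by linarith [ht.2, hs.1], by linarith [ht.1, hp.2]⟩
      simpa [Function.comp_def] using h1.scomp t (hasDerivAt_neg t)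
    have := norm_le_gronwallBound_of_norm_deriv_right_le (f := fun t => y (-t))
      (f' := fun t => -y' (-t)) (δ := δ) (K := K)
      (ε := ε) (a := -p) (b := -s)
      (fun t ht => (hd t ht).continuousAt.continuousWithinAt)
      (fun t ht => (hd t ⟨ht.1, ht.2.le⟩).hasDerivWithinAt) (by simpa using hδ)
      (fun t ht => by
        rw [norm_neg]
        exact hb (-t) ⟨by linarith [ht.2, hs.1], by linarith [ht.1, hp.2]⟩) (-s)
      ⟨by linarith, le_rfl⟩
    simp only [neg_neg] at this
    exact this.trans (hgb _ (by linarith) (by linarith [hp.2, hs.1]))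

/-! ### Convergence to the limit profile on compact logarithmic intervals. -/

namespace Family

variable {f N D D2 κ : ℝ → ℝ} {T q c C : ℝ} {Λ mu : ℕ → ℝ} {U ω : ℕ → ℝ → ℝ}

/-- The linearisation error of the convex function N lies between 0 and the difference of slopes
times the displacement. The relative change of D thus controls it without any bound on N''. -/
theorem _root_.InfConc.Growth.abs_N_sub_le {f N D D2 : ℝ → ℝ} {T q : ℝ}
    (G : Growth f N D D2 T q) {v y : ℝ} (hv : T ≤ v) (hy : T ≤ y) :
    |N y - N v - D v * (y - v)| ≤ |D y / D v - 1| * |D v * (y - v)| := by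
  have hD := G.D_pos v hv
  rw [← abs_mul, show (D y / D v - 1) * (D v * (y - v)) = (D y - D v) * (y - v) by field_simp]
  rcases le_total v y with h | h
  · have h1 := G.D_mul_le_sub hv h
    have h2 := G.sub_le_D_mul hv h
    rw [abs_of_nonneg (by linarith)]
    refine le_trans ?_ (le_abs_self _)
    linarith
  · have h1 := G.D_mul_le_sub hy h
    have h2 := G.sub_le_D_mul hy h
    rw [abs_of_nonneg (by linarith)]
    refine le_trans ?_ (le_abs_self _)
    linarith

/-- The rescaled density, in terms of the rescaled solution. -/
theorem mul_dens_eq (F : Family f κ Λ mu U ω c C) (G : Growth f N D D2 T q) (n : ℕ) {σ cn t : ℝ}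
    (hσ : σ ≤ 0) (hv : T ≤ U n σ) (hy : T ≤ U n t)
    (hc : κ σ * (D (U n σ) * (Λ n * f (U n σ))) * Real.exp (2 * cn) = 1) :
    D (U n σ) * (κ t * dens f (Λ n) (U n) t)
      = κ t / κ σ * Real.exp (2 * (t - cn) + (N (U n t) - N (U n σ))) := by
  have hκ := (F.κ_pos hσ).ne'
  have h1 : D (U n σ) * (Λ n * f (U n σ)) = Real.exp (-(2 * cn)) / κ σ := by
    rw [Real.exp_neg, eq_div_iff hκ]
    exact eq_inv_of_mul_eq_one_left (by linarith)
  unfold dens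
  have h2 : f (U n t) = f (U n σ) * Real.exp (N (U n t) - N (U n σ)) := by
    rw [G.exp_N _ hv, G.exp_N _ hy, ← Real.exp_add]; congr 1; ring
  rw [h2, show 2 * (t - cn) + (N (U n t) - N (U n σ))
    = -(2 * cn) + 2 * t + (N (U n t) - N (U n σ)) by ring, Real.exp_add, Real.exp_add]
  linear_combination (κ t * Real.exp (2 * t) * Real.exp (N (U n t) - N (U n σ))) * h1

theorem abs_dens_sub_le {r A P E b e : ℝ} (hr : |r - 1| ≤ e) (hA : A ≤ b) (hP : P ≤ b)
    (hAP : |A - P| ≤ E) : |r * Real.exp A - Real.exp P| ≤ Real.exp b * (e + E) := by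
  have h1 := abs_exp_sub_exp_le hA hP
  have h2 : |(r - 1) * Real.exp A| ≤ e * Real.exp b := by
    rw [abs_mul, abs_of_pos (Real.exp_pos A)]
    exact mul_le_mul hr (Real.exp_le_exp.2 hA) (Real.exp_pos _).le ((abs_nonneg _).trans hr)
  have h3 := mul_le_mul_of_nonneg_left hAP (Real.exp_pos b).le
  calc _ = |(r - 1) * Real.exp A + (Real.exp A - Real.exp P)| := by ring_nf
    _ ≤ _ := abs_add_le _ _
    _ ≤ _ := by linarith

theorem center_tendsto_atBot (F : Family f κ Λ mu U ω c C) (G : Growth f N D D2 T q)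
    {x a : ℝ} {σ : ℕ → ℝ} (S : Center f N D Λ mu U ω x a σ) :
    Tendsto σ atTop atBot := by
  refine F.tendsto_atBot_of_bounded G (B := max 3 (a ^ 2 / 2 + 1))
    (S.neg.mono fun n hn => hn.le) S.top ?_ ?_
  · exact (S.mass.eventually (gt_mem_nhds (show (2 : ℝ) < 3 by norm_num))).mono fun n hn =>
      hn.le.trans (le_max_left _ _)
  · exact (S.density.eventually (gt_mem_nhds (lt_add_one _))).mono fun n hn =>
      hn.le.trans (le_max_right _ _)

/-- Here `cn` is the logarithm of the scale and σ that of the centre: the density at the centre says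
that e^{2(σ - cn)} → a^2/2. -/
theorem scale_sub_tendsto (F : Family f κ Λ mu U ω c C) (G : Growth f N D D2 T q)
    {x a : ℝ} {σ cn : ℕ → ℝ} (S : Center f N D Λ mu U ω x a σ) (ha : 0 < a)
    (hc : ∀ᶠ n in atTop, κ (σ n) * (D (U n (σ n)) * (Λ n * f (U n (σ n)))) * Real.exp (2 * cn n) = 1) :
    Tendsto (fun n => σ n - cn n) atTop (𝓝 (Real.log (a ^ 2 / 2) / 2)) := by
  have h1 := ((F.κ_tendsto.comp (F.center_tendsto_atBot G S)).mul S.density)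
  rw [one_mul] at h1
  have h2 := ((Real.continuousAt_log (by positivity : a ^ 2 / 2 ≠ 0)).tendsto.comp h1).div_const 2
  refine h2.congr' ?_
  filter_upwards [hc] with n hn
  simp only [Function.comp, dens]
  have h3 : κ (σ n) * (D (U n (σ n)) * (Λ n * Real.exp (2 * σ n) * f (U n (σ n))))
      = Real.exp (2 * (σ n - cn n)) := by
    rw [mul_sub, Real.exp_sub, eq_div_iff (Real.exp_pos _).ne']
    linear_combination (Real.exp (2 * σ n)) * hn
  rw [h3, Real.log_exp]; ring

/-- The smallness condition on η that makes both the Gronwall bound and the resulting density error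
at most ε. -/
theorem gronwall_arith {K X B ε η : ℝ} (hK : 1 ≤ K) (hX : 1 ≤ X) (hB : 0 ≤ B) (hη : 0 ≤ η)
    (h : (3 + 2 * B) * K ^ 2 * X * η ≤ ε) :
    (η + K * ((1 + B) * η)) * X ≤ ε ∧
      K * ((η + K * ((1 + B) * η)) * X) + K * ((1 + B) * η) ≤ ε := by
  have h1 : K ≤ K ^ 2 := by nlinarith
  have h2 : K * X ≤ K ^ 2 * X := mul_le_mul_of_nonneg_right h1 (by linarith)
  have h3 : K ≤ K ^ 2 * X := h1.trans (le_mul_of_one_le_right (by positivity) hX)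
  have h4 := mul_le_mul_of_nonneg_right h2 hη
  have h5 := mul_le_mul_of_nonneg_right h3 (show 0 ≤ (1 + B) * η by positivity)
  have h6 : K * ((η + K * ((1 + B) * η)) * X) + K * ((1 + B) * η) ≤ ε := by linarith
  have h7 : 0 ≤ (η + K * ((1 + B) * η)) * X := by positivity
  have h8 : 0 ≤ K * ((1 + B) * η) := by positivity
  have h9 := mul_le_mul_of_nonneg_right hK h7
  exact ⟨by linarith, h6⟩

set_option maxHeartbeats 1000000 in
/-- Convergence of a rescaled solution to the limit profile, in logarithmic coordinates. -/
theorem profile_tendsto (F : Family f κ Λ mu U ω c C) (G : Growth f N D D2 T q)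
    {x a : ℝ} {σ cn : ℕ → ℝ} (S : Center f N D Λ mu U ω x a σ) (ha : 0 < a)
    (hc : ∀ᶠ n in atTop, κ (σ n) * (D (U n (σ n)) * (Λ n * f (U n (σ n)))) * Real.exp (2 * cn n) = 1)
    (M : ℝ) {ε : ℝ} (hε : 0 < ε) :
    ∀ᶠ n in atTop, ∀ s ∈ Icc (-M) M, cn n + s < 0 ∧ T ≤ U n (cn n + s) ∧
      |D (U n (σ n)) * (U n (cn n + s) - U n (σ n)) - prof a s| ≤ ε ∧
      |D (U n (σ n)) * ω n (cn n + s) - profMass a s| ≤ ε ∧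
      |D (U n (σ n)) * (κ (cn n + s) * dens f (Λ n) (U n) (cn n + s))
        - Real.exp (2 * s + prof a s)| ≤ ε := by
  set ℓ := Real.log (a ^ 2 / 2) / 2 with hℓ
  have hσbot := F.center_tendsto_atBot G S
  have hsc := F.scale_sub_tendsto G S ha hc
  -- The data for Gronwall are prescribed at σ - cn, which tends to ℓ, so the window is enlarged
  -- until it contains that point.
  set m : ℝ := max M (|ℓ| + 1) with hm
  have hm0 : 0 < m := lt_of_lt_of_le (by positivity) (le_max_right _ _)
  have hMm : M ≤ m := le_max_left _ _
  set v : ℕ → ℝ := fun n => U n (σ n) with hv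
  have hvT : ∀ᶠ n in atTop, T ≤ v n := S.top.eventually_ge_atTop T
  set B0 : ℝ := max 3 (a ^ 2 / 2 + 1) with hB0
  have hω3 : ∀ᶠ n in atTop, D (v n) * ω n (σ n) ≤ B0 :=
    (S.mass.eventually (gt_mem_nhds (show (2 : ℝ) < 3 by norm_num))).mono fun n hn =>
      hn.le.trans (le_max_left _ _)
  have hfwd := F.mul_dens_le_of_le G (S.neg.mono fun n hn => hn.le) S.top hω3
    ((S.density.eventually (gt_mem_nhds (lt_add_one _))).mono fun n hn =>
      hn.le.trans (le_max_right _ _)) (M := 2 * m) (by linarith)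
  set B1 : ℝ := B0 + 2 * m * (C * Real.exp (2 * (2 * m)) * B0) with hB1
  have hB03 : 3 ≤ B0 := le_max_left _ _
  have hCp := F.C_pos
  have hB01 : B0 ≤ B1 := by
    have : 0 ≤ 2 * m * (C * Real.exp (2 * (2 * m)) * B0) := by positivity
    linarith
  set B2 : ℝ := 2 * m * B1 with hB2
  have hB2pos : 0 < B2 := by positivity
  have hloc : ∀ᶠ n in atTop, |σ n - cn n| ≤ m := by
    filter_upwards [Metric.tendsto_nhds.1 hsc 1 one_pos] with n hn
    rw [Real.dist_eq] at hn
    have := abs_sub_abs_le_abs_sub (σ n - cn n) ℓ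
    have h2 : |ℓ| + 1 ≤ m := le_max_right _ _
    linarith
  -- a priori bound
  have hZ : ∀ᶠ n in atTop, ∀ t, σ n - 2 * m ≤ t → t ≤ σ n + 2 * m →
      t < 0 ∧ |D (v n) * (U n t - v n)| ≤ B2 := by
    filter_upwards [hfwd, hω3, hvT] with n h1 h2 h3 t ht1 ht2
    have hD := G.D_pos _ h3
    have ht0 : t < 0 := lt_of_le_of_lt ht2 h1.1
    refine ⟨ht0, abs_le.2 ⟨?_, ?_⟩⟩
    · have h4 := mul_le_mul_of_nonneg_left (F.anti_U G n ht2 h1.1.le) hD.le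
      have h5 := h1.2.2
      change D (v n) * (v n - U n (σ n + 2 * m)) ≤ B2 at h5
      linarith
    · rcases le_total t (σ n) with h | h
      · have h4 := mul_le_mul_of_nonneg_left (F.sub_le G n h (by linarith [h1.1])) hD.le
        have h5 : D (v n) * ω n (σ n) * (σ n - t) ≤ B1 * (2 * m) :=
          mul_le_mul (h2.trans hB01) (by linarith) (by linarith) (by linarith)
        change D (v n) * (U n t - v n) ≤ _ at h4
        linarith
      · have h4 := F.anti_U G n h ht0.le
        have h5 : D (v n) * (U n t - v n) ≤ 0 :=
          mul_nonpos_of_nonneg_of_nonpos hD.le (sub_nonpos.2 h4)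
        linarith
  -- In the window U moves by O(1/D), which is o(N/D), so D(U)/D(v) → 1. By monotonicity the two
  -- endpoints suffice for uniformity.
  have hslow : ∀ τ : ℕ → ℝ, (∀ᶠ n in atTop, σ n - 2 * m ≤ τ n ∧ τ n ≤ σ n + 2 * m) →
      Tendsto (fun n => U n (τ n)) atTop atTop ∧
      Tendsto (fun n => N (U n (τ n)) / N (v n)) atTop (𝓝 1) ∧
      Tendsto (fun n => D (U n (τ n)) / D (v n)) atTop (𝓝 1) := by
    intro τ hτ
    refine G.slow S.top (w := fun n => U n (τ n)) ?_
    have h1 : Tendsto (fun n => B2 / N (v n)) atTop (𝓝 0) :=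
      tendsto_const_nhds.div_atTop (G.N_tendsto.comp S.top)
    refine squeeze_zero' ?_ ?_ h1
    · filter_upwards [hvT] with n h2
      exact div_nonneg (mul_nonneg (G.D_pos _ h2).le (abs_nonneg _)) (G.N_pos _ h2).le
    · filter_upwards [hvT, hτ, hZ] with n h2 h3 h4
      refine div_le_div_of_nonneg_right ?_ (G.N_pos _ h2).le
      have := (h4 _ h3.1 h3.2).2
      rwa [abs_mul, abs_of_pos (G.D_pos _ h2)] at this
  have hlo := hslow (fun n => σ n + 2 * m) (Eventually.of_forall fun n => ⟨by linarith, le_rfl⟩)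
  have hhi := hslow (fun n => σ n - 2 * m) (Eventually.of_forall fun n => ⟨le_rfl, by linarith⟩)
  -- bound for the profile
  obtain ⟨P, hP⟩ : ∃ P, ∀ s ∈ Icc (-m) m, |prof a s| ≤ P :=
    isCompact_Icc.exists_bound_of_continuousOn (continuous_prof ha).continuousOn
  set bd : ℝ := 2 * m + max (2 * B2) P with hbd
  -- On this bounded range of exponents K is a Lipschitz constant for exp; it is taken at least 1 so
  -- that it also dominates the equation Z' = -W.
  set K : ℝ := max 1 (Real.exp bd) with hK
  have hK1 : 1 ≤ K := le_max_left _ _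
  -- smallness
  set η : ℝ := ε / ((3 + 2 * B2) * K ^ 2 * Real.exp (K * (2 * m))) with hη
  have hηpos : 0 < η := by positivity
  have hκ : ∀ᶠ n in atTop, ∀ s ∈ Icc (-m) m, |κ (cn n + s) / κ (σ n) - 1| ≤ η := by
    obtain ⟨δ, hδ0, hδ⟩ : ∃ δ > 0, ∀ y z : ℝ, |y - 1| < δ → |z - 1| < δ → |y / z - 1| < η := by
      have hcont : Tendsto (fun p : ℝ × ℝ => p.1 / p.2) (𝓝 ((1 : ℝ), (1 : ℝ))) (𝓝 (1 / 1)) :=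
        (continuousAt_fst.div continuousAt_snd one_ne_zero)
      rw [div_one] at hcont
      obtain ⟨δ, hδ0, hδ⟩ := Metric.tendsto_nhds_nhds.1 hcont η hηpos
      refine ⟨δ, hδ0, fun y z hy hz => ?_⟩
      have := @hδ (y, z) (by rw [Prod.dist_eq]; exact max_lt hy hz)
      simpa [Real.dist_eq] using this
    obtain ⟨b', hb'⟩ := eventually_atBot.1 (Metric.tendsto_nhds.1 F.κ_tendsto δ hδ0)
    filter_upwards [hσbot.eventually_le_atBot (b' - 2 * m), hloc] with n h1 h2 s hs
    have h4 := abs_le.1 h2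
    exact (hδ _ _ (hb' _ (by linarith [hs.2])) (hb' _ (by linarith))).le
  have hDr : ∀ᶠ n in atTop, ∀ t, σ n - 2 * m ≤ t → t ≤ σ n + 2 * m → T ≤ U n t ∧
      |D (U n t) / D (v n) - 1| ≤ min η 1 := by
    have hη1 : 0 < min η 1 := by positivity
    filter_upwards [hlo.1.eventually_ge_atTop T, Metric.tendsto_nhds.1 hlo.2.2 _ hη1,
      Metric.tendsto_nhds.1 hhi.2.2 _ hη1, hZ, hvT] with n h1 h2 h3 h4 h5 t ht1 ht2
    rw [Real.dist_eq] at h2 h3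
    have hD := G.D_pos _ h5
    have h6 := (h4 (σ n + 2 * m) (by linarith) le_rfl).1
    have ht0 := (h4 t ht1 ht2).1
    have h7 : T ≤ U n t := h1.trans (F.anti_U G n ht2 h6.le)
    refine ⟨h7, ?_⟩
    have h8 := div_le_div_of_nonneg_right (G.mono_D h1 (F.anti_U G n ht2 h6.le)) hD.le
    have h9 := div_le_div_of_nonneg_right (G.mono_D h7 (F.anti_U G n ht1 ht0.le)) hD.le
    rw [abs_le]
    constructor
    · linarith [(abs_lt.1 h2).1]
    · linarith [(abs_lt.1 h3).2]
  have hinit : ∀ᶠ n in atTop, |prof a (σ n - cn n)| ≤ η ∧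
      |D (v n) * ω n (σ n) - profMass a (σ n - cn n)| ≤ η := by
    have h1 := ((continuous_prof ha).tendsto ℓ).comp hsc
    have h2 := S.mass.sub (((continuous_profMass ha).tendsto ℓ).comp hsc)
    rw [prof_center ha] at h1
    rw [profMass_center ha, sub_self] at h2
    filter_upwards [Metric.tendsto_nhds.1 h1 η hηpos, Metric.tendsto_nhds.1 h2 η hηpos] with n h3 h4
    rw [Real.dist_eq, sub_zero] at h3 h4
    exact ⟨h3.le, h4.le⟩
  filter_upwards [hZ, hκ, hDr, hinit, hloc, hc, hvT, S.neg] with n h1 h2 h3 h4 h5 h6 h7 h8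
  have hD := G.D_pos _ h7
  have hrange : ∀ s ∈ Icc (-m) m, σ n - 2 * m ≤ cn n + s ∧ cn n + s ≤ σ n + 2 * m := by
    intro s hs
    have := abs_le.1 h5
    constructor <;> linarith [hs.1, hs.2]
  set Z : ℝ → ℝ := fun s => D (v n) * (U n (cn n + s) - v n) with hZdef
  set W : ℝ → ℝ := fun s => D (v n) * ω n (cn n + s) with hWdef
  set A : ℝ → ℝ := fun s => D (v n) * (κ (cn n + s) * dens f (Λ n) (U n) (cn n + s)) with hAdef
  have hZ' : ∀ s ∈ Icc (-m) m, HasDerivAt Z (-W s) s := by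
    intro s hs
    have h9 := (h1 _ (hrange s hs).1 (hrange s hs).2).1
    have h10 := (F.hasDeriv_U n _ h9).comp_const_add (cn n) s
    refine ((h10.sub_const (v n)).const_mul (D (v n))).congr_deriv ?_
    simp only [hWdef]; ring
  have hW' : ∀ s ∈ Icc (-m) m, HasDerivAt W (A s) s := by
    intro s hs
    have h9 := (h1 _ (hrange s hs).1 (hrange s hs).2).1
    exact ((F.hasDeriv_ω n _ h9).comp_const_add (cn n) s).const_mul (D (v n))
  have hA : ∀ s ∈ Icc (-m) m, |A s - Real.exp (2 * s + prof a s)|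
      ≤ K * |Z s - prof a s| + K * ((1 + B2) * η) := by
    intro s hs
    obtain ⟨r1, r2⟩ := hrange s hs
    obtain ⟨g1, g2⟩ := h3 _ r1 r2
    obtain ⟨-, z2⟩ := h1 _ r1 r2
    have e1 : A s = κ (cn n + s) / κ (σ n) * Real.exp (2 * s + (N (U n (cn n + s)) - N (v n))) := by
      have := F.mul_dens_eq G n h8.le h7 g1 h6
      rw [add_sub_cancel_left] at this
      exact this
    have e2 := G.abs_N_sub_le h7 g1
    have e3 : |N (U n (cn n + s)) - N (v n) - Z s| ≤ min η 1 * B2 :=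
      e2.trans (mul_le_mul g2 z2 (abs_nonneg _) (by positivity))
    have e4 : min η 1 * B2 ≤ η * B2 := mul_le_mul_of_nonneg_right (min_le_left _ _) hB2pos.le
    have e5 : min η 1 * B2 ≤ 1 * B2 := mul_le_mul_of_nonneg_right (min_le_right _ _) hB2pos.le
    have e6 : |2 * s + (N (U n (cn n + s)) - N (v n)) - (2 * s + prof a s)|
        ≤ |Z s - prof a s| + η * B2 := by
      calc _ = |(Z s - prof a s) + (N (U n (cn n + s)) - N (v n) - Z s)| := by ring_nf
        _ ≤ _ := abs_add_le _ _
        _ ≤ _ := by linarith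
    have e7 : 2 * s + (N (U n (cn n + s)) - N (v n)) ≤ bd := by
      have := (abs_le.1 e3).2
      have := (abs_le.1 z2).2
      have h12 : Z s ≤ B2 := this
      have := le_max_left (2 * B2) P
      linarith [hs.2]
    have e8 : 2 * s + prof a s ≤ bd := by
      have := (abs_le.1 (hP s hs)).2
      have := le_max_right (2 * B2) P
      linarith [hs.2]
    rw [e1]
    refine (abs_dens_sub_le (h2 s hs) e7 e8 e6).trans ?_
    have e9 : Real.exp bd ≤ K := le_max_right _ _
    have e10 : 0 ≤ η + (|Z s - prof a s| + η * B2) := by positivity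
    calc _ ≤ K * (η + (|Z s - prof a s| + η * B2)) := mul_le_mul_of_nonneg_right e9 e10
      _ = _ := by ring
  have hp : σ n - cn n ∈ Icc (-m) m := ⟨(abs_le.1 h5).1, (abs_le.1 h5).2⟩
  have hε2 : 0 ≤ K * ((1 + B2) * η) := by positivity
  -- Rescaled solution and mass are compared with profile and profile mass as one vector. The system
  -- is first order and Lipschitz up to the error K(1 + B2)η from κ and from the linearisation of N.
  have hgr := norm_le_of_norm_deriv_le (y := fun s => (Z s - prof a s, W s - profMass a s))
    (y' := fun s => (-W s - -profMass a s, A s - Real.exp (2 * s + prof a s))) (δ := η)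
    (K := K) (ε := K * ((1 + B2) * η)) hp hK1 hε2
    (fun s hs => ((hZ' s hs).sub (hasDerivAt_prof ha s)).prodMk
      ((hW' s hs).sub (hasDerivAt_profMass ha s)))
    (by
      rw [Prod.norm_def, Real.norm_eq_abs, Real.norm_eq_abs]
      refine max_le ?_ ?_
      · simp only [hZdef, add_sub_cancel, hv, sub_self, mul_zero, zero_sub, abs_neg]
        exact h4.1
      · simp only [hWdef, add_sub_cancel]
        exact h4.2)
    (fun s hs => by
      rw [Prod.norm_def, Prod.norm_def, Real.norm_eq_abs, Real.norm_eq_abs, Real.norm_eq_abs,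
        Real.norm_eq_abs]
      have i1 : |-W s - -profMass a s| = |W s - profMass a s| := by
        rw [← abs_neg]; ring_nf
      simp only [i1]
      have i2 := le_max_left |Z s - prof a s| |W s - profMass a s|
      have i3 := le_max_right |Z s - prof a s| |W s - profMass a s|
      refine max_le ?_ ?_
      · have i4 : 0 ≤ max |Z s - prof a s| |W s - profMass a s| := (abs_nonneg _).trans i2
        have i5 := mul_le_mul_of_nonneg_right hK1 i4
        linarith
      · have i6 := mul_le_mul_of_nonneg_left i2 (zero_le_one.trans hK1)
        linarith [hA s hs])
  have hK0 : 0 < K := by linarith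
  obtain ⟨hKε, hfin⟩ := gronwall_arith hK1 (Real.one_le_exp (by positivity : 0 ≤ K * (2 * m)))
    hB2pos.le hηpos.le (show (3 + 2 * B2) * K ^ 2 * Real.exp (K * (2 * m)) * η ≤ ε by
      simp only [hη]; field_simp; exact le_rfl)
  intro s hs
  have hs' : s ∈ Icc (-m) m := ⟨by linarith [hs.1], hs.2.trans hMm⟩
  have hg := hgr s hs'
  rw [Prod.norm_def, Real.norm_eq_abs, Real.norm_eq_abs] at hg
  have g1 := (le_max_left _ _).trans hg
  have g2 := (le_max_right _ _).trans hg
  simp only at g1 g2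
  obtain ⟨r1, r2⟩ := hrange s hs'
  refine ⟨(h1 _ r1 r2).1, (h3 _ r1 r2).1, g1.trans hKε, g2.trans hKε, (hA s hs').trans ?_⟩
  have := mul_le_mul_of_nonneg_left g1 hK0.le
  linarith

end Family

/-! ### Tails of the profile, and the first bubble up to the origin. -/

theorem tendsto_exp_mul_atBot {a : ℝ} (ha : 0 < a) :
    Tendsto (fun s : ℝ => Real.exp (a * s)) atBot (𝓝 0) :=
  Real.tendsto_exp_atBot.comp (tendsto_id.const_mul_atBot ha)

theorem profMass_tendsto_atBot {a : ℝ} (ha : 0 < a) :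
    Tendsto (profMass a) atBot (𝓝 (2 - a)) := by
  have h1 := ((tendsto_exp_mul_atBot ha).const_mul (profB a)).const_add 1
  rw [mul_zero, add_zero] at h1
  have h2 := ((tendsto_const_nhds (x := 2 * a)).div h1 one_ne_zero).const_sub (2 + a)
  rw [show 2 + a - 2 * a / 1 = 2 - a by ring] at h2
  exact h2

theorem profMass_tendsto_atTop {a : ℝ} (ha : 0 < a) :
    Tendsto (profMass a) atTop (𝓝 (2 + a)) := by
  have h1 : Tendsto (fun s => 1 + profB a * Real.exp (a * s)) atTop atTop :=
    tendsto_atTop_add_const_left _ _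
      ((Real.tendsto_exp_atTop.comp (tendsto_id.const_mul_atTop ha)).const_mul_atTop (profB_pos ha))
  have h2 := (h1.const_div_atTop (2 * a)).const_sub (2 + a)
  rw [sub_zero] at h2
  exact h2

theorem prof_two_tendsto : Tendsto (prof 2) atBot (𝓝 (Real.log (2 * 2 ^ 2 * profB 2))) := by
  have h1 := ((tendsto_exp_mul_atBot two_pos).const_mul (profB 2)).const_add 1
  rw [mul_zero, add_zero] at h1
  have h2 := ((((Real.continuousAt_log one_ne_zero).tendsto.comp h1).const_mul 2)).const_sub
    (Real.log (2 * 2 ^ 2 * profB 2))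
  rw [Real.log_one, mul_zero, sub_zero] at h2
  refine h2.congr fun s => ?_
  simp [prof]

theorem profMass_nonneg {a : ℝ} (ha : 0 < a) (ha2 : a ≤ 2) (s : ℝ) : 0 ≤ profMass a s := by
  have h1 := one_add_profB_pos ha s
  have h2 : 1 ≤ 1 + profB a * Real.exp (a * s) := by
    have := profB_pos ha
    have : 0 ≤ profB a * Real.exp (a * s) := by positivity
    linarith
  have h3 : 2 * a / (1 + profB a * Real.exp (a * s)) ≤ 2 * a := div_le_self (by positivity) h2
  unfold profMass
  linarith

theorem anti_prof {a : ℝ} (ha : 0 < a) (ha2 : a ≤ 2) {s t : ℝ} (hst : s ≤ t) :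
    prof a t ≤ prof a s := by
  have := le_of_hasDerivAt_nonneg (f := fun x => -prof a x) hst
    ((continuous_prof ha).neg.continuousOn) (fun x _ => (hasDerivAt_prof ha x).fun_neg)
    (fun x _ => by rw [neg_neg]; exact profMass_nonneg ha ha2 x)
  linarith

namespace Family

variable {f N D D2 κ : ℝ → ℝ} {T q c C : ℝ} {Λ mu : ℕ → ℝ} {U ω : ℕ → ℝ → ℝ}

theorem κ_ratio (F : Family f κ Λ mu U ω c C) {b σ : ℕ → ℝ} (hb : Tendsto b atTop atBot)
    (hσ : Tendsto σ atTop atBot) {η : ℝ} (hη : 0 < η) :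
    ∀ᶠ n in atTop, ∀ t ≤ b n, |κ t / κ (σ n) - 1| ≤ η := by
  obtain ⟨δ, hδ0, hδ⟩ : ∃ δ > 0, ∀ y z : ℝ, |y - 1| < δ → |z - 1| < δ → |y / z - 1| < η := by
    have hcont : Tendsto (fun p : ℝ × ℝ => p.1 / p.2) (𝓝 ((1 : ℝ), (1 : ℝ))) (𝓝 (1 / 1)) :=
      (continuousAt_fst.div continuousAt_snd one_ne_zero)
    rw [div_one] at hcont
    obtain ⟨δ, hδ0, hδ⟩ := Metric.tendsto_nhds_nhds.1 hcont η hη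
    refine ⟨δ, hδ0, fun y z hy hz => ?_⟩
    have := @hδ (y, z) (by rw [Prod.dist_eq]; exact max_lt hy hz)
    simpa [Real.dist_eq] using this
  obtain ⟨b', hb'⟩ := eventually_atBot.1 (Metric.tendsto_nhds.1 F.κ_tendsto δ hδ0)
  filter_upwards [hb.eventually_le_atBot b', hσ.eventually_le_atBot b'] with n h1 h2 t ht
  exact (hδ _ _ (hb' _ (ht.trans h1)) (hb' _ h2)).le

theorem dens_tendsto_atBot (F : Family f κ Λ mu U ω c C) (G : Growth f N D D2 T q) (n : ℕ)
    (hmu : T ≤ mu n) : Tendsto (dens f (Λ n) (U n)) atBot (𝓝 0) := by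
  have h1 := (tendsto_exp_mul_atBot two_pos).const_mul (Λ n * f (mu n))
  rw [mul_zero] at h1
  refine squeeze_zero' ?_ ?_ h1
  · filter_upwards [eventually_le_atBot 0] with t ht using F.dens_nonneg G n ht
  · filter_upwards [eventually_le_atBot 0] with t ht
    have := mul_le_mul_of_nonneg_left (G.f_le _ _ (F.U_nonneg n t ht) (F.U_le G n ht) hmu)
      (mul_nonneg (F.Λ_pos n).le (Real.exp_pos (2 * t)).le)
    unfold dens
    linarith

/-- Before the mass becomes noticeable, the distance to the maximum is controlled by the
density. -/
theorem mu_sub_le (F : Family f κ Λ mu U ω c C) (G : Growth f N D D2 T q) (n : ℕ) {t : ℝ}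
    (ht : t < 0) (hT : T < U n t) (hω : D (mu n) * ω n t ≤ 1) :
    mu n - U n t ≤ C * dens f (Λ n) (U n) t := by
  have hmu : T ≤ mu n := hT.le.trans (F.U_le G n ht.le)
  have hsub : Iic t ⊆ Iic 0 := Iic_subset_Iic.2 ht.le
  have hTx : ∀ x ≤ t, T < U n x := fun x hx => hT.trans_le (F.anti_U G n hx ht.le)
  have hdens : ∀ x ≤ t, HasDerivAt (dens f (Λ n) (U n))
      (dens f (Λ n) (U n) x * (2 - D (U n x) * ω n x)) x := fun x hx =>
    F.hasDerivAt_dens G n (hx.trans_lt ht) (hTx x hx)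
  have hsmall : ∀ x ≤ t, D (U n x) * ω n x ≤ 1 := fun x hx =>
    (mul_le_mul (G.mono_D (hTx x hx).le (F.U_le G n (hx.trans ht.le))) (F.mono_ω G n hx ht.le)
      (F.ω_nonneg G n (hx.trans ht.le)) (G.D_pos _ hmu).le).trans hω
  have hcont : ContinuousOn (dens f (Λ n) (U n)) (Iic t) := fun x hx =>
    (hdens x hx).continuousAt.continuousWithinAt
  have hlim := F.dens_tendsto_atBot G n hmu
  -- Normalised mass at most 1 means that the density K satisfies K' ≥ K. Comparing derivatives from
  -- -∞ gives ω ≤ C K, and once more μ - U ≤ C K.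
  have hgrow : ∀ x ≤ t, dens f (Λ n) (U n) x ≤
      dens f (Λ n) (U n) x * (2 - D (U n x) * ω n x) := fun x hx =>
    le_mul_of_one_le_right (F.dens_nonneg G n (hx.trans ht.le)) (by linarith [hsmall x hx])
  have h1 : ∀ x ≤ t, ω n x ≤ C * dens f (Λ n) (U n) x := by
    intro x hx
    have := le_of_hasDerivAt_nonneg_atBot (f := fun y => C * dens f (Λ n) (U n) y - ω n y)
      (f' := fun y => C * (dens f (Λ n) (U n) y * (2 - D (U n y) * ω n y))
        - κ y * dens f (Λ n) (U n) y) (b := x) (l := 0)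
      ((continuousOn_const.mul (hcont.mono (Iic_subset_Iic.2 hx))).sub
        ((F.cont_ω n).mono (Iic_subset_Iic.2 (hx.trans ht.le))))
      (fun y hy => ((hdens y (hy.le.trans hx)).const_mul C).fun_sub
        (F.hasDeriv_ω n y (hy.trans_le (hx.trans ht.le))))
      (fun y hy => by
        have hy0 : y ≤ 0 := hy.le.trans (hx.trans ht.le)
        have a1 := mul_le_mul_of_nonneg_left (hgrow y (hy.le.trans hx)) F.C_pos.le
        have a2 := mul_le_mul_of_nonneg_right (F.κ_le y hy0) (F.dens_nonneg G n hy0)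
        linarith)
      (by simpa using (hlim.const_mul C).sub (F.ω_tendsto n))
    linarith
  have h2 := le_of_hasDerivAt_nonneg_atBot (f := fun y => U n y + C * dens f (Λ n) (U n) y)
    (f' := fun y => -ω n y + C * (dens f (Λ n) (U n) y * (2 - D (U n y) * ω n y)))
    (b := t) (l := mu n)
    (((F.cont_U n).mono hsub).add (continuousOn_const.mul hcont))
    (fun y hy => (F.hasDeriv_U n y (hy.trans ht)).fun_add ((hdens y hy.le).const_mul C))
    (fun y hy => by
      have a1 := mul_le_mul_of_nonneg_left (hgrow y hy.le) F.C_pos.le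
      linarith [h1 y hy.le])
    (by simpa using (F.U_tendsto n).add (hlim.const_mul C))
  linarith

set_option maxHeartbeats 1000000 in
/-- Convergence of a rescaled solution to the first limit profile, up to the origin. -/
theorem origin_tendsto (F : Family f κ Λ mu U ω c C) (G : Growth f N D D2 T q)
    {σ cn : ℕ → ℝ} (S : Center f N D Λ mu U ω 1 2 σ)
    (hc : ∀ᶠ n in atTop, κ (σ n) * (D (U n (σ n)) * (Λ n * f (U n (σ n)))) * Real.exp (2 * cn n) = 1)
    (M : ℝ) {ε : ℝ} (hε : 0 < ε) :
    ∀ᶠ n in atTop, ∀ s ≤ M, cn n + s < 0 ∧ T ≤ U n (cn n + s) ∧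
      |D (U n (σ n)) * (U n (cn n + s) - U n (σ n)) - prof 2 s| ≤ ε ∧
      |D (U n (σ n)) * ω n (cn n + s) - profMass 2 s| ≤ ε * Real.exp (2 * s) ∧
      |D (U n (σ n)) * (κ (cn n + s) * dens f (Λ n) (U n) (cn n + s))
        - Real.exp (2 * s + prof 2 s)| ≤ ε * Real.exp (2 * s) := by
  set v : ℕ → ℝ := fun n => U n (σ n) with hv
  have hvT : ∀ᶠ n in atTop, T ≤ v n := S.top.eventually_ge_atTop T
  have hσbot := F.center_tendsto_atBot G S
  have hsc := F.scale_sub_tendsto G S two_pos hc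
  have hcbot : Tendsto cn atTop atBot := by
    have := hσbot.atBot_add hsc.neg
    refine this.congr fun n => by ring
  have hcp := F.c_pos
  have hCp := F.C_pos
  -- constants
  set L := Real.log (2 * 2 ^ 2 * profB 2) with hL
  set P : ℝ := max |prof 2 M| |L| with hP
  have hPb : ∀ s ≤ M, |prof 2 s| ≤ P := by
    intro s hs
    have h1 : prof 2 s ≤ L := ge_of_tendsto prof_two_tendsto (by
      filter_upwards [eventually_le_atBot s] with t ht using anti_prof two_pos le_rfl ht)
    have h2 := anti_prof two_pos le_rfl hs
    have h3 := le_max_left |prof 2 M| |L|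
    have h4 := le_max_right |prof 2 M| |L|
    rw [abs_le]
    constructor
    · linarith [neg_abs_le (prof 2 M)]
    · linarith [le_abs_self L]
  have hP0 : 0 ≤ P := (abs_nonneg _).trans (hPb M le_rfl)
  set bd : ℝ := 2 * (P + 3) with hbd
  have hbd0 : 0 ≤ bd := by positivity
  set η : ℝ := min 1 (ε / (Real.exp bd * (7 + P))) with hη
  have hη0 : 0 < η := by positivity
  have hη1 : η ≤ 1 := min_le_left _ _
  have hηε : Real.exp bd * (7 + P) * η ≤ ε := by
    have : η ≤ ε / (Real.exp bd * (7 + P)) := min_le_right _ _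
    rwa [le_div_iff₀ (by positivity), mul_comm] at this
  -- the inner radius
  obtain ⟨M0, hM0M, hM0a, hM0b, hM0c⟩ : ∃ M0, |M| ≤ M0 ∧
      (∀ s ≤ -M0, |prof 2 s - prof 2 (-M0)| ≤ η) ∧
      C * Real.exp (2 * (-M0) + prof 2 (-M0)) ≤ c * η / 2 ∧ profMass 2 (-M0) ≤ 1 / 4 := by
    have h1 := Metric.tendsto_nhds.1 prof_two_tendsto (η / 2) (half_pos hη0)
    have h2 : Tendsto (fun s => C * Real.exp (2 * s + prof 2 s)) atBot (𝓝 0) := by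
      have := ((tendsto_exp_mul_atBot two_pos).mul
        ((Real.continuous_exp.tendsto _).comp prof_two_tendsto)).const_mul C
      rw [zero_mul, mul_zero] at this
      refine this.congr fun s => by rw [Real.exp_add]; rfl
    have h3 := profMass_tendsto_atBot two_pos
    rw [sub_self] at h3
    obtain ⟨b, hb⟩ := eventually_atBot.1 ((h1.and (h2.eventually (gt_mem_nhds
      (show 0 < c * η / 2 by positivity)))).and (h3.eventually (gt_mem_nhds
      (show (0 : ℝ) < 1 / 4 by norm_num))))
    refine ⟨max |M| (-b), le_max_left _ _, ?_, ?_, ?_⟩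
    · intro s hs
      have e1 : -max |M| (-b) ≤ b := by linarith [le_max_right |M| (-b)]
      have e2 := (hb s (hs.trans e1)).1.1
      have e3 := (hb _ e1).1.1
      rw [Real.dist_eq, ← hL] at e2 e3
      have := abs_sub_le (prof 2 s) L (prof 2 (-max |M| (-b)))
      rw [abs_sub_comm L] at this
      linarith
    · exact (hb _ (by linarith [le_max_right |M| (-b)])).1.2.le
    · exact (hb _ (by linarith [le_max_right |M| (-b)])).2.le
  have hM0 : 0 ≤ M0 := (abs_nonneg M).trans hM0M
  -- By `mu_sub_le` the tail μ - U is at most (C/c) κ K. The profile density at -M0 and the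
  -- deviation from it, at most ε', each contribute η/2 to the normalised tail. The bound 1/4
  -- ensures the smallness of the mass required there.
  set ε' : ℝ := min (min η (1 / 4)) (c * η / (2 * C)) with hε'
  have hε'0 : 0 < ε' := by positivity
  have hprof := F.profile_tendsto G S two_pos hc M0 hε'0
  -- `D` is almost constant
  have hmuD : Tendsto (fun n => D (mu n) / D (v n)) atTop (𝓝 1) := by
    have h1 := G.D_ratio_tendsto one_pos F.mu_tendsto S.top
      (S.neg.mono fun n hn => F.U_le G n hn.le) S.height
    rw [Real.one_rpow] at h1
    have := h1.inv₀ one_ne_zero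
    rw [inv_one] at this
    refine this.congr fun n => by rw [inv_div]
  obtain ⟨hlotop, -, hlo⟩ : Tendsto (fun n => U n (cn n + M0)) atTop atTop ∧ _ ∧
      Tendsto (fun n => D (U n (cn n + M0)) / D (v n)) atTop (𝓝 1) := by
    refine G.slow S.top (w := fun n => U n (cn n + M0)) ?_
    have h1 : Tendsto (fun n => (|prof 2 M0| + 1) / N (v n)) atTop (𝓝 0) :=
      tendsto_const_nhds.div_atTop (G.N_tendsto.comp S.top)
    refine squeeze_zero' ?_ ?_ h1
    · filter_upwards [hvT] with n h2
      exact div_nonneg (mul_nonneg (G.D_pos _ h2).le (abs_nonneg _)) (G.N_pos _ h2).le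
    · filter_upwards [hvT, hprof] with n h2 h3
      refine div_le_div_of_nonneg_right ?_ (G.N_pos _ h2).le
      have h4 := (h3 M0 ⟨by linarith, le_rfl⟩).2.2.1
      have h5 := abs_sub_abs_le_abs_sub (D (v n) * (U n (cn n + M0) - v n)) (prof 2 M0)
      have h6 : ε' ≤ 1 := (min_le_left _ _).trans ((min_le_left _ _).trans hη1)
      rw [abs_mul, abs_of_pos (G.D_pos _ h2)] at h5
      change |D (v n) * (U n (cn n + M0) - v n) - prof 2 M0| ≤ ε' at h4
      linarith
  have hκ := F.κ_ratio (hcbot.atBot_add (tendsto_const_nhds (x := M0))) hσbot hη0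
  filter_upwards [hprof, hvT, S.neg, hκ, Metric.tendsto_nhds.1 hmuD η hη0,
    Metric.tendsto_nhds.1 hlo η hη0, hc, F.mu_tendsto.eventually_ge_atTop T,
    hmuD.eventually (gt_mem_nhds (show (1 : ℝ) < 2 by norm_num)),
    hlotop.eventually_gt_atTop T]
    with n h1 h2 h3 h4 h5 h6 h7 h8 h9 h10
  rw [Real.dist_eq] at h5 h6
  have hD := G.D_pos _ h2
  have hmem0 : -M0 ∈ Icc (-M0) M0 := ⟨le_rfl, by linarith⟩
  have hmem1 : M0 ∈ Icc (-M0) M0 := ⟨by linarith, le_rfl⟩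
  obtain ⟨p1, p2, p3, p4, p5⟩ := h1 _ hmem0
  obtain ⟨r1, r2, -, -, -⟩ := h1 _ hmem1
  have hε'η : ε' ≤ η := (min_le_left _ _).trans (min_le_left _ _)
  have hε'4 : ε' ≤ 1 / 4 := (min_le_left _ _).trans (min_le_right _ _)
  -- near the origin
  have htail : D (v n) * (mu n - U n (cn n + -M0)) ≤ η := by
    have hlt : T < U n (cn n + -M0) := h10.trans_le (F.anti_U G n (by linarith) r1.le)
    have b1 : D (mu n) * ω n (cn n + -M0) ≤ 1 := by
      have b2 := (abs_le.1 p4).2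
      have b3 : D (v n) * ω n (cn n + -M0) ≤ 1 / 2 := by
        change D (v n) * ω n (cn n + -M0) - profMass 2 (-M0) ≤ ε' at b2
        linarith
      have b4 : D (mu n) ≤ 2 * D (v n) := by
        rw [div_lt_iff₀ hD] at h9
        exact h9.le
      have b5 := mul_le_mul_of_nonneg_right b4 (F.ω_nonneg G n p1.le)
      linarith
    have b2 := F.mu_sub_le G n p1 hlt b1
    have b3 := (abs_le.1 p5).2
    have b4 : D (v n) * (κ (cn n + -M0) * dens f (Λ n) (U n) (cn n + -M0))
        ≤ Real.exp (2 * -M0 + prof 2 (-M0)) + ε' := by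
      change D (v n) * (κ (cn n + -M0) * dens f (Λ n) (U n) (cn n + -M0))
        - Real.exp (2 * -M0 + prof 2 (-M0)) ≤ ε' at b3
      linarith
    have b5 : c * (D (v n) * dens f (Λ n) (U n) (cn n + -M0)) ≤
        D (v n) * (κ (cn n + -M0) * dens f (Λ n) (U n) (cn n + -M0)) := by
      have := mul_le_mul_of_nonneg_right (F.κ_ge _ p1.le)
        (mul_nonneg hD.le (F.dens_nonneg G n p1.le))
      linarith
    have b6 : C * ε' ≤ c * η / 2 := by
      have : ε' ≤ c * η / (2 * C) := min_le_right _ _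
      rw [le_div_iff₀ (by positivity)] at this
      linarith
    have b7 := mul_le_mul_of_nonneg_left (b5.trans b4) hCp.le
    have b8 := mul_le_mul_of_nonneg_left b2 hD.le
    have b9 : c * (C * (D (v n) * dens f (Λ n) (U n) (cn n + -M0))) ≤ c * η := by
      rw [show 2 * -M0 = 2 * (-M0) by ring] at b7
      linarith
    have b10 := le_of_mul_le_mul_left b9 hcp
    linarith
  have hZ : ∀ s ≤ M, cn n + s < 0 ∧ T ≤ U n (cn n + s) ∧
      |D (v n) * (U n (cn n + s) - v n) - prof 2 s| ≤ 3 * η := by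
    intro s hs
    have hsM0 : s ≤ M0 := hs.trans ((le_abs_self M).trans hM0M)
    rcases le_total (-M0) s with hh | hh
    · obtain ⟨a1, a2, a3, -, -⟩ := h1 s ⟨hh, hsM0⟩
      refine ⟨a1, a2, a3.trans ?_⟩
      linarith
    · have a0 : cn n + s ≤ cn n + -M0 := by linarith
      have a1 := F.anti_U G n a0 p1.le
      refine ⟨by linarith, p2.trans a1, ?_⟩
      have a2 := mul_le_mul_of_nonneg_left (F.U_le G n (t := cn n + s) (by linarith)) hD.le
      have a3 := mul_le_mul_of_nonneg_left a1 hD.le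
      have a4 : |D (v n) * (U n (cn n + s) - v n) - D (v n) * (U n (cn n + -M0) - v n)| ≤ η := by
        rw [abs_of_nonneg (by linarith)]
        linarith
      have a5 := hM0a s hh
      rw [abs_sub_comm] at a5
      have a6 : |D (v n) * (U n (cn n + -M0) - v n) - prof 2 (-M0)| ≤ ε' := p3
      calc _ = |(D (v n) * (U n (cn n + s) - v n) - D (v n) * (U n (cn n + -M0) - v n)) +
            (D (v n) * (U n (cn n + -M0) - v n) - prof 2 (-M0)) + (prof 2 (-M0) - prof 2 s)| := by
            ring_nf
        _ ≤ _ := abs_add_three _ _ _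
        _ ≤ _ := by linarith
  have hA : ∀ s ≤ M, |D (v n) * (κ (cn n + s) * dens f (Λ n) (U n) (cn n + s))
      - Real.exp (2 * s + prof 2 s)| ≤ ε * Real.exp (2 * s) := by
    intro s hs
    obtain ⟨a1, a2, a3⟩ := hZ s hs
    have hsM0 : s ≤ M0 := hs.trans ((le_abs_self M).trans hM0M)
    have e1 := F.mul_dens_eq G n h3.le h2 a2 h7
    rw [add_sub_cancel_left] at e1
    change D (v n) * (κ (cn n + s) * dens f (Λ n) (U n) (cn n + s)) = _ * Real.exp (2 * s + (N (U n (cn n + s)) - N (v n))) at e1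
    have hZb : |D (v n) * (U n (cn n + s) - v n)| ≤ P + 3 := by
      have := abs_sub_abs_le_abs_sub (D (v n) * (U n (cn n + s) - v n)) (prof 2 s)
      linarith [hPb s hs]
    have hDr : |D (U n (cn n + s)) / D (v n) - 1| ≤ η := by
      have b1 := div_le_div_of_nonneg_right (G.mono_D a2 (F.U_le G n a1.le)) hD.le
      have b2 := div_le_div_of_nonneg_right
        (G.mono_D r2 (F.anti_U G n (show cn n + s ≤ cn n + M0 by linarith) r1.le)) hD.le
      rw [abs_le]
      constructor
      · linarith [(abs_lt.1 h6).1]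
      · linarith [(abs_lt.1 h5).2]
    have e2 := G.abs_N_sub_le h2 a2
    have e3 : |N (U n (cn n + s)) - N (v n) - D (v n) * (U n (cn n + s) - v n)| ≤ η * (P + 3) :=
      e2.trans (mul_le_mul hDr hZb (abs_nonneg _) hη0.le)
    have e3' : η * (P + 3) ≤ 1 * (P + 3) := mul_le_mul_of_nonneg_right hη1 (by positivity)
    have e4 : |N (U n (cn n + s)) - N (v n) - prof 2 s| ≤ 3 * η + η * (P + 3) := by
      calc _ = |(D (v n) * (U n (cn n + s) - v n) - prof 2 s) +
          (N (U n (cn n + s)) - N (v n) - D (v n) * (U n (cn n + s) - v n))| := by ring_nf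
        _ ≤ _ := abs_add_le _ _
        _ ≤ _ := by linarith
    have e5 : N (U n (cn n + s)) - N (v n) ≤ bd := by
      linarith [(abs_le.1 e3).2, (abs_le.1 hZb).2]
    have e6 : prof 2 s ≤ bd := by linarith [(abs_le.1 (hPb s hs)).2]
    have e7 := abs_dens_sub_le (h4 _ (show cn n + s ≤ cn n + M0 by linarith)) e5 e6 e4
    rw [e1, Real.exp_add, Real.exp_add, show κ (cn n + s) / κ (σ n) * (Real.exp (2 * s) *
      Real.exp (N (U n (cn n + s)) - N (v n))) - Real.exp (2 * s) * Real.exp (prof 2 s)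
      = (κ (cn n + s) / κ (σ n) * Real.exp (N (U n (cn n + s)) - N (v n)) - Real.exp (prof 2 s))
        * Real.exp (2 * s) by ring, abs_mul, abs_of_pos (Real.exp_pos (2 * s))]
    refine mul_le_mul_of_nonneg_right (e7.trans ?_) (Real.exp_pos _).le
    refine le_trans (le_of_eq ?_) hηε
    ring
  -- The mass error vanishes at -∞ and its derivative is the density error, so the weight e^{2s}
  -- survives integration. This weight allows division by r^2 near the origin.
  have hW : ∀ s ≤ M, |D (v n) * ω n (cn n + s) - profMass 2 s| ≤ ε * Real.exp (2 * s) := by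
    intro s hs
    have hder : ∀ x < s, HasDerivAt (fun x => D (v n) * ω n (cn n + x) - profMass 2 x)
        (D (v n) * (κ (cn n + x) * dens f (Λ n) (U n) (cn n + x)) - Real.exp (2 * x + prof 2 x)) x :=
      fun x hx => (((F.hasDeriv_ω n _ (hZ x (hx.le.trans hs)).1).comp_const_add (cn n) x).const_mul
        (D (v n))).sub (hasDerivAt_profMass two_pos x)
    have hdexp : ∀ x : ℝ, HasDerivAt (fun x : ℝ => ε * Real.exp (2 * x)) (ε * (2 * Real.exp (2 * x))) x := by
      intro x
      refine (((hasDerivAt_id x).const_mul 2).exp.const_mul ε).congr_deriv ?_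
      simp only [id]; ring
    have hcexp : Continuous fun x : ℝ => ε * Real.exp (2 * x) := by fun_prop
    have hcW : ContinuousOn (fun x => D (v n) * ω n (cn n + x) - profMass 2 x) (Iic s) := by
      refine (continuousOn_const.mul ((F.cont_ω n).comp (by fun_prop) ?_)).sub
        (continuous_profMass two_pos).continuousOn
      intro x hx
      exact (hZ x (le_trans hx hs)).1.le
    have hlim : Tendsto (fun x => D (v n) * ω n (cn n + x) - profMass 2 x) atBot (𝓝 0) := by
      have b1 := ((F.ω_tendsto n).comp (tendsto_atBot_add_const_left _ (cn n) tendsto_id)).const_mul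
        (D (v n))
      have b2 := profMass_tendsto_atBot two_pos
      have b3 := b1.sub b2
      rw [show D (v n) * 0 - (2 - 2) = (0 : ℝ) by ring] at b3
      exact b3
    have hlime : Tendsto (fun x : ℝ => ε * Real.exp (2 * x)) atBot (𝓝 0) := by
      simpa using (tendsto_exp_mul_atBot two_pos).const_mul ε
    have g1 := le_of_hasDerivAt_nonneg_atBot (f := fun x => ε * Real.exp (2 * x) -
      (D (v n) * ω n (cn n + x) - profMass 2 x)) (hcexp.continuousOn.sub hcW)
      (fun x hx => (hdexp x).fun_sub (hder x hx))
      (fun x hx => by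
        have b1 := (abs_le.1 (hA x (hx.le.trans hs))).2
        have : 0 ≤ ε * Real.exp (2 * x) := by positivity
        linarith) (by simpa using hlime.sub hlim)
    have g2 := le_of_hasDerivAt_nonneg_atBot (f := fun x => ε * Real.exp (2 * x) +
      (D (v n) * ω n (cn n + x) - profMass 2 x)) (hcexp.continuousOn.add hcW)
      (fun x hx => (hdexp x).fun_add (hder x hx))
      (fun x hx => by
        have b1 := (abs_le.1 (hA x (hx.le.trans hs))).1
        have : 0 ≤ ε * Real.exp (2 * x) := by positivity
        linarith) (by simpa using hlime.add hlim)
    rw [abs_le]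
    constructor <;> linarith
  intro s hs
  obtain ⟨a1, a2, a3⟩ := hZ s hs
  refine ⟨a1, a2, a3.trans ?_, hW s hs, hA s hs⟩
  refine le_trans ?_ hηε
  refine mul_le_mul_of_nonneg_right ?_ hη0.le
  have := Real.one_le_exp hbd0
  nlinarith

end Family

/-- The first integral with value a^2/2. It shows that the density vanishes as the mass tends to 2 +
a. -/
theorem exp_prof_eq_energy {a : ℝ} (ha : 0 < a) (s : ℝ) :
    Real.exp (2 * s + prof a s) = (a ^ 2 - (2 - profMass a s) ^ 2) / 2 := by
  have := (one_add_profB_pos ha s).ne'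
  rw [exp_prof ha, profMass]
  field_simp
  ring

theorem exp_prof_tendsto_atTop {a : ℝ} (ha : 0 < a) :
    Tendsto (fun s => Real.exp (2 * s + prof a s)) atTop (𝓝 0) := by
  have := ((((profMass_tendsto_atTop ha).const_sub 2).pow 2).const_sub (a ^ 2)).div_const 2
  rw [show (a ^ 2 - (2 - (2 + a)) ^ 2) / 2 = 0 by ring] at this
  exact this.congr fun s => (exp_prof_eq_energy ha s).symm

/-! ### The recurrence formulas in terms of `drop` -/

/-- The recurrence formulas, for all `q` in terms of `η_k`. -/
theorem recurrence_eta {q : ℝ} (h1 : 1 ≤ q) (h2 : q < 2) :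
    aSeq q 1 = 2 ∧ etaSeq q 1 = 1 ∧ ∀ k : ℕ, 1 ≤ k →
      0 < aSeq q k ∧ aSeq q k ≤ 2 ∧ 0 < etaSeq q k ∧
      1 - drop q (etaSeq q k) * (1 - 1 / q) = deltaSeq q k ∧
      ∃ y, 0 < y ∧ y < 1 ∧ etaSeq q (k + 1) = etaSeq q k * y ∧
        2 / (2 + aSeq q k) * drop q y - 1 + y = 0 ∧
        2 - aSeq q (k + 1) = y ^ (1 / q) * (2 + aSeq q k) := by
  rcases eq_or_lt_of_le h1 with rfl | hq
  · obtain ⟨b1, b2, b3⟩ := recurrence_one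
    refine ⟨b1, b2, fun k hk => ?_⟩
    obtain ⟨c1, c2, c3, c4, c5, c6⟩ := b3 k hk
    have hpos : 0 < etaSeq 1 k := c3.trans c4
    refine ⟨c1, c2, hpos, by simp [deltaSeq], etaSeq 1 (k + 1) / etaSeq 1 k, div_pos c3 hpos,
      (div_lt_one hpos).2 c4, by field_simp, ?_, ?_⟩
    · simp only [drop, if_true]
      rw [← Real.log_inv, inv_div]
      exact c5
    · rw [div_one, Real.rpow_one]; linarith
  · obtain ⟨b1, b2, b3⟩ := recurrence_pow hq h2
    have hq1 : q ≠ 1 := hq.ne'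
    have hq0 : 0 < q := by linarith
    have hqm : q - 1 ≠ 0 := by linarith
    have heta : ∀ k, etaSeq q k = deltaSeq q k ^ conjP q := fun k => by simp [etaSeq, hq1]
    have hp : 0 < conjP q := div_pos hq0 (by linarith)
    have hpi : 1 - 1 / q = 1 / conjP q := by unfold conjP; field_simp
    have hpq : conjP q * (1 / q) = conjP q - 1 := by unfold conjP; field_simp; ring
    -- With y = x^p and 1 - 1/q = 1/p, the function `drop` becomes p(1 - x). This unifies the two
    -- forms of the recurrence.
    have hdrop : ∀ x, 0 < x → drop q (x ^ conjP q) = conjP q * (1 - x) := fun x hx => by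
      simp only [drop, hq1, if_false]
      rw [hpi, ← Real.rpow_mul hx.le, mul_one_div_cancel hp.ne', Real.rpow_one]
      field_simp
    refine ⟨b1, by rw [heta, b2, Real.one_rpow], fun k hk => ?_⟩
    obtain ⟨c1, c2, c3, c4, c5, c6⟩ := b3 k hk
    have hpos : 0 < deltaSeq q k := c3.trans c4
    have hx : 0 < deltaSeq q (k + 1) / deltaSeq q k := div_pos c3 hpos
    have hx1 : deltaSeq q (k + 1) / deltaSeq q k < 1 := (div_lt_one hpos).2 c4
    refine ⟨c1, c2, by rw [heta]; exact Real.rpow_pos_of_pos hpos _, ?_,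
      (deltaSeq q (k + 1) / deltaSeq q k) ^ conjP q, Real.rpow_pos_of_pos hx _,
      Real.rpow_lt_one hx.le hx1 hp, ?_, ?_, ?_⟩
    · rw [heta, hdrop _ hpos, hpi]
      field_simp
      ring
    · rw [heta, heta, ← Real.mul_rpow hpos.le hx.le]
      congr 1; field_simp
    · rw [hdrop _ hx]
      rw [← c5]; ring
    · rw [← Real.rpow_mul hx.le, hpq, c6]; ring

/-! ### Leaving a bubble, and the induction over the bubbles. -/

namespace Family

variable {f N D D2 κ : ℝ → ℝ} {T q c C : ℝ} {Λ mu : ℕ → ℝ} {U ω : ℕ → ℝ → ℝ}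

/-- The logarithm of the scale of a bubble centred at `σ`. -/
noncomputable def logScale (f D κ : ℝ → ℝ) (Λ : ℕ → ℝ) (U : ℕ → ℝ → ℝ) (σ : ℕ → ℝ) (n : ℕ) : ℝ :=
  -(Real.log (κ (σ n) * (D (U n (σ n)) * (Λ n * f (U n (σ n)))))) / 2

theorem logScale_spec (F : Family f κ Λ mu U ω c C) (G : Growth f N D D2 T q)
    {x a : ℝ} {σ : ℕ → ℝ} (S : Center f N D Λ mu U ω x a σ) :
    ∀ᶠ n in atTop, κ (σ n) * (D (U n (σ n)) * (Λ n * f (U n (σ n)))) *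
      Real.exp (2 * logScale f D κ Λ U σ n) = 1 := by
  filter_upwards [S.neg, S.top.eventually_ge_atTop T] with n h1 h2
  have h3 : 0 < κ (σ n) * (D (U n (σ n)) * (Λ n * f (U n (σ n)))) :=
    mul_pos (F.κ_pos h1.le) (mul_pos (G.D_pos _ h2) (mul_pos (F.Λ_pos n) (G.f_pos h2)))
  unfold logScale
  rw [show ∀ z : ℝ, 2 * (-z / 2) = -z by intro z; ring, Real.exp_neg, Real.exp_log h3,
    mul_inv_cancel₀ h3.ne']

theorem logScale_tendsto (F : Family f κ Λ mu U ω c C) (G : Growth f N D D2 T q)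
    {x a : ℝ} {σ : ℕ → ℝ} (S : Center f N D Λ mu U ω x a σ) (ha : 0 < a) :
    Tendsto (logScale f D κ Λ U σ) atTop atBot := by
  have := (F.center_tendsto_atBot G S).atBot_add
    (F.scale_sub_tendsto G S ha (F.logScale_spec G S)).neg
  exact this.congr fun n => by ring

/-- `N` and `D` are constant to leading order at points where the rescaled solution is `o(N)`. -/
theorem slow_of_rescaled (G : Growth f N D D2 T q)
    {x a : ℝ} {σ : ℕ → ℝ} (S : Center f N D Λ mu U ω x a σ) {w e : ℕ → ℝ}
    (hw : ∀ᶠ n in atTop, |D (U n (σ n)) * (w n - U n (σ n))| ≤ e n)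
    (he : Tendsto (fun n => e n / N (U n (σ n))) atTop (𝓝 0)) :
    Tendsto w atTop atTop ∧ Tendsto (fun n => N (w n) / N (U n (σ n))) atTop (𝓝 1) ∧
      Tendsto (fun n => D (w n) / D (U n (σ n))) atTop (𝓝 1) := by
  refine G.slow S.top (squeeze_zero' ?_ ?_ he)
  · filter_upwards [S.top.eventually_ge_atTop T] with n h2
    exact div_nonneg (mul_nonneg (G.D_pos _ h2).le (abs_nonneg _)) (G.N_pos _ h2).le
  · filter_upwards [S.top.eventually_ge_atTop T, hw] with n h2 h3
    refine div_le_div_of_nonneg_right ?_ (G.N_pos _ h2).le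
    rwa [abs_mul, abs_of_pos (G.D_pos _ h2)] at h3

theorem height_of_ratio (G : Growth f N D D2 T q)
    {v w : ℕ → ℝ} {x : ℝ} (hv : ∀ᶠ n in atTop, T ≤ v n)
    (h1 : Tendsto (fun n => N (w n) / N (v n)) atTop (𝓝 1))
    (h2 : Tendsto (fun n => N (v n) / N (mu n)) atTop (𝓝 x)) :
    Tendsto (fun n => N (w n) / N (mu n)) atTop (𝓝 x) := by
  have := h1.mul h2
  rw [one_mul] at this
  refine this.congr' ?_
  filter_upwards [hv] with n hn
  have := (G.N_pos _ hn).ne'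
  field_simp

/-- After a bubble there are quiet points. -/
theorem exists_quiet_exit (F : Family f κ Λ mu U ω c C) (G : Growth f N D D2 T q)
    {x a : ℝ} {σ : ℕ → ℝ} (S : Center f N D Λ mu U ω x a σ) (hx : 0 < x) (ha : 0 < a) :
    ∃ τ, Quiet f N D Λ mu U ω x (2 + a) τ := by
  set cn := logScale f D κ Λ U σ with hcn
  have hc := F.logScale_spec G S
  have hcbot := F.logScale_tendsto G S ha
  set v : ℕ → ℝ := fun n => U n (σ n) with hv
  have hvT : ∀ᶠ n in atTop, T ≤ v n := S.top.eventually_ge_atTop T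
  have hNmu := F.N_mu_tendsto G
  -- At a fixed distance m beyond the scale the density tends to a positive constant, so its
  -- logarithm is o(N(μ)). Letting m grow slowly then sends the density to 0 and the mass to 2 + a.
  have key : ∀ m : ℕ, (∀ᶠ n in atTop, cn n + m < 0 ∧ T ≤ U n (cn n + m)) ∧
      Tendsto (fun n => (N (U n (cn n + m)) / N (mu n), D (U n (cn n + m)) * ω n (cn n + m),
        D (U n (cn n + m)) * dens f (Λ n) (U n) (cn n + m),
        Real.log (D (U n (cn n + m)) * dens f (Λ n) (U n) (cn n + m)) / N (mu n))) atTop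
        (𝓝 (x, profMass a m, Real.exp (2 * m + prof a m), 0)) := by
    intro m
    have hm : (m : ℝ) ∈ Icc (-(m : ℝ)) m := ⟨by linarith [Nat.cast_nonneg (α := ℝ) m], le_rfl⟩
    have hpr := fun {ε : ℝ} (hε : 0 < ε) => F.profile_tendsto G S ha hc m hε
    have hmass : Tendsto (fun n => D (v n) * ω n (cn n + m)) atTop (𝓝 (profMass a m)) := by
      rw [Metric.tendsto_nhds]
      intro ε hε
      filter_upwards [hpr (half_pos hε)] with n hn
      rw [Real.dist_eq]
      linarith [(hn m hm).2.2.2.1]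
    have hdens : Tendsto (fun n => D (v n) * (κ (cn n + m) * dens f (Λ n) (U n) (cn n + m))) atTop
        (𝓝 (Real.exp (2 * m + prof a m))) := by
      rw [Metric.tendsto_nhds]
      intro ε hε
      filter_upwards [hpr (half_pos hε)] with n hn
      rw [Real.dist_eq]
      linarith [(hn m hm).2.2.2.2]
    have hslow := slow_of_rescaled G S (w := fun n => U n (cn n + m)) (e := fun _ => |prof a m| + 1)
      (by
        filter_upwards [hpr one_pos] with n hn
        have := abs_sub_abs_le_abs_sub (D (U n (σ n)) * (U n (cn n + m) - U n (σ n))) (prof a m)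
        linarith [(hn m hm).2.2.1])
      (tendsto_const_nhds.div_atTop (G.N_tendsto.comp S.top))
    have hev := (hpr one_pos).mono fun n hn => (⟨(hn m hm).1, (hn m hm).2.1⟩ : cn n + m < 0 ∧ T ≤ U n (cn n + m))
    have hK : Tendsto (fun n => D (U n (cn n + m)) * dens f (Λ n) (U n) (cn n + m)) atTop
        (𝓝 (Real.exp (2 * m + prof a m))) := by
      have h1 := (hslow.2.2.mul hdens).div
        (F.κ_tendsto.comp (hcbot.atBot_add (tendsto_const_nhds (x := (m : ℝ))))) one_ne_zero
      rw [one_mul, div_one] at h1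
      refine h1.congr' ?_
      filter_upwards [hvT, hev] with n h2 h3
      have h4 := (G.D_pos _ h2).ne'
      have h5 := (F.κ_pos h3.1.le).ne'
      simp only [Pi.div_apply, Function.comp]
      change D (U n (cn n + m)) / D (v n) * _ / κ (cn n + m) = _
      field_simp
    refine ⟨hev, Tendsto.prodMk_nhds ?_ (Tendsto.prodMk_nhds ?_ (Tendsto.prodMk_nhds hK ?_))⟩
    · exact height_of_ratio G hvT hslow.2.1 S.height
    · have := hslow.2.2.mul hmass
      rw [one_mul] at this
      refine this.congr' ?_
      filter_upwards [hvT] with n h2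
      have h4 := (G.D_pos _ h2).ne'
      change D (U n (cn n + m)) / D (v n) * (D (v n) * ω n (cn n + m)) = _
      field_simp
    · exact ((Real.continuousAt_log (Real.exp_pos _).ne').tendsto.comp hK).div_atTop hNmu
  have hcast : Tendsto (fun m : ℕ => (m : ℝ)) atTop atTop := tendsto_natCast_atTop_atTop
  obtain ⟨M, -, hM, hP⟩ := exists_slow_tendsto (fun m => (key m).2)
    ((tendsto_const_nhds (x := x)).prodMk_nhds
      (((profMass_tendsto_atTop ha).comp hcast).prodMk_nhds
        (((exp_prof_tendsto_atTop ha).comp hcast).prodMk_nhds (tendsto_const_nhds (x := (0 : ℝ))))))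
    (fun m => (key m).1)
  rw [nhds_prod_eq, nhds_prod_eq, nhds_prod_eq] at hM
  have e1 := hM.fst
  refine ⟨fun n => cn n + M n, hP.mono fun n hn => hn.1, ?_, e1, hM.snd.fst, hM.snd.snd.fst,
    hM.snd.snd.snd⟩
  refine G.tendsto_of_N_tendsto (hP.mono fun n hn => hn.2) ?_
  refine (Tendsto.pos_mul_atTop hx e1 hNmu).congr' ?_
  filter_upwards [F.mu_tendsto.eventually_ge_atTop T] with n hn
  have := (G.N_pos _ hn).ne'
  field_simp

/-- There are infinitely many bubbles. -/
theorem exists_centers (F : Family f κ Λ mu U ω c C) (G : Growth f N D D2 T q) (hq : q < 2)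
    (k : ℕ) (hk : 1 ≤ k) : ∃ σ, Center f N D Λ mu U ω (etaSeq q k) (aSeq q k) σ := by
  obtain ⟨r1, r2, r3⟩ := recurrence_eta G.one_le hq
  induction k, hk using Nat.le_induction with
  | base =>
    obtain ⟨τ, hτ⟩ := F.exists_quiet_one G
    rw [r1, r2]
    exact F.exists_center G (by rwa [sub_self]) one_pos two_pos le_rfl
  | succ k hk ih =>
    obtain ⟨σ, hσ⟩ := ih
    obtain ⟨c1, c2, c3, -, y, y0, y1, hη, hroot, ha⟩ := r3 k hk
    obtain ⟨d1, d2, d3, -⟩ := r3 (k + 1) (hk.trans (Nat.le_succ k))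
    obtain ⟨τ, hτ⟩ := F.exists_quiet_exit G hσ c3 c1
    obtain ⟨τ', hτ'⟩ := F.exists_quiet_next G hτ c3 (by linarith) y0 y1 hroot
    rw [← hη, ← ha] at hτ'
    exact F.exists_center G hτ' d3 d1 d2

end Family

/-! ### The nonlinearity and the solutions of the theorem -/

section nonlinearity

variable {h f : ℝ → ℝ} {t₀ q : ℝ}

theorem contDiffOn_g (hH0 : H0 h f t₀) : ContDiffOn ℝ 2 (g f) (Ici t₀) :=
  hH0.f_contDiff_two.log fun t ht => (hH0.f_pos t ht).ne'

theorem hasDerivAt_g (hH0 : H0 h f t₀) {t : ℝ} (ht : t₀ < t) :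
    HasDerivAt (g f) (dg f t₀ t) t :=
  (((contDiffOn_g hH0).differentiableOn two_ne_zero t ht.le).hasDerivWithinAt).hasDerivAt
    (Ici_mem_nhds ht)

theorem hasDerivAt_dg (hH0 : H0 h f t₀) {t : ℝ} (ht : t₀ < t) :
    HasDerivAt (dg f t₀) (ddg f t₀ t) t := by
  have h1 : ContDiffOn ℝ 1 (dg f t₀) (Ici t₀) :=
    (contDiffOn_g hH0).derivWithin (uniqueDiffOn_Ici t₀) (by norm_num)
  exact ((h1.differentiableOn one_ne_zero t ht.le).hasDerivWithinAt).hasDerivAt (Ici_mem_nhds ht)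

theorem df_eq (hH0 : H0 h f t₀) {t : ℝ} (ht : t₀ < t) : df f t = f t * dg f t₀ t := by
  have hft := hH0.f_pos t ht.le
  have h1 : HasDerivAt (fun x => Real.exp (g f x)) (Real.exp (g f t) * dg f t₀ t) t :=
    (hasDerivAt_g hH0 ht).exp
  have h2 : HasDerivAt f (f t * dg f t₀ t) t := by
    have e : Real.exp (g f t) = f t := Real.exp_log hft
    rw [e] at h1
    refine h1.congr_of_eventuallyEq ?_
    filter_upwards [Ioi_mem_nhds ht] with x hx
    exact (Real.exp_log (hH0.f_pos x (le_of_lt hx))).symm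
  unfold df
  exact h2.hasDerivWithinAt.derivWithin (uniqueDiffOn_Ici 0 t (hH0.t₀_nonneg.trans ht.le))

/-- The threshold T must also make f(v), for v ≥ T, dominate all earlier values of f, although f
need not be monotone on [0, t₀]. The tangent of the convex function g gives g → ∞. -/
theorem exists_growth (hH0 : H0 h f t₀) (hH1 : H1 f t₀ q) :
    ∃ T, t₀ < T ∧ Growth f (g f) (dg f t₀) (ddg f t₀) T q := by
  set t1 := t₀ + 1 with ht1
  have ht01 : t₀ < t1 := by linarith
  have hmono : ∀ s t, t1 ≤ s → s ≤ t → dg f t₀ s ≤ dg f t₀ t := fun s t hs hst =>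
    le_of_hasDerivAt_nonneg hst
      (fun x hx => (hasDerivAt_dg hH0 (ht01.trans_le (hs.trans hx.1))).continuousAt.continuousWithinAt)
      (fun x hx => hasDerivAt_dg hH0 (ht01.trans_le (hs.trans hx.1.le)))
      (fun x hx => (hH1.ddg_pos x (ht01.le.trans (hs.trans hx.1.le))).le)
  have hg_mono : ∀ s t, t1 ≤ s → s ≤ t → g f s ≤ g f t := fun s t hs hst =>
    le_of_hasDerivAt_nonneg hst
      (fun x hx => (hasDerivAt_g hH0 (ht01.trans_le (hs.trans hx.1))).continuousAt.continuousWithinAt)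
      (fun x hx => hasDerivAt_g hH0 (ht01.trans_le (hs.trans hx.1.le)))
      (fun x hx => (hH1.dg_pos x (ht01.le.trans (hs.trans hx.1.le))).le)
  have hd1 := hH1.dg_pos t1 ht01.le
  have hgtop : Tendsto (g f) atTop atTop := by
    have h1 : Tendsto (fun t => dg f t₀ t1 * (t - t1) + g f t1) atTop atTop :=
      tendsto_atTop_add_const_right _ _ ((tendsto_atTop_add_const_right _ (-t1)
        tendsto_id).const_mul_atTop hd1)
    refine tendsto_atTop_mono' _ ?_ h1
    filter_upwards [eventually_ge_atTop t1] with t ht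
    have := le_of_hasDerivAt_nonneg (f := fun x => g f x - dg f t₀ t1 * x)
      (f' := fun x => dg f t₀ x - dg f t₀ t1 * 1) ht
      (fun x hx => ((hasDerivAt_g hH0 (ht01.trans_le hx.1)).fun_sub
        ((hasDerivAt_id x).const_mul _)).continuousAt.continuousWithinAt)
      (fun x hx => (hasDerivAt_g hH0 (ht01.trans_le hx.1.le)).fun_sub
        ((hasDerivAt_id x).const_mul _))
      (fun x hx => by linarith [hmono t1 x le_rfl hx.1.le])
    linarith
  have hratio : Tendsto (fun t => g f t * ddg f t₀ t / dg f t₀ t ^ 2) atTop (𝓝 (1 / q)) := by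
    have := hH1.tendsto_Q.inv₀ (by linarith [hH1.one_le_q])
    rw [← one_div] at this
    exact this.congr fun t => by rw [inv_div]
  have h1q : 1 / q < 2 := by
    rw [div_lt_iff₀ (by linarith [hH1.one_le_q])]; linarith [hH1.one_le_q]
  -- On the compact initial interval f is merely bounded; beyond T it exceeds that bound.
  obtain ⟨B, hB⟩ := (isCompact_Icc (a := (0 : ℝ)) (b := t1)).exists_bound_of_continuousOn
    (hH0.f_contDiff.continuousOn.mono Icc_subset_Ici_self)
  obtain ⟨T, hT⟩ := eventually_atTop.1 (((hratio.eventually (gt_mem_nhds h1q)).and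
    (hgtop.eventually_gt_atTop 0)).and
    ((hgtop.eventually_ge_atTop (Real.log (|B| + 1))).and (eventually_ge_atTop t1)))
  have hTt1 : t1 ≤ T := (hT T le_rfl).2.2
  have hT0 : t₀ < T := ht01.trans_le hTt1
  have hexp : ∀ t, t₀ ≤ t → f t = Real.exp (g f t) := fun t ht =>
    (Real.exp_log (hH0.f_pos t ht)).symm
  refine ⟨T, hT0, hH1.one_le_q, hH0.t₀_nonneg.trans_lt hT0,
    fun t ht => hasDerivAt_g hH0 (hT0.trans_le ht), fun t ht => hasDerivAt_dg hH0 (hT0.trans_le ht),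
    fun t ht => (hT t ht).1.2, fun t ht => hH1.dg_pos t (hT0.le.trans ht),
    fun t ht => hH1.ddg_pos t (hT0.le.trans ht), fun t ht => hexp t (hT0.le.trans ht),
    fun t ht => (hT t ht).1.1.le, hratio, hgtop, hH0.f_nonneg, ?_⟩
  intro t v ht htv hv
  rcases le_total t t1 with h | h
  · have h1 := hB t ⟨ht, h⟩
    rw [Real.norm_eq_abs] at h1
    have h2 := Real.exp_le_exp.2 (hT v hv).2.1
    rw [Real.exp_log (by positivity), ← hexp v (hT0.le.trans hv)] at h2
    linarith [le_abs_self (f t), le_abs_self B]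
  · rw [hexp t (ht01.le.trans h), hexp v (hT0.le.trans hv)]
    exact Real.exp_le_exp.2 (hg_mono t v h htv)

end nonlinearity

section solution

variable {h f u : ℝ → ℝ} {lam mu : ℝ}

/-- The derivative of a solution. -/
noncomputable def du (u : ℝ → ℝ) : ℝ → ℝ := derivWithin u (Icc 0 1)

theorem IsSolution.continuousOn_du (S : IsSolution h f lam mu u) :
    ContinuousOn (du u) (Icc 0 1) :=
  (S.contDiff.continuousOn_derivWithin (uniqueDiffOn_Icc one_pos) (by norm_num))

theorem IsSolution.hasDerivWithinAt (S : IsSolution h f lam mu u) {r : ℝ}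
    (hr : r ∈ Icc (0 : ℝ) 1) : HasDerivWithinAt u (du u r) (Icc 0 1) r :=
  (S.contDiff.differentiableOn two_ne_zero r hr).hasDerivWithinAt

/-- The second derivative of a solution. -/
noncomputable def ddu (u : ℝ → ℝ) : ℝ → ℝ := derivWithin (du u) (Icc 0 1)

theorem IsSolution.contDiffOn_du (S : IsSolution h f lam mu u) :
    ContDiffOn ℝ 1 (du u) (Icc 0 1) :=
  S.contDiff.derivWithin (uniqueDiffOn_Icc one_pos) (by norm_num)

theorem IsSolution.hasDerivWithinAt_du (S : IsSolution h f lam mu u) {r : ℝ}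
    (hr : r ∈ Icc (0 : ℝ) 1) : HasDerivWithinAt (du u) (ddu u r) (Icc 0 1) r :=
  (S.contDiffOn_du.differentiableOn one_ne_zero r hr).hasDerivWithinAt

theorem IsSolution.continuousOn_ddu (S : IsSolution h f lam mu u) :
    ContinuousOn (ddu u) (Icc 0 1) :=
  S.contDiffOn_du.continuousOn_derivWithin (uniqueDiffOn_Icc one_pos) (by norm_num)

theorem IsSolution.eqn' (S : IsSolution h f lam mu u) {r : ℝ} (hr : r ∈ Ioo (0 : ℝ) 1) :
    -ddu u r - 1 / r * du u r = lam * h r * f (u r) := by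
  have h1 := S.eqn r hr
  have h2 : iteratedDerivWithin 2 u (Icc 0 1) r = ddu u r := by
    rw [iteratedDerivWithin_succ]
    refine derivWithin_congr (fun x _ => ?_) ?_ <;> rw [iteratedDerivWithin_one] <;> rfl
  rw [h2] at h1
  exact h1

theorem exp_mem_Ioo {τ : ℝ} (hτ : τ < 0) : Real.exp τ ∈ Ioo (0 : ℝ) 1 :=
  ⟨Real.exp_pos _, by rw [← Real.exp_zero]; exact Real.exp_lt_exp.2 hτ⟩

theorem exp_mem_Icc {τ : ℝ} (hτ : τ ≤ 0) : Real.exp τ ∈ Icc (0 : ℝ) 1 :=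
  ⟨(Real.exp_pos _).le, Real.exp_le_one_iff.2 hτ⟩

theorem tendsto_exp_atBot_Icc : Tendsto Real.exp atBot (𝓝[Icc 0 1] 0) :=
  tendsto_nhdsWithin_iff.2 ⟨Real.tendsto_exp_atBot, by
    filter_upwards [eventually_le_atBot 0] with τ hτ using exp_mem_Icc hτ⟩

/-- The solution in logarithmic coordinates. -/
noncomputable def logU (u : ℝ → ℝ) (τ : ℝ) : ℝ := u (Real.exp τ)

/-- `-r u'(r)` in logarithmic coordinates. -/
noncomputable def logW (u : ℝ → ℝ) (τ : ℝ) : ℝ := -(Real.exp τ * du u (Real.exp τ))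

end solution

/-- The substitution r = e^τ turns r(r u')' into U''. Continuity of h at 0 gives κ → 1, and its
extrema on [0,1] give c and C. -/
theorem family_of_solutions {h f : ℝ → ℝ} {t₀ : ℝ} (hH0 : H0 h f t₀) {lam mu : ℕ → ℝ}
    {u : ℕ → ℝ → ℝ} (hsol : ∀ n, IsSolution h f (lam n) (mu n) (u n))
    (hmu : Tendsto mu atTop atTop) :
    ∃ c C, Family f (fun τ => h (Real.exp τ) / h 0) (fun n => lam n * h 0) mu
      (fun n => logU (u n)) (fun n => logW (u n)) c C := by
  have h00 : 0 < h 0 := hH0.h_pos 0 ⟨le_rfl, zero_le_one⟩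
  have hcont := hH0.h_contDiff.continuousOn
  obtain ⟨a, ha, hmin⟩ := isCompact_Icc.exists_isMinOn (nonempty_Icc.2 zero_le_one) hcont
  obtain ⟨b, hb, hmax⟩ := isCompact_Icc.exists_isMaxOn (nonempty_Icc.2 zero_le_one) hcont
  have hmaps : MapsTo Real.exp (Iic 0) (Icc 0 1) := fun τ hτ => exp_mem_Icc hτ
  refine ⟨h a / h 0, h b / h 0, fun n => mul_pos (hsol n).lam_pos h00, hmu,
    div_pos (hH0.h_pos a ha) h00, fun τ hτ => div_le_div_of_nonneg_right (hmin (exp_mem_Icc hτ)) h00.le,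
    fun τ hτ => div_le_div_of_nonneg_right (hmax (exp_mem_Icc hτ)) h00.le, ?_, ?_, ?_, ?_, ?_, ?_, ?_,
    ?_, ?_⟩
  · have := ((hcont 0 ⟨le_rfl, zero_le_one⟩).tendsto.comp tendsto_exp_atBot_Icc).div_const (h 0)
    rwa [div_self h00.ne'] at this
  · intro n τ hτ
    have h1 := ((hsol n).hasDerivWithinAt (exp_mem_Icc hτ.le)).hasDerivAt
      (Icc_mem_nhds (exp_mem_Ioo hτ).1 (exp_mem_Ioo hτ).2)
    refine (h1.comp τ (Real.hasDerivAt_exp τ)).congr_deriv ?_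
    simp only [logW]; ring
  · intro n τ hτ
    have hr := exp_mem_Ioo hτ
    have h1 := ((hsol n).hasDerivWithinAt_du (exp_mem_Icc hτ.le)).hasDerivAt
      (Icc_mem_nhds hr.1 hr.2)
    have h2 := ((Real.hasDerivAt_exp τ).mul (h1.comp τ (Real.hasDerivAt_exp τ))).fun_neg
    refine h2.congr_deriv ?_
    have h3 := (hsol n).eqn' hr
    simp only [dens, logU, Function.comp]
    have h4 : Real.exp (2 * τ) = Real.exp τ * Real.exp τ := by rw [← Real.exp_add]; ring_nf
    have h5 : h (Real.exp τ) / h 0 * (lam n * h 0 * Real.exp (2 * τ) * f (u n (Real.exp τ)))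
        = Real.exp τ * Real.exp τ * (lam n * h (Real.exp τ) * f (u n (Real.exp τ))) := by
      rw [h4]; field_simp
    rw [h5, ← h3]
    have := hr.1.ne'
    field_simp
    ring
  · intro n
    exact (hsol n).contDiff.continuousOn.comp Real.continuous_exp.continuousOn hmaps
  · intro n
    exact (Real.continuous_exp.continuousOn.mul ((hsol n).continuousOn_du.comp
      Real.continuous_exp.continuousOn hmaps)).neg
  · intro n
    simp only [logU, Real.exp_zero]; exact (hsol n).apply_one
  · intro n τ hτ
    rcases eq_or_lt_of_le hτ with rfl | hlt
    · simp only [logU, Real.exp_zero]; exact (hsol n).apply_one.ge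
    · exact ((hsol n).pos _ (exp_mem_Ioo hlt)).le
  · intro n
    have := ((hsol n).contDiff.continuousOn 0 ⟨le_rfl, zero_le_one⟩).tendsto.comp
      tendsto_exp_atBot_Icc
    rw [(hsol n).apply_zero] at this
    exact this
  · intro n
    have h1 := ((hsol n).continuousOn_du 0 ⟨le_rfl, zero_le_one⟩).tendsto.comp
      tendsto_exp_atBot_Icc
    have h2 := (Real.tendsto_exp_atBot.mul h1).neg
    rw [zero_mul, neg_zero] at h2
    exact h2

/-! ### The limit profiles -/

theorem bubble_exp {q : ℝ} {k : ℕ} (ha : 0 < aSeq q k) (s : ℝ) :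
    bubble q k (Real.exp s) = prof (aSeq q k) s := by
  have h1 := one_add_profB_pos ha s
  have h2 := profB_pos ha
  have h3 : bSeq q k = profB (aSeq q k) := rfl
  unfold bubble prof
  rw [h3, ← Real.exp_mul, ← Real.exp_mul, mul_comm s (aSeq q k),
    Real.log_div (by positivity) (by positivity), Real.log_mul (by positivity) (by positivity),
    Real.log_mul (Real.exp_pos _).ne' (by positivity), Real.log_exp, Real.log_pow]
  push_cast
  ring

theorem bubble_eq {q : ℝ} {k : ℕ} (ha : 0 < aSeq q k) {s : ℝ} (hs : 0 < s) :
    bubble q k s = prof (aSeq q k) (Real.log s) := by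
  rw [← bubble_exp ha, Real.exp_log hs]

theorem hasDerivAt_bubble {q : ℝ} {k : ℕ} (ha : 0 < aSeq q k) {s : ℝ} (hs : 0 < s) :
    HasDerivAt (bubble q k) (-profMass (aSeq q k) (Real.log s) / s) s := by
  refine (((hasDerivAt_prof ha (Real.log s)).comp s (Real.hasDerivAt_log hs.ne')).congr_of_eventuallyEq
    ?_).congr_deriv (by rw [div_eq_mul_inv])
  filter_upwards [Ioi_mem_nhds hs] with x hx using bubble_eq ha hx

theorem hasDerivAt_deriv_bubble {q : ℝ} {k : ℕ} (ha : 0 < aSeq q k) {s : ℝ} (hs : 0 < s) :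
    HasDerivAt (fun s => -profMass (aSeq q k) (Real.log s) / s)
      ((profMass (aSeq q k) (Real.log s) - Real.exp (2 * Real.log s + prof (aSeq q k) (Real.log s)))
        / s ^ 2) s := by
  have h1 := ((hasDerivAt_profMass ha (Real.log s)).comp s (Real.hasDerivAt_log hs.ne')).fun_neg
  refine (h1.fun_div (hasDerivAt_id s) hs.ne').congr_deriv ?_
  simp only [id, Function.comp]
  field_simp
  ring

theorem bubble_liouville {q : ℝ} {k : ℕ} (ha : 0 < aSeq q k) {s : ℝ} (hs : 0 < s) :
    -(deriv (deriv (bubble q k)) s) - 1 / s * deriv (bubble q k) s = Real.exp (bubble q k s) := by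
  have h1 : deriv (bubble q k) =ᶠ[𝓝 s] fun s => -profMass (aSeq q k) (Real.log s) / s := by
    filter_upwards [Ioi_mem_nhds hs] with x hx using (hasDerivAt_bubble ha hx).deriv
  rw [h1.deriv_eq, (hasDerivAt_deriv_bubble ha hs).deriv, (hasDerivAt_bubble ha hs).deriv,
    bubble_eq ha hs, Real.exp_add, show 2 * Real.log s = Real.log s + Real.log s by ring,
    Real.exp_add, Real.exp_log hs]
  field_simp
  ring

theorem bubble_integral {q : ℝ} {k : ℕ} (ha : 0 < aSeq q k) :
    IntegrableOn (fun s => Real.exp (bubble q k s) * s) (Ioi 0) ∧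
      ∫ s in Ioi (0 : ℝ), Real.exp (bubble q k s) * s = 2 * aSeq q k := by
  set a := aSeq q k with hadef
  -- A primitive of the integrand: the profile mass as a function of s = e^τ, continuous up to s =
  -- 0. It increases from 2 - a to 2 + a.
  set F : ℝ → ℝ := fun s => 2 + a - 2 * a / (1 + profB a * s ^ a) with hF
  have hb := profB_pos ha
  have hden : ∀ s : ℝ, 0 ≤ s → 0 < 1 + profB a * s ^ a := fun s hs => by
    have := Real.rpow_nonneg hs a
    positivity
  have hFlog : ∀ s, 0 < s → F s = profMass a (Real.log s) := fun s hs => by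
    simp only [hF, profMass]
    rw [Real.rpow_def_of_pos hs, mul_comm (Real.log s)]
  have hder : ∀ s ∈ Ioi (0 : ℝ), HasDerivAt F (Real.exp (bubble q k s) * s) s := by
    intro s hs
    have hs : 0 < s := hs
    have h1 : HasDerivAt (fun x => profMass a (Real.log x)) (Real.exp (bubble q k s) * s) s := by
      refine ((hasDerivAt_profMass ha (Real.log s)).comp s (Real.hasDerivAt_log hs.ne')).congr_deriv ?_
      rw [bubble_eq ha hs, Real.exp_add, show 2 * Real.log s = Real.log s + Real.log s by ring,
        Real.exp_add, Real.exp_log hs]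
      field_simp
      rfl
    refine h1.congr_of_eventuallyEq ?_
    filter_upwards [Ioi_mem_nhds hs] with x hx using hFlog x hx
  have hcont : ContinuousWithinAt F (Ici 0) 0 := by
    have h1 : Continuous fun s : ℝ => s ^ a := Real.continuous_rpow_const ha.le
    refine (ContinuousAt.continuousWithinAt ?_)
    refine continuousAt_const.sub (continuousAt_const.div (by fun_prop) ?_)
    rw [Real.zero_rpow ha.ne']
    norm_num
  have hlim : Tendsto F atTop (𝓝 (2 + a)) := by
    have h1 : Tendsto (fun s : ℝ => 1 + profB a * s ^ a) atTop atTop :=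
      tendsto_atTop_add_const_left _ _ ((tendsto_rpow_atTop ha).const_mul_atTop hb)
    have h2 := (h1.const_div_atTop (2 * a)).const_sub (2 + a)
    rwa [sub_zero] at h2
  have hnn : ∀ s ∈ Ioi (0 : ℝ), 0 ≤ Real.exp (bubble q k s) * s := fun s hs =>
    mul_nonneg (Real.exp_pos _).le (le_of_lt hs)
  refine ⟨integrableOn_Ioi_deriv_of_nonneg hcont hder hnn hlim, ?_⟩
  rw [integral_Ioi_of_hasDerivAt_of_nonneg hcont hder hnn hlim]
  simp only [hF]
  rw [Real.zero_rpow ha.ne']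
  ring

/-! ### The `C²` norm -/

/-- Bounds are asked only on (A,B], and continuity extends them to A. For the first bubble A = 0,
where logarithmic coordinates are not available. -/
theorem c2Norm_le {A B ε : ℝ} {w w1 w2 : ℝ → ℝ} (hAB : A < B)
    (h1 : ∀ s ∈ Icc A B, HasDerivWithinAt w (w1 s) (Icc A B) s)
    (h2 : ∀ s ∈ Icc A B, HasDerivWithinAt w1 (w2 s) (Icc A B) s)
    (h3 : ContinuousOn w2 (Icc A B))
    (hb : ∀ s ∈ Ioc A B, |w s| ≤ ε ∧ |w1 s| ≤ ε ∧ |w2 s| ≤ ε) :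
    c2Norm A B w ≤ 3 * ENNReal.ofReal ε := by
  have hu := uniqueDiffOn_Icc hAB
  have hext : ∀ v : ℝ → ℝ, ContinuousOn v (Icc A B) → (∀ s ∈ Ioc A B, |v s| ≤ ε) →
      ∀ s ∈ Icc A B, |v s| ≤ ε := by
    intro v hv hvb s hs
    have hcl : closure (Ioc A B) = Icc A B := closure_Ioc hAB.ne
    have hva : ContinuousOn (fun x => |v x|) (closure (Ioc A B)) := by
      rw [hcl]; exact hv.abs
    rw [← hcl] at hs
    exact le_on_closure hvb hva continuousOn_const hs
  have e0 : ∀ s ∈ Icc A B, iteratedDerivWithin 0 w (Icc A B) s = w s := fun s _ => by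
    rw [iteratedDerivWithin_zero]
  have e1 : ∀ s ∈ Icc A B, iteratedDerivWithin 1 w (Icc A B) s = w1 s := fun s hs => by
    rw [iteratedDerivWithin_one]; exact (h1 s hs).derivWithin (hu s hs)
  have e2 : ∀ s ∈ Icc A B, iteratedDerivWithin 2 w (Icc A B) s = w2 s := fun s hs => by
    rw [iteratedDerivWithin_succ, derivWithin_congr e1 (e1 s hs)]
    exact (h2 s hs).derivWithin (hu s hs)
  have key : ∀ (i : ℕ) (v : ℝ → ℝ), (∀ s ∈ Icc A B, iteratedDerivWithin i w (Icc A B) s = v s) →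
      (∀ s ∈ Icc A B, |v s| ≤ ε) →
      ⨆ s ∈ Icc A B, ‖iteratedDerivWithin i w (Icc A B) s‖ₑ ≤ ENNReal.ofReal ε := by
    intro i v hiv hv
    refine iSup₂_le fun s hs => ?_
    rw [hiv s hs, Real.enorm_eq_ofReal_abs]
    exact ENNReal.ofReal_le_ofReal (hv s hs)
  have k0 := key 0 w e0 (hext w (fun s hs => (h1 s hs).continuousWithinAt) fun s hs => (hb s hs).1)
  have k1 := key 1 w1 e1
    (hext w1 (fun s hs => (h2 s hs).continuousWithinAt) fun s hs => (hb s hs).2.1)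
  have k2 := key 2 w2 e2 (hext w2 h3 fun s hs => (hb s hs).2.2)
  unfold c2Norm
  rw [Finset.sum_range_succ, Finset.sum_range_succ, Finset.sum_range_one]
  calc _ ≤ ENNReal.ofReal ε + ENNReal.ofReal ε + ENNReal.ofReal ε := by gcongr
    _ = 3 * ENNReal.ofReal ε := by ring

theorem contDiffAt_bubble {q : ℝ} {k : ℕ} (ha : 0 < aSeq q k) {s : ℝ} (hs : 0 < s) :
    ContDiffAt ℝ 2 (bubble q k) s := by
  have hb : 0 < bSeq q k := profB_pos ha
  have hr : ∀ p : ℝ, ContDiffAt ℝ 2 (fun x : ℝ => x ^ p) s := fun p =>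
    Real.contDiffAt_rpow_const (Or.inl hs.ne')
  have h1 := Real.rpow_pos_of_pos hs (2 - aSeq q k)
  have h2 := Real.rpow_pos_of_pos hs (aSeq q k)
  unfold bubble
  exact (contDiffAt_const.div ((hr _).mul ((contDiffAt_const.add
    (contDiffAt_const.mul (hr _))).pow 2)) (by positivity)).log
    (div_pos (by positivity) (by positivity)).ne'

/-- For a = 2 the singular factor r^{2-a} is 1 and r^a is a square. The profile is therefore smooth
across 0, as needed when the inner radius is 0. -/
theorem contDiff_bubble {q : ℝ} {k : ℕ} (ha : aSeq q k = 2) : ContDiff ℝ 2 (bubble q k) := by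
  have hb : 0 < bSeq q k := profB_pos (by rw [ha]; exact two_pos)
  have e : bubble q k = fun s => Real.log (8 * bSeq q k / (1 + bSeq q k * s ^ 2) ^ 2) := by
    funext s
    unfold bubble
    rw [ha, sub_self, Real.rpow_zero, one_mul, Real.rpow_two]
    norm_num
  rw [e]
  refine contDiff_iff_contDiffAt.2 fun s => ContDiffAt.log ?_ (by positivity)
  exact contDiffAt_const.div ((contDiffAt_const.add (contDiffAt_const.mul
    (contDiffAt_id.pow 2))).pow 2) (by change (1 + bSeq q k * s ^ 2) ^ 2 ≠ 0; positivity)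

/-! ### Windows around the bubbles -/

/-- The rescaled solution is `1/(m+1)`-close to the profile on `I`, in the weighted sense needed
for `C²` estimates, and the window `[c-m,c+m]` is far from `0` and at the height of the centre. -/
def WindowAt (f N D κ : ℝ → ℝ) (Λ : ℕ → ℝ) (U ω : ℕ → ℝ → ℝ) (T a : ℝ) (σ cn : ℕ → ℝ) (I : Set ℝ)
    (m n : ℕ) : Prop :=
  (∀ s ∈ I, cn n + s < 0 ∧ T ≤ U n (cn n + s) ∧
    |D (U n (σ n)) * (U n (cn n + s) - U n (σ n)) - prof a s| ≤ 1 / ((m : ℝ) + 1) ∧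
    |D (U n (σ n)) * ω n (cn n + s) - profMass a s| ≤ Real.exp (2 * s - 2 * m) / ((m : ℝ) + 1) ∧
    |D (U n (σ n)) * (κ (cn n + s) * dens f (Λ n) (U n) (cn n + s)) - Real.exp (2 * s + prof a s)|
      ≤ Real.exp (2 * s - 2 * m) / ((m : ℝ) + 1)) ∧
  cn n + m ≤ -m ∧ (|prof a m| + |prof a (-m)| + 2) * ((m : ℝ) + 1) ≤ N (U n (σ n))

namespace Family

variable {f κ N D D2 : ℝ → ℝ} {Λ mu : ℕ → ℝ} {U ω : ℕ → ℝ → ℝ} {c C T q : ℝ}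

theorem eventually_window_far (F : Family f κ Λ mu U ω c C) (G : Growth f N D D2 T q)
    {x a : ℝ} {σ : ℕ → ℝ} (S : Center f N D Λ mu U ω x a σ) (ha : 0 < a) (m : ℕ) :
    ∀ᶠ n in atTop, logScale f D κ Λ U σ n + m ≤ -m ∧
      (|prof a m| + |prof a (-m)| + 2) * ((m : ℝ) + 1) ≤ N (U n (σ n)) := by
  filter_upwards [(F.logScale_tendsto G S ha).eventually_le_atBot (-(2 * m : ℝ)),
    (G.N_tendsto.comp S.top).eventually_ge_atTop
      ((|prof a m| + |prof a (-m)| + 2) * ((m : ℝ) + 1))] with n h1 h2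
  exact ⟨by linarith, h2⟩

/-- For s ≥ -m one has e^{-4m} ≤ e^{2s-2m}, so a uniform estimate of size e^{-4m}/(m+1) yields the
weighted one. -/
theorem exists_window (F : Family f κ Λ mu U ω c C) (G : Growth f N D D2 T q)
    {x a : ℝ} {σ : ℕ → ℝ} (S : Center f N D Λ mu U ω x a σ) (ha : 0 < a) :
    ∃ M : ℕ → ℕ, Tendsto M atTop atTop ∧ ∀ᶠ n in atTop,
      WindowAt f N D κ Λ U ω T a σ (logScale f D κ Λ U σ) (Icc (-(M n : ℝ)) (M n)) (M n) n := by
  refine exists_slow_of_eventually (P := fun m n =>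
    WindowAt f N D κ Λ U ω T a σ (logScale f D κ Λ U σ) (Icc (-(m : ℝ)) m) m n) fun m => ?_
  have hε : 0 < Real.exp (-(4 * m : ℝ)) / ((m : ℝ) + 1) := by positivity
  filter_upwards [F.profile_tendsto G S ha (F.logScale_spec G S) m hε,
    F.eventually_window_far G S ha m] with n h1 h2
  refine ⟨fun s hs => ?_, h2⟩
  obtain ⟨b1, b2, b3, b4, b5⟩ := h1 s hs
  have e1 : Real.exp (-(4 * m : ℝ)) / ((m : ℝ) + 1) ≤ 1 / ((m : ℝ) + 1) :=
    div_le_div_of_nonneg_right (Real.exp_le_one_iff.2 (by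
      have : (0 : ℝ) ≤ m := Nat.cast_nonneg m
      linarith)) (by positivity)
  have e2 : Real.exp (-(4 * m : ℝ)) / ((m : ℝ) + 1) ≤ Real.exp (2 * s - 2 * m) / ((m : ℝ) + 1) :=
    div_le_div_of_nonneg_right (Real.exp_le_exp.2 (by linarith [hs.1])) (by positivity)
  exact ⟨b1, b2, b3.trans e1, b4.trans e2, b5.trans e2⟩

/-- Here the window is a half-line, and the weight e^{2s} is supplied by `origin_tendsto`. -/
theorem exists_window_origin (F : Family f κ Λ mu U ω c C) (G : Growth f N D D2 T q)
    {σ : ℕ → ℝ} (S : Center f N D Λ mu U ω 1 2 σ) :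
    ∃ M : ℕ → ℕ, Tendsto M atTop atTop ∧ ∀ᶠ n in atTop,
      WindowAt f N D κ Λ U ω T 2 σ (logScale f D κ Λ U σ) (Iic (M n : ℝ)) (M n) n := by
  refine exists_slow_of_eventually (P := fun m n =>
    WindowAt f N D κ Λ U ω T 2 σ (logScale f D κ Λ U σ) (Iic (m : ℝ)) m n) fun m => ?_
  have hε : 0 < Real.exp (-(2 * m : ℝ)) / ((m : ℝ) + 1) := by positivity
  filter_upwards [F.origin_tendsto G S (F.logScale_spec G S) m hε,
    F.eventually_window_far G S two_pos m] with n h1 h2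
  refine ⟨fun s hs => ?_, h2⟩
  obtain ⟨b1, b2, b3, b4, b5⟩ := h1 s hs
  have e1 : Real.exp (-(2 * m : ℝ)) / ((m : ℝ) + 1) ≤ 1 / ((m : ℝ) + 1) :=
    div_le_div_of_nonneg_right (Real.exp_le_one_iff.2 (by
      have : (0 : ℝ) ≤ m := Nat.cast_nonneg m
      linarith)) (by positivity)
  have e2 : Real.exp (-(2 * m : ℝ)) / ((m : ℝ) + 1) * Real.exp (2 * s)
      = Real.exp (2 * s - 2 * m) / ((m : ℝ) + 1) := by
    rw [sub_eq_add_neg, Real.exp_add]; ring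
  rw [e2] at b4 b5
  exact ⟨b1, b2, b3.trans e1, b4, b5⟩

end Family

/-! ### From logarithmic to rescaled radial variables. -/

section rescaled

variable {h f u : ℝ → ℝ} {lam mu : ℝ}

theorem IsSolution.continuousOn (S : IsSolution h f lam mu u) : ContinuousOn u (Icc 0 1) :=
  S.contDiff.continuousOn

/-- `-r u'(r)`. -/
noncomputable def flux (u : ℝ → ℝ) (r : ℝ) : ℝ := -(r * du u r)

theorem mul_dens_exp (h0 : h 0 ≠ 0) (τ : ℝ) :
    h (Real.exp τ) / h 0 * dens f (lam * h 0) (logU u) τ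
      = Real.exp τ ^ 2 * (lam * h (Real.exp τ) * f (u (Real.exp τ))) := by
  have h4 : Real.exp (2 * τ) = Real.exp τ ^ 2 := by rw [sq, ← Real.exp_add]; ring_nf
  simp only [dens, logU, h4]
  field_simp

theorem IsSolution.sq_mul_ddu (S : IsSolution h f lam mu u) (h0 : h 0 ≠ 0) {τ : ℝ} (hτ : τ < 0) :
    Real.exp τ ^ 2 * ddu u (Real.exp τ)
      = logW u τ - h (Real.exp τ) / h 0 * dens f (lam * h 0) (logU u) τ := by
  have hr := exp_mem_Ioo hτ
  rw [mul_dens_exp h0, ← S.eqn' hr, logW]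
  have := hr.1.ne'
  field_simp
  ring

/-- In the radial variable s, first derivatives are -mass/s and second derivatives are (mass -
density)/s^2, for the rescaled solution and for the profile alike. This explains the divisions by s
and s^2 in the hypotheses. -/
theorem c2Norm_rescale_le {t₀ q γ A B ε c v : ℝ} {k : ℕ} (S : IsSolution h f lam mu u)
    (h0 : h 0 ≠ 0) (ha : 0 < aSeq q k) (hγ : γ = Real.exp c) (hA : 0 ≤ A) (hAB : A < B)
    (hB : γ * B ≤ 1)
    (hz : ∀ s ∈ Icc A B, ContDiffAt ℝ 2 (bubble q k) s)
    (hb : ∀ s ∈ Ioc A B, c + Real.log s < 0 ∧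
      |dg f t₀ (u v) * (logU u (c + Real.log s) - u v) - prof (aSeq q k) (Real.log s)| ≤ ε ∧
      |dg f t₀ (u v) * logW u (c + Real.log s) - profMass (aSeq q k) (Real.log s)| / s ≤ ε ∧
      (|dg f t₀ (u v) * logW u (c + Real.log s) - profMass (aSeq q k) (Real.log s)| +
        |dg f t₀ (u v) * (h (Real.exp (c + Real.log s)) / h 0 *
          dens f (lam * h 0) (logU u) (c + Real.log s)) -
          Real.exp (2 * Real.log s + prof (aSeq q k) (Real.log s))|) / s ^ 2 ≤ ε) :
    c2Norm A B (fun s => rescale f t₀ u v γ s - bubble q k s) ≤ 3 * ENNReal.ofReal ε := by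
  have hγ0 : 0 < γ := hγ ▸ Real.exp_pos c
  have hmaps : MapsTo (fun s => γ * s) (Icc A B) (Icc 0 1) := fun s hs =>
    ⟨mul_nonneg hγ0.le (hA.trans hs.1), (mul_le_mul_of_nonneg_left hs.2 hγ0.le).trans hB⟩
  have hlin : ∀ s, HasDerivWithinAt (fun s => γ * s) γ (Icc A B) s := fun s =>
    (((hasDerivAt_id s).const_mul γ).congr_deriv (mul_one γ)).hasDerivWithinAt
  set d := dg f t₀ (u v) with hd
  have hz1 : ∀ s ∈ Icc A B, ContDiffAt ℝ 1 (deriv (bubble q k)) s := fun s hs =>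
    (hz s hs).derivWithin (by norm_num)
  refine c2Norm_le (w1 := fun s => d * (du u (γ * s) * γ) - deriv (bubble q k) s)
    (w2 := fun s => d * (ddu u (γ * s) * γ * γ) - deriv (deriv (bubble q k)) s) hAB ?_ ?_ ?_ ?_
  · intro s hs
    exact ((((S.hasDerivWithinAt (hmaps hs)).comp s (hlin s) hmaps).sub_const (u v)).const_mul
      d).fun_sub ((hz s hs).differentiableAt two_ne_zero).hasDerivAt.hasDerivWithinAt
  · intro s hs
    exact ((((S.hasDerivWithinAt_du (hmaps hs)).comp s (hlin s) hmaps).mul_const γ).const_mul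
      d).fun_sub ((hz1 s hs).differentiableAt one_ne_zero).hasDerivAt.hasDerivWithinAt
  · refine (continuousOn_const.mul (((S.continuousOn_ddu.comp (by fun_prop) hmaps).mul
      continuousOn_const).mul continuousOn_const)).sub fun s hs =>
      ((hz1 s hs).derivWithin (m := 0) (by norm_num)).continuousAt.continuousWithinAt
  · intro s hs
    have hs0 : 0 < s := hA.trans_lt hs.1
    obtain ⟨b0, b1, b2, b3⟩ := hb s hs
    have hexp : Real.exp (c + Real.log s) = γ * s := by
      rw [Real.exp_add, Real.exp_log hs0, hγ]
    have hder : deriv (bubble q k) =ᶠ[𝓝 s] fun s => -profMass (aSeq q k) (Real.log s) / s := by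
      filter_upwards [Ioi_mem_nhds hs0] with x hx using (hasDerivAt_bubble ha hx).deriv
    have hdd := S.sq_mul_ddu h0 b0
    rw [hexp] at hdd
    have hW : logW u (c + Real.log s) = -(γ * s * du u (γ * s)) := by rw [logW, hexp]
    refine ⟨?_, ?_, ?_⟩
    · rw [bubble_eq ha hs0, rescale]
      rwa [logU, hexp] at b1
    · rw [(hasDerivAt_bubble ha hs0).deriv, ← abs_neg]
      rw [hW, ← abs_of_pos hs0, ← abs_div, abs_of_pos hs0] at b2
      refine le_trans (le_of_eq ?_) b2
      congr 1
      field_simp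
      ring
    · rw [hder.deriv_eq, (hasDerivAt_deriv_bubble ha hs0).deriv]
      refine le_trans ?_ b3
      rw [hexp]
      set X := logW u (c + Real.log s)
      set Y := h (γ * s) / h 0 * dens f (lam * h 0) (logU u) (c + Real.log s)
      have e : ddu u (γ * s) * γ * γ = (X - Y) / s ^ 2 := by
        rw [← hdd]; field_simp
      rw [e, mul_div_assoc', ← sub_div, abs_div, abs_of_pos (show 0 < s ^ 2 by positivity)]
      refine div_le_div_of_nonneg_right (le_trans (le_of_eq ?_) (abs_sub _ _)) (by positivity)
      congr 1
      ring

end rescaled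

/-! ### Heights -/

namespace Growth

variable {f N D D2 : ℝ → ℝ} {T q : ℝ}

/-- Here 1 - w/μ is the product of D(μ)(μ - w)/N(μ) → `drop q y` and N(μ)/(μ D(μ)) → 1 - 1/q. For q
= 1 the limit carries no information, hence the finer `hasHeight`. -/
theorem height_ratio_tendsto (G : Growth f N D D2 T q) {mu w : ℕ → ℝ} {y : ℝ} (hy : 0 < y)
    (hmu : Tendsto mu atTop atTop) (hw : Tendsto w atTop atTop) (hwmu : ∀ᶠ n in atTop, w n ≤ mu n)
    (hN : Tendsto (fun n => N (w n) / N (mu n)) atTop (𝓝 y)) :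
    Tendsto (fun n => w n / mu n) atTop (𝓝 (1 - drop q y * (1 - 1 / q))) := by
  refine (((G.drop_tendsto hy hw hwmu hN).mul (G.psi_div_tendsto.comp hmu)).const_sub 1).congr' ?_
  filter_upwards [hmu.eventually_ge_atTop T] with n hn
  have h1 := (G.N_pos _ hn).ne'
  have h2 := (G.D_pos _ hn).ne'
  have h3 := (G.T_pos.trans_le hn).ne'
  simp only [Function.comp]
  field_simp
  ring

theorem hasHeight {t₀ : ℝ} (G : Growth f (g f) (dg f t₀) (ddg f t₀) T 1) {mu w : ℕ → ℝ} {y : ℝ}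
    (hy : 0 < y) (hmu : Tendsto mu atTop atTop) (hw : Tendsto w atTop atTop)
    (hwmu : ∀ᶠ n in atTop, w n ≤ mu n)
    (hN : Tendsto (fun n => g f (w n) / g f (mu n)) atTop (𝓝 y)) :
    HasHeight f t₀ mu (Real.log (1 / y)) w := by
  have h1 := (G.drop_tendsto hy hw hwmu hN).sub_const (Real.log (1 / y))
  have h2 : drop 1 y = Real.log (1 / y) := by rw [one_div, Real.log_inv]; simp [drop]
  rw [h2, sub_self] at h1
  refine ⟨_, h1, ?_⟩
  filter_upwards [hmu.eventually_ge_atTop T] with n hn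
  have h1 := (G.N_pos _ hn).ne'
  have h2 := (G.D_pos _ hn).ne'
  field_simp
  ring

end Growth

/-! ### Energies -/

section energy

variable {h f u : ℝ → ℝ} {lam mu t₀ q T : ℝ}

theorem IsSolution.nonneg (S : IsSolution h f lam mu u) {r : ℝ} (hr : r ∈ Icc (0 : ℝ) 1) :
    0 ≤ u r := by
  rcases eq_or_lt_of_le hr.1 with rfl | h0
  · rw [S.apply_zero]; exact S.mu_pos.le
  rcases eq_or_lt_of_le hr.2 with rfl | h1
  · exact S.apply_one.ge
  · exact (S.pos r ⟨h0, h1⟩).le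

theorem IsSolution.continuousOn_density (hH0 : H0 h f t₀) (S : IsSolution h f lam mu u)
    {φ : ℝ → ℝ} (hφ : ContinuousOn φ (Ici 0)) :
    ContinuousOn (fun s => lam * h s * φ (u s) * s) (Icc 0 1) :=
  ((continuousOn_const.mul hH0.h_contDiff.continuousOn).mul
    (hφ.comp S.continuousOn fun _ hs => S.nonneg hs)).mul continuousOn_id

theorem intervalIntegrable_of_continuousOn_Icc {φ : ℝ → ℝ} (hφ : ContinuousOn φ (Icc 0 1)) {x y : ℝ}
    (hx : x ∈ Icc (0 : ℝ) 1) (hy : y ∈ Icc (0 : ℝ) 1) : IntervalIntegrable φ volume x y :=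
  (hφ.mono (uIcc_subset_Icc hx hy)).intervalIntegrable

/-- The radial equation in divergence form: (-r u')' = λ h f(u) r. All local energies are thereby
differences of fluxes. -/
theorem IsSolution.integral_eq_flux_sub (hH0 : H0 h f t₀) (S : IsSolution h f lam mu u) {x y : ℝ}
    (hx : x ∈ Icc (0 : ℝ) 1) (hy : y ∈ Icc (0 : ℝ) 1) :
    ∫ s in x..y, lam * h s * f (u s) * s = flux u y - flux u x := by
  have key : ∀ x y : ℝ, x ∈ Icc (0 : ℝ) 1 → y ∈ Icc (0 : ℝ) 1 → x ≤ y →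
      ∫ s in x..y, lam * h s * f (u s) * s = flux u y - flux u x := by
    intro x y hx hy hxy
    refine intervalIntegral.integral_eq_sub_of_hasDerivAt_of_le hxy ?_ ?_
      (intervalIntegrable_of_continuousOn_Icc
        (S.continuousOn_density hH0 hH0.f_contDiff.continuousOn) hx hy)
    · exact ((continuousOn_id.mul S.continuousOn_du).neg).mono (Icc_subset_Icc hx.1 hy.2)
    · intro s hs
      have hs' : s ∈ Ioo (0 : ℝ) 1 := ⟨hx.1.trans_lt hs.1, hs.2.trans_le hy.2⟩
      have h1 := (S.hasDerivWithinAt_du (Ioo_subset_Icc_self hs')).hasDerivAt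
        (Icc_mem_nhds hs'.1 hs'.2)
      refine ((hasDerivAt_id s).fun_mul h1).fun_neg.congr_deriv ?_
      have := hs'.1.ne'
      rw [← S.eqn' hs']
      simp only [id]
      field_simp
      ring
  rcases le_total x y with hxy | hxy
  · exact key x y hx hy hxy
  · rw [intervalIntegral.integral_symm, key y x hy hx hxy, neg_sub]

theorem flux_zero (u : ℝ → ℝ) : flux u 0 = 0 := by simp [flux]

theorem IsSolution.flux_nonneg (hH0 : H0 h f t₀) (S : IsSolution h f lam mu u) {r : ℝ}
    (hr : r ∈ Icc (0 : ℝ) 1) : 0 ≤ flux u r := by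
  have h1 := S.integral_eq_flux_sub hH0 (x := 0) ⟨le_rfl, zero_le_one⟩ hr
  rw [flux_zero, sub_zero] at h1
  rw [← h1]
  refine intervalIntegral.integral_nonneg hr.1 fun s hs => ?_
  have hs' : s ∈ Icc (0 : ℝ) 1 := ⟨hs.1, hs.2.trans hr.2⟩
  exact mul_nonneg (mul_nonneg (mul_nonneg S.lam_pos.le (hH0.h_pos s hs').le)
    (hH0.f_nonneg _ (S.nonneg hs'))) hs.1

theorem IsSolution.antitoneOn (hH0 : H0 h f t₀) (S : IsSolution h f lam mu u) :
    AntitoneOn u (Icc 0 1) := by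
  have hd : ∀ s ∈ Ioo (0 : ℝ) 1, HasDerivAt u (du u s) s := fun s hs =>
    (S.hasDerivWithinAt (Ioo_subset_Icc_self hs)).hasDerivAt (Icc_mem_nhds hs.1 hs.2)
  refine antitoneOn_of_deriv_nonpos (convex_Icc 0 1) S.continuousOn ?_ ?_ <;> rw [interior_Icc]
  · exact fun s hs => (hd s hs).differentiableAt.differentiableWithinAt
  · intro s hs
    rw [(hd s hs).deriv]
    have := S.flux_nonneg hH0 (Ioo_subset_Icc_self hs)
    unfold flux at this
    nlinarith [hs.1]

/-- Since f' = f g', with g' increasing and u decreasing, g'(u) lies between its values at the two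
ends. Both energies have the same limit when g' is asymptotically constant. -/
theorem IsSolution.integral_df_mem (hH0 : H0 h f t₀) (S : IsSolution h f lam mu u)
    (G : Growth f (g f) (dg f t₀) (ddg f t₀) T q) (hT : t₀ < T) {x y : ℝ}
    (hx : x ∈ Icc (0 : ℝ) 1) (hy : y ∈ Icc (0 : ℝ) 1) (hxy : x ≤ y) (huy : T ≤ u y) :
    ∫ s in x..y, lam * h s * df f (u s) * s ∈ Icc
      (dg f t₀ (u y) * ∫ s in x..y, lam * h s * f (u s) * s)
      (dg f t₀ (u x) * ∫ s in x..y, lam * h s * f (u s) * s) := by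
  have hc1 := intervalIntegrable_of_continuousOn_Icc
    (S.continuousOn_density hH0 hH0.f_contDiff.continuousOn) hx hy
  have hdf : ContinuousOn (df f) (Ici 0) :=
    hH0.f_contDiff.continuousOn_derivWithin (uniqueDiffOn_Ici 0) le_rfl
  have hc2 := intervalIntegrable_of_continuousOn_Icc (S.continuousOn_density hH0 hdf) hx hy
  have key : ∀ s ∈ Icc x y, s ∈ Icc (0 : ℝ) 1 ∧ u y ≤ u s ∧ u s ≤ u x ∧
      lam * h s * df f (u s) * s = dg f t₀ (u s) * (lam * h s * f (u s) * s) ∧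
      0 ≤ lam * h s * f (u s) * s := by
    intro s hs
    have hs' : s ∈ Icc (0 : ℝ) 1 := ⟨hx.1.trans hs.1, hs.2.trans hy.2⟩
    have h1 := S.antitoneOn hH0 hs' hy hs.2
    refine ⟨hs', h1, S.antitoneOn hH0 hx hs' hs.1, ?_, ?_⟩
    · rw [df_eq hH0 (hT.trans_le (huy.trans h1))]; ring
    · exact mul_nonneg (mul_nonneg (mul_nonneg S.lam_pos.le (hH0.h_pos s hs').le)
        (hH0.f_nonneg _ (S.nonneg hs'))) hs'.1
  rw [← intervalIntegral.integral_const_mul, ← intervalIntegral.integral_const_mul]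
  constructor
  · refine intervalIntegral.integral_mono_on hxy (hc1.const_mul _) hc2 fun s hs => ?_
    obtain ⟨k1, k2, k3, k4, k5⟩ := key s hs
    rw [k4]
    exact mul_le_mul_of_nonneg_right (G.mono_D huy k2) k5
  · refine intervalIntegral.integral_mono_on hxy hc2 (hc1.const_mul _) fun s hs => ?_
    obtain ⟨k1, k2, k3, k4, k5⟩ := key s hs
    rw [k4]
    exact mul_le_mul_of_nonneg_right (G.mono_D (huy.trans k2) k3) k5

end energy

/-! ### Limits along the ends of the windows -/

namespace Family

variable {f κ N D D2 : ℝ → ℝ} {Λ mu : ℕ → ℝ} {U ω : ℕ → ℝ → ℝ} {c C T q x a : ℝ}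
  {σ cn p : ℕ → ℝ} {M : ℕ → ℕ} {I : ℕ → Set ℝ}

theorem tendsto_one_div_nat_add_one (hM : Tendsto M atTop atTop) :
    Tendsto (fun n => 1 / ((M n : ℝ) + 1)) atTop (𝓝 0) :=
  tendsto_one_div_add_atTop_nhds_zero_nat.comp hM

/-- The last clause of `WindowAt` makes the profile at the ends of the window o(N), although the
window grows. Hence N and D keep their leading order up to the radii. -/
theorem window_slow (G : Growth f N D D2 T q) (S : Center f N D Λ mu U ω x a σ)
    (hM : Tendsto M atTop atTop)
    (W : ∀ᶠ n in atTop, WindowAt f N D κ Λ U ω T a σ cn (I n) (M n) n)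
    (hp : ∀ᶠ n in atTop, p n ∈ I n ∧ |prof a (p n)| ≤ |prof a (M n)| + |prof a (-(M n : ℝ))|) :
    Tendsto (fun n => U n (cn n + p n)) atTop atTop ∧
      Tendsto (fun n => N (U n (cn n + p n)) / N (U n (σ n))) atTop (𝓝 1) ∧
      Tendsto (fun n => D (U n (cn n + p n)) / D (U n (σ n))) atTop (𝓝 1) := by
  refine slow_of_rescaled (e := fun n => |prof a (M n)| + |prof a (-(M n : ℝ))| + 2) G S ?_ ?_
  · filter_upwards [W, hp] with n ⟨hW, _, _⟩ ⟨h1, h2⟩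
    have h3 := (hW _ h1).2.2.1
    have h4 := abs_le.1 h3
    have h5 : 1 / ((M n : ℝ) + 1) ≤ 1 := by
      rw [div_le_one (by positivity)]; linarith [(M n).cast_nonneg (α := ℝ)]
    have h6 := abs_le.1 h2
    rw [abs_le]
    constructor <;> linarith
  · refine squeeze_zero' ?_ ?_ (tendsto_one_div_nat_add_one hM)
    · filter_upwards [S.top.eventually_ge_atTop T] with n hn
      exact div_nonneg (by positivity) (G.N_pos _ hn).le
    · filter_upwards [W, S.top.eventually_ge_atTop T] with n ⟨_, _, hW⟩ hn
      rw [div_le_div_iff₀ (G.N_pos _ hn) (by positivity)]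
      linarith

theorem window_mass (hM : Tendsto M atTop atTop)
    (W : ∀ᶠ n in atTop, WindowAt f N D κ Λ U ω T a σ cn (I n) (M n) n)
    (hp : ∀ᶠ n in atTop, p n ∈ I n ∧ p n ≤ M n) {l : ℝ}
    (hl : Tendsto (fun n => profMass a (p n)) atTop (𝓝 l)) :
    Tendsto (fun n => D (U n (σ n)) * ω n (cn n + p n)) atTop (𝓝 l) := by
  have h1 : Tendsto (fun n => D (U n (σ n)) * ω n (cn n + p n) - profMass a (p n)) atTop (𝓝 0) := by
    refine tendsto_of_abs_sub_le (e := fun n => 1 / ((M n : ℝ) + 1)) ?_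
      (tendsto_one_div_nat_add_one hM)
    filter_upwards [W, hp] with n ⟨hW, _, _⟩ ⟨h1, h2⟩
    rw [sub_zero]
    refine (hW _ h1).2.2.2.1.trans (div_le_div_of_nonneg_right (Real.exp_le_one_iff.2 ?_)
      (by positivity))
    linarith
  have h2 := h1.add hl
  rw [zero_add] at h2
  exact h2.congr fun n => by ring

end Family

/-! ### Assembling the statements about one bubble. -/

/-- Concentration of a sequence of solutions at the `k`-th bubble, with centres `r`, scales `γ` and
inner and outer radii `ρ'` and `ρ`. -/
structure Concentration (h f : ℝ → ℝ) (t₀ q : ℝ) (lam mu : ℕ → ℝ) (u : ℕ → ℝ → ℝ) (k : ℕ)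
    (r γ ρ' ρ : ℕ → ℝ) : Prop where
  center_mem : ∀ n, r n ∈ Ioo (0 : ℝ) 1
  center_height : Tendsto (fun n => u n (r n) / mu n) atTop (𝓝 (deltaSeq q k))
  center_density : Tendsto (fun n => lam n * r n ^ 2 * h (r n) * df f (u n (r n))) atTop
    (𝓝 (aSeq q k ^ 2 / 2))
  scale_pos : ∀ n, 0 < γ n
  scale_eq : ∀ᶠ n in atTop, lam n * h (r n) * df f (u n (r n)) * γ n ^ 2 = 1
  scale_tendsto : Tendsto γ atTop (𝓝 0)
  outer_mem : ∀ n, ρ n ∈ Ioo (0 : ℝ) 1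
  inner_mem : ∀ n, ρ' n ∈ Ico (0 : ℝ) 1
  outer_tendsto : Tendsto ρ atTop (𝓝 0)
  inner_div_tendsto : Tendsto (fun n => ρ' n / γ n) atTop (𝓝 0)
  outer_div_tendsto : Tendsto (fun n => ρ n / γ n) atTop atTop
  inner_height : Tendsto (fun n => u n (ρ' n) / mu n) atTop (𝓝 (deltaSeq q k))
  outer_height : Tendsto (fun n => u n (ρ n) / mu n) atTop (𝓝 (deltaSeq q k))
  profile : Tendsto (fun n => c2Norm (ρ' n / γ n) (ρ n / γ n)
    (fun s => rescale f t₀ (u n) (r n) (γ n) s - bubble q k s)) atTop (𝓝 0)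
  hasHeight : q = 1 → HasHeight f t₀ mu (Real.log (1 / etaSeq q k)) (fun n => u n (r n)) ∧
    HasHeight f t₀ mu (Real.log (1 / etaSeq q k)) (fun n => u n (ρ n)) ∧
    HasHeight f t₀ mu (Real.log (1 / etaSeq q k)) (fun n => u n (ρ' n))
  energy : Tendsto (fun n => dg f t₀ (u n (r n)) *
    ∫ s in (ρ' n)..(ρ n), lam n * h s * f (u n s) * s) atTop (𝓝 (2 * aSeq q k))
  energy_df : Tendsto (fun n => ∫ s in (ρ' n)..(ρ n), lam n * h s * df f (u n s) * s) atTop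
    (𝓝 (2 * aSeq q k))
  inner_flux : Tendsto (fun n => dg f t₀ (mu n) * flux (u n) (ρ' n)) atTop
    (𝓝 ((2 - aSeq q k) / etaSeq q k ^ (1 / q)))
  outer_flux : Tendsto (fun n => dg f t₀ (mu n) * flux (u n) (ρ n)) atTop
    (𝓝 ((2 + aSeq q k) / etaSeq q k ^ (1 / q)))

/-- The part common to all k. The first bubble has inner radius 0 and the others a positive one, so
what is needed at ρ' is assumed, while the outer radius is always e^{cn + M}. -/
theorem concentration_of_window {h f : ℝ → ℝ} {t₀ q T c C : ℝ} {lam mu : ℕ → ℝ} {u : ℕ → ℝ → ℝ}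
    {k : ℕ} (hH0 : H0 h f t₀) (hsol : ∀ n, IsSolution h f (lam n) (mu n) (u n))
    (hmu : Tendsto mu atTop atTop) (hT : t₀ < T) (G : Growth f (g f) (dg f t₀) (ddg f t₀) T q)
    (F : Family f (fun τ => h (Real.exp τ) / h 0) (fun n => lam n * h 0) mu
      (fun n => logU (u n)) (fun n => logW (u n)) c C)
    (ha : 0 < aSeq q k) (hη : 0 < etaSeq q k)
    (hδ : 1 - drop q (etaSeq q k) * (1 - 1 / q) = deltaSeq q k) {σ cn β : ℕ → ℝ}
    (S : Center f (g f) (dg f t₀) (fun n => lam n * h 0) mu (fun n => logU (u n))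
      (fun n => logW (u n)) (etaSeq q k) (aSeq q k) σ)
    (hσ : ∀ n, σ n < 0) (hcn : Tendsto cn atTop atBot)
    (hc : ∀ᶠ n in atTop, h (Real.exp (σ n)) / h 0 * (dg f t₀ (logU (u n) (σ n)) *
      (lam n * h 0 * f (logU (u n) (σ n)))) * Real.exp (2 * cn n) = 1)
    {M : ℕ → ℕ} {I : ℕ → Set ℝ} (hM : Tendsto M atTop atTop)
    (W : ∀ᶠ n in atTop, WindowAt f (g f) (dg f t₀) (fun τ => h (Real.exp τ) / h 0)
      (fun n => lam n * h 0) (fun n => logU (u n)) (fun n => logW (u n)) T (aSeq q k) σ cn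
      (I n) (M n) n)
    (hMI : ∀ n, (M n : ℝ) ∈ I n)
    (hβ : ∀ n, β n < 0) (hβ' : ∀ᶠ n in atTop, β n = cn n + M n)
    {ρ' : ℕ → ℝ} (hρ' : ∀ n, ρ' n ∈ Ico (0 : ℝ) 1)
    (hρβ : ∀ᶠ n in atTop, ρ' n < Real.exp (β n))
    (hρ0 : Tendsto (fun n => ρ' n / Real.exp (cn n)) atTop (𝓝 0))
    (hlog : ∀ᶠ n in atTop, ∀ s, ρ' n / Real.exp (cn n) < s → s ≤ Real.exp (M n) →
      Real.log s ∈ I n)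
    (hz : ∀ᶠ n in atTop, ∀ s, ρ' n / Real.exp (cn n) ≤ s → ContDiffAt ℝ 2 (bubble q k) s)
    (htop : Tendsto (fun n => u n (ρ' n)) atTop atTop)
    (hN : Tendsto (fun n => g f (u n (ρ' n)) / g f (mu n)) atTop (𝓝 (etaSeq q k)))
    (hD : Tendsto (fun n => dg f t₀ (u n (ρ' n)) / dg f t₀ (u n (Real.exp (σ n)))) atTop (𝓝 1))
    (hflux : Tendsto (fun n => dg f t₀ (u n (Real.exp (σ n))) * flux (u n) (ρ' n)) atTop
      (𝓝 (2 - aSeq q k))) :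
    Concentration h f t₀ q lam mu u k (fun n => Real.exp (σ n)) (fun n => Real.exp (cn n)) ρ'
      (fun n => Real.exp (β n)) := by
  have h00 : 0 < h 0 := hH0.h_pos 0 ⟨le_rfl, zero_le_one⟩
  have hST : Tendsto (fun n => u n (Real.exp (σ n))) atTop atTop := S.top
  have hMr : Tendsto (fun n => (M n : ℝ)) atTop atTop := tendsto_natCast_atTop_atTop.comp hM
  have hDpos : ∀ᶠ n in atTop, 0 < dg f t₀ (u n (Real.exp (σ n))) :=
    (hST.eventually_ge_atTop T).mono fun n hn => G.D_pos _ hn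
  -- the outer radius
  have hpM : ∀ᶠ n in atTop, (M n : ℝ) ∈ I n ∧
      |prof (aSeq q k) (M n)| ≤ |prof (aSeq q k) (M n)| + |prof (aSeq q k) (-(M n : ℝ))| :=
    Eventually.of_forall fun n => ⟨hMI n, le_add_of_nonneg_right (abs_nonneg _)⟩
  obtain ⟨o1, o2, o3⟩ := Family.window_slow G S hM W hpM
  have o4 := Family.window_mass hM W (p := fun n => (M n : ℝ))
    (Eventually.of_forall fun n => ⟨hMI n, le_rfl⟩) ((profMass_tendsto_atTop ha).comp hMr)
  have hUβ : ∀ᶠ n in atTop, logU (u n) (cn n + M n) = u n (Real.exp (β n)) :=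
    hβ'.mono fun n hn => by rw [hn]; rfl
  have htopβ : Tendsto (fun n => u n (Real.exp (β n))) atTop atTop := o1.congr' hUβ
  have hNβ : Tendsto (fun n => g f (u n (Real.exp (β n))) / g f (mu n)) atTop
      (𝓝 (etaSeq q k)) :=
    (Family.height_of_ratio G (S.top.eventually_ge_atTop T) o2 S.height).congr'
      (hUβ.mono fun n hn => by rw [hn])
  have hDβ : Tendsto (fun n => dg f t₀ (u n (Real.exp (β n))) / dg f t₀ (u n (Real.exp (σ n))))
      atTop (𝓝 1) := o3.congr' (hUβ.mono fun n hn => by rw [hn]; rfl)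
  have hfluxβ : Tendsto (fun n => dg f t₀ (u n (Real.exp (σ n))) * flux (u n) (Real.exp (β n)))
      atTop (𝓝 (2 + aSeq q k)) :=
    o4.congr' (hβ'.mono fun n hn => by beta_reduce; rw [hn]; rfl)
  -- heights
  have hle : ∀ r : ℕ → ℝ, (∀ n, r n ∈ Icc (0 : ℝ) 1) → ∀ᶠ n in atTop, u n (r n) ≤ mu n :=
    fun r hr => Eventually.of_forall fun n => by
      rw [← (hsol n).apply_zero]
      exact (hsol n).antitoneOn hH0 ⟨le_rfl, zero_le_one⟩ (hr n) (hr n).1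
  have hσI : ∀ n, Real.exp (σ n) ∈ Icc (0 : ℝ) 1 := fun n => exp_mem_Icc (hσ n).le
  have hβI : ∀ n, Real.exp (β n) ∈ Icc (0 : ℝ) 1 := fun n => exp_mem_Icc (hβ n).le
  have hρI : ∀ n, ρ' n ∈ Icc (0 : ℝ) 1 := fun n => Ico_subset_Icc_self (hρ' n)
  have hratio : ∀ r : ℕ → ℝ, (∀ n, r n ∈ Icc (0 : ℝ) 1) →
      Tendsto (fun n => u n (r n)) atTop atTop →
      Tendsto (fun n => g f (u n (r n)) / g f (mu n)) atTop (𝓝 (etaSeq q k)) →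
      Tendsto (fun n => u n (r n) / mu n) atTop (𝓝 (deltaSeq q k)) := fun r hr h1 h2 =>
    hδ ▸ G.height_ratio_tendsto hη hmu h1 (hle r hr) h2
  -- comparison of `g'(μ)` and `g'` at the centre
  have hDmu := G.D_ratio_tendsto hη hmu hST (hle _ hσI) S.height
  have hηq : 0 < etaSeq q k ^ (1 / q) := Real.rpow_pos_of_pos hη _
  have hfl : ∀ {r : ℕ → ℝ} {l : ℝ},
      Tendsto (fun n => dg f t₀ (u n (Real.exp (σ n))) * flux (u n) (r n)) atTop (𝓝 l) →
      Tendsto (fun n => dg f t₀ (mu n) * flux (u n) (r n)) atTop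
        (𝓝 (l / etaSeq q k ^ (1 / q))) := by
    intro r l hl
    refine (hl.div hDmu hηq.ne').congr' ?_
    filter_upwards [hDpos, hmu.eventually_ge_atTop T] with n h1 h2
    have h3 := G.D_pos _ h2
    simp only [Pi.div_apply]
    field_simp
  -- energies
  have hint : ∀ n, ∫ s in (ρ' n)..(Real.exp (β n)), lam n * h s * f (u n s) * s
      = flux (u n) (Real.exp (β n)) - flux (u n) (ρ' n) := fun n =>
    (hsol n).integral_eq_flux_sub hH0 (hρI n) (hβI n)
  have hE : Tendsto (fun n => dg f t₀ (u n (Real.exp (σ n))) *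
      ∫ s in (ρ' n)..(Real.exp (β n)), lam n * h s * f (u n s) * s) atTop
      (𝓝 (2 * aSeq q k)) := by
    have h1 := hfluxβ.sub hflux
    rw [show 2 + aSeq q k - (2 - aSeq q k) = 2 * aSeq q k by ring] at h1
    exact h1.congr fun n => by rw [hint]; ring
  have hED : ∀ {r : ℕ → ℝ},
      Tendsto (fun n => dg f t₀ (u n (r n)) / dg f t₀ (u n (Real.exp (σ n)))) atTop (𝓝 1) →
      Tendsto (fun n => dg f t₀ (u n (r n)) *
        ∫ s in (ρ' n)..(Real.exp (β n)), lam n * h s * f (u n s) * s) atTop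
        (𝓝 (2 * aSeq q k)) := by
    intro r hr
    have h1 := hr.mul hE
    rw [one_mul] at h1
    refine h1.congr' ?_
    filter_upwards [hDpos] with n h1
    field_simp
  have hdfmem : ∀ᶠ n in atTop, ∫ s in (ρ' n)..(Real.exp (β n)), lam n * h s * df f (u n s) * s ∈
      Icc (dg f t₀ (u n (Real.exp (β n))) *
        ∫ s in (ρ' n)..(Real.exp (β n)), lam n * h s * f (u n s) * s)
      (dg f t₀ (u n (ρ' n)) *
        ∫ s in (ρ' n)..(Real.exp (β n)), lam n * h s * f (u n s) * s) := by
    filter_upwards [hρβ, htopβ.eventually_ge_atTop T] with n h1 h2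
    exact (hsol n).integral_df_mem hH0 G hT (hρI n) (hβI n) h1.le h2
  refine
    { center_mem := fun n => exp_mem_Ioo (hσ n)
      center_height := hratio _ hσI hST S.height
      center_density := ?_
      scale_pos := fun n => Real.exp_pos _
      scale_eq := ?_
      scale_tendsto := Real.tendsto_exp_atBot.comp hcn
      outer_mem := fun n => exp_mem_Ioo (hβ n)
      inner_mem := hρ'
      outer_tendsto := ?_
      inner_div_tendsto := hρ0
      outer_div_tendsto := ?_
      inner_height := hratio _ hρI htop hN
      outer_height := hratio _ hβI htopβ hNβ
      profile := ?_
      hasHeight := ?_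
      energy := hE
      energy_df := tendsto_of_tendsto_of_tendsto_of_le_of_le' (hED hDβ) (hED hD)
        (hdfmem.mono fun n hn => hn.1) (hdfmem.mono fun n hn => hn.2)
      inner_flux := hfl hflux
      outer_flux := hfl hfluxβ }
  · have h1 := (F.κ_tendsto.comp (F.center_tendsto_atBot G S)).mul S.density
    rw [one_mul] at h1
    refine h1.congr' ?_
    filter_upwards [hST.eventually_gt_atTop t₀] with n hn
    rw [df_eq hH0 hn]
    have h2 := mul_dens_exp (f := f) (u := u n) (lam := lam n) h00.ne' (σ n)
    simp only [Function.comp]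
    rw [mul_left_comm, h2, logU]
    ring
  · filter_upwards [hST.eventually_gt_atTop t₀, hc] with n hn h1
    rw [df_eq hH0 hn, ← h1, two_mul (cn n), Real.exp_add, logU]
    field_simp
  · have h1 : Tendsto β atTop atBot := by
      refine tendsto_atBot_mono' _ ?_ (tendsto_neg_atTop_atBot.comp hMr)
      filter_upwards [hβ', W] with n h1 ⟨_, h2, _⟩
      rw [h1]; exact h2
    exact Real.tendsto_exp_atBot.comp h1
  · refine (Real.tendsto_exp_atTop.comp hMr).congr' ?_
    filter_upwards [hβ'] with n hn
    rw [hn, Function.comp, ← Real.exp_sub, add_sub_cancel_left]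
  · have h3 : Tendsto (fun n => 3 * ENNReal.ofReal (2 * (1 / ((M n : ℝ) + 1)))) atTop (𝓝 0) := by
      have h4 := ENNReal.tendsto_ofReal ((Family.tendsto_one_div_nat_add_one hM).const_mul 2)
      rw [mul_zero, ENNReal.ofReal_zero] at h4
      have h5 := ENNReal.Tendsto.const_mul (a := 3) h4 (Or.inr (by norm_num))
      rwa [mul_zero] at h5
    refine tendsto_of_tendsto_of_tendsto_of_le_of_le' tendsto_const_nhds h3
      (Eventually.of_forall fun n => zero_le) ?_
    filter_upwards [W, hβ', hlog, hz, hρβ] with n ⟨hW, _, _⟩ hβn hlogn hzn hρn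
    have hBM : Real.exp (β n) / Real.exp (cn n) = Real.exp (M n) := by
      rw [hβn, ← Real.exp_sub, add_sub_cancel_left]
    have hA0 : 0 ≤ ρ' n / Real.exp (cn n) := div_nonneg (hρ' n).1 (Real.exp_pos _).le
    refine c2Norm_rescale_le (c := cn n) (hsol n) h00.ne' ha rfl hA0
      (div_lt_div_of_pos_right hρn (Real.exp_pos _)) ?_ (fun s hs => hzn s hs.1) fun s hs => ?_
    · rw [mul_div_cancel₀ _ (Real.exp_pos _).ne']
      exact (hβI n).2
    · have hs0 : 0 < s := hA0.trans_lt hs.1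
      have hsM : s ≤ Real.exp (M n) := hBM ▸ hs.2
      obtain ⟨b1, _, b2, b3, b4⟩ := hW _ (hlogn s hs.1 hsM)
      have hM0 : (0 : ℝ) ≤ M n := (M n).cast_nonneg
      have hm : (0 : ℝ) < M n + 1 := by linarith
      have hlogM : Real.log s ≤ M n := (Real.log_le_iff_le_exp hs0).2 hsM
      -- The weight e^{2 log s - 2M} = s^2 e^{-2M} absorbs division by s^2, and division by s since
      -- s ≤ e^M.
      have e2 : Real.exp (2 * Real.log s - 2 * M n) = s * Real.exp (Real.log s - 2 * M n) := by
        rw [show 2 * Real.log s - 2 * M n = Real.log s + (Real.log s - 2 * M n) by ring,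
          Real.exp_add, Real.exp_log hs0]
      have e3 : Real.exp (2 * Real.log s - 2 * M n) = s ^ 2 * Real.exp (- 2 * M n) := by
        rw [show 2 * Real.log s - 2 * M n = Real.log s + (Real.log s + (-2 * M n)) by ring,
          Real.exp_add, Real.exp_add, Real.exp_log hs0]
        ring
      have hd0 : 0 ≤ 1 / ((M n : ℝ) + 1) := by positivity
      have f1 : Real.exp (Real.log s - 2 * M n) ≤ 1 := Real.exp_le_one_iff.2 (by linarith)
      have f2 : Real.exp (-2 * (M n : ℝ)) ≤ 1 := Real.exp_le_one_iff.2 (by linarith)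
      refine ⟨b1, b2.trans (by linarith), ?_, ?_⟩
      · rw [div_le_iff₀ hs0]
        refine b3.trans ?_
        rw [e2, mul_div_assoc, mul_comm]
        refine mul_le_mul_of_nonneg_right ?_ hs0.le
        have := div_le_div_of_nonneg_right f1 hm.le
        linarith
      · rw [div_le_iff₀ (by positivity)]
        refine (add_le_add b3 b4).trans ?_
        rw [e3, mul_div_assoc, ← two_mul, mul_comm (s ^ 2), ← mul_assoc]
        refine mul_le_mul_of_nonneg_right ?_ (by positivity)
        exact mul_le_mul_of_nonneg_left (div_le_div_of_nonneg_right f2 hm.le) two_pos.le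
  · rintro rfl
    exact ⟨G.hasHeight hη hmu hST (hle _ hσI) S.height, G.hasHeight hη hmu htopβ (hle _ hβI) hNβ,
      G.hasHeight hη hmu htop (hle _ hρI) hN⟩

theorem Center.congr {f N D : ℝ → ℝ} {Λ mu : ℕ → ℝ} {U ω : ℕ → ℝ → ℝ} {x a : ℝ} {σ σ' : ℕ → ℝ}
    (S : Center f N D Λ mu U ω x a σ) (h : σ =ᶠ[atTop] σ') : Center f N D Λ mu U ω x a σ' where
  neg := by filter_upwards [S.neg, h] with n h1 h2 using h2 ▸ h1
  top := S.top.congr' (h.mono fun n hn => by rw [hn])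
  height := S.height.congr' (h.mono fun n hn => by rw [hn])
  mass := S.mass.congr' (h.mono fun n hn => by rw [hn])
  density := S.density.congr' (h.mono fun n hn => by rw [hn])

/-- Centres and radii must lie in (0,1) for every n, whereas the asymptotic arguments give this only
eventually. -/
theorem exists_neg_eventuallyEq {σ : ℕ → ℝ} (h : ∀ᶠ n in atTop, σ n < 0) :
    ∃ σ' : ℕ → ℝ, (∀ n, σ' n < 0) ∧ σ =ᶠ[atTop] σ' := by
  refine ⟨fun n => if σ n < 0 then σ n else -1, fun n => ?_, h.mono fun n hn => ?_⟩
  · dsimp only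
    split_ifs with h
    exacts [h, by norm_num]
  · exact (if_pos hn).symm

theorem exists_concentration {h f : ℝ → ℝ} {t₀ q : ℝ} {lam mu : ℕ → ℝ} {u : ℕ → ℝ → ℝ}
    (hH0 : H0 h f t₀) (hH1 : H1 f t₀ q) (hq : q < 2)
    (hsol : ∀ n, IsSolution h f (lam n) (mu n) (u n)) (hmu : Tendsto mu atTop atTop)
    (k : ℕ) (hk : 1 ≤ k) :
    ∃ r γ ρ' ρ : ℕ → ℝ, Concentration h f t₀ q lam mu u k r γ ρ' ρ ∧ (k = 1 → ρ' = fun _ => 0) ∧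
      (2 ≤ k → ∀ n, 0 < ρ' n) := by
  obtain ⟨T, hT, G⟩ := exists_growth hH0 hH1
  obtain ⟨c, C, F⟩ := family_of_solutions hH0 hsol hmu
  obtain ⟨ra, rη, rk⟩ := recurrence_eta G.one_le hq
  obtain ⟨ha, -, hη, hδ, -⟩ := rk k hk
  obtain ⟨σ₀, S₀⟩ := F.exists_centers G hq k hk
  obtain ⟨σ, hσ, hσeq⟩ := exists_neg_eventuallyEq S₀.neg
  have S := S₀.congr hσeq
  set cn := Family.logScale f (dg f t₀) (fun τ => h (Real.exp τ) / h 0) (fun n => lam n * h 0)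
    (fun n => logU (u n)) σ with hcn
  have hcbot : Tendsto cn atTop atBot := F.logScale_tendsto G S ha
  have hc := F.logScale_spec G S
  have hconc := fun {M : ℕ → ℕ} {I : ℕ → Set ℝ} {β ρ' : ℕ → ℝ} =>
    concentration_of_window (M := M) (I := I) (β := β) (ρ' := ρ') hH0 hsol hmu hT G F ha hη hδ S hσ
      hcbot hc
  rcases eq_or_lt_of_le hk with rfl | hk2
  · have S' := S
    rw [ra, rη] at S'
    -- For k = 1 the window extends to τ = -∞. At ρ' = 0 the height is μ and the flux is 0, in
    -- agreement with 2 - a_1 = 0.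
    obtain ⟨M, hM, W⟩ := F.exists_window_origin G S'
    rw [← ra] at W
    obtain ⟨β, hβ, hβeq⟩ := exists_neg_eventuallyEq (σ := fun n => cn n + M n) (by
      filter_upwards [W, hM.eventually_ge_atTop 1] with n ⟨_, h1, _⟩ h2
      have : (1 : ℝ) ≤ M n := by exact_mod_cast h2
      linarith)
    have hu0 : ∀ n, u n 0 = mu n := fun n => (hsol n).apply_zero
    have hσmu : ∀ n, logU (u n) (σ n) ≤ mu n := fun n => F.U_le G n (hσ n).le
    refine ⟨_, _, fun _ => 0, _, hconc hM W (fun n => mem_Iic.2 le_rfl) hβ (hβeq.mono fun n hn => hn.symm)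
      (fun n => ⟨le_rfl, one_pos⟩) (Eventually.of_forall fun n => Real.exp_pos _) ?_ ?_ ?_ ?_ ?_ ?_ ?_,
      fun _ => rfl, fun h => absurd h (by norm_num)⟩
    · simp
    · refine Eventually.of_forall fun n s hs hsM => ?_
      rw [zero_div] at hs
      exact (Real.log_le_iff_le_exp hs).2 hsM
    · exact Eventually.of_forall fun n s _ => (contDiff_bubble ra).contDiffAt
    · simpa only [hu0] using hmu
    · simp only [hu0]
      rw [rη]
      refine tendsto_const_nhds.congr' ?_
      filter_upwards [hmu.eventually_ge_atTop T] with n hn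
      exact (div_self (G.N_pos _ hn).ne').symm
    · have h1 := G.D_ratio_tendsto hη hmu S.top (Eventually.of_forall hσmu) S.height
      rw [rη, Real.one_rpow] at h1
      have h2 := h1.inv₀ one_ne_zero
      rw [inv_one] at h2
      refine h2.congr fun n => ?_
      rw [inv_div, hu0]
      rfl
    · simp only [flux_zero, mul_zero, ra, sub_self]
      exact tendsto_const_nhds
  · obtain ⟨M, hM, W⟩ := F.exists_window G S ha
    have hMr : Tendsto (fun n => (M n : ℝ)) atTop atTop := tendsto_natCast_atTop_atTop.comp hM
    have hpos : ∀ᶠ n in atTop, (1 : ℝ) ≤ M n ∧ cn n + M n ≤ -M n := by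
      filter_upwards [W, hMr.eventually_ge_atTop 1] with n ⟨_, h1, _⟩ h2 using ⟨h2, h1⟩
    obtain ⟨β, hβ, hβeq⟩ := exists_neg_eventuallyEq (σ := fun n => cn n + M n) (by
      filter_upwards [hpos] with n hn
      linarith)
    obtain ⟨β', hβ', hβ'eq⟩ := exists_neg_eventuallyEq (σ := fun n => cn n + -(M n : ℝ)) (by
      filter_upwards [hpos] with n hn
      linarith)
    have hpI : ∀ n, -(M n : ℝ) ∈ Icc (-(M n : ℝ)) (M n) := fun n =>
      ⟨le_rfl, by linarith [(M n).cast_nonneg (α := ℝ)]⟩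
    obtain ⟨o1, o2, o3⟩ := Family.window_slow G S hM W (p := fun n => -(M n : ℝ))
      (Eventually.of_forall fun n => ⟨hpI n, le_add_of_nonneg_left (abs_nonneg _)⟩)
    have o4 := Family.window_mass hM W (p := fun n => -(M n : ℝ))
      (Eventually.of_forall fun n => ⟨hpI n, (hpI n).2⟩)
      ((profMass_tendsto_atBot ha).comp (tendsto_neg_atTop_atBot.comp hMr))
    have hU : ∀ᶠ n in atTop, logU (u n) (cn n + -(M n : ℝ)) = u n (Real.exp (β' n)) :=
      hβ'eq.mono fun n hn => by rw [← hn]; rfl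
    have hdiv : ∀ᶠ n in atTop, Real.exp (β' n) / Real.exp (cn n) = Real.exp (-(M n : ℝ)) :=
      hβ'eq.mono fun n hn => by
        rw [← hn, ← Real.exp_sub, add_sub_cancel_left]
    refine ⟨_, _, fun n => Real.exp (β' n), _, hconc hM W (fun n => ⟨(hpI n).2, le_rfl⟩) hβ
      (hβeq.mono fun n hn => hn.symm) (fun n => Ioo_subset_Ico_self (exp_mem_Ioo (hβ' n)))
      ?_ ?_ ?_ ?_ ?_ ?_ ?_ ?_,
      fun h => absurd h hk2.ne', fun _ n => Real.exp_pos _⟩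
    · filter_upwards [hβeq, hβ'eq, hpos] with n h1 h2 h3
      rw [← h1, ← h2]
      exact Real.exp_lt_exp.2 (by linarith)
    · exact (Real.tendsto_exp_atBot.comp (tendsto_neg_atTop_atBot.comp hMr)).congr'
        (hdiv.mono fun n hn => hn.symm)
    · filter_upwards [hdiv] with n hn s hs hsM
      rw [hn] at hs
      have hs0 : 0 < s := (Real.exp_pos _).trans hs
      exact ⟨((Real.lt_log_iff_exp_lt hs0).2 hs).le, (Real.log_le_iff_le_exp hs0).2 hsM⟩
    · filter_upwards [hdiv] with n hn s hs
      rw [hn] at hs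
      exact contDiffAt_bubble ha ((Real.exp_pos _).trans_le hs)
    · exact o1.congr' hU
    · exact (Family.height_of_ratio G (S.top.eventually_ge_atTop T) o2 S.height).congr'
        (hU.mono fun n hn => by rw [hn])
    · exact o3.congr' (hU.mono fun n hn => by rw [hn]; rfl)
    · exact o4.congr' (hβ'eq.mono fun n hn => by beta_reduce; rw [← hn]; rfl)

end InfConc

theorem theorem1p2 (h f : ℝ → ℝ) (t₀ q : ℝ) (hH0 : H0 h f t₀) (hH1 : H1 f t₀ q)
    (hq1 : 1 ≤ q) (hq2 : q < 2) (lam mu : ℕ → ℝ) (u : ℕ → ℝ → ℝ)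
    (hsol : ∀ n, IsSolution h f (lam n) (mu n) (u n)) (hmu : Tendsto mu atTop atTop) :
    -- each `z_k` solves the Liouville equation and has mass `2 a_k`
    (∀ k : ℕ, 1 ≤ k →
      (∀ s : ℝ, 0 < s → -(deriv (deriv (bubble q k)) s) - 1 / s * deriv (bubble q k) s
        = Real.exp (bubble q k s)) ∧
      IntegrableOn (fun s => Real.exp (bubble q k s) * s) (Ioi 0) ∧
      ∫ s in Ioi (0 : ℝ), Real.exp (bubble q k s) * s = 2 * aSeq q k) ∧
    -- one subsequence `φ` for all `k`; `ρ' k n` and `ρ k n` are the inner and outer radii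
    ∃ φ : ℕ → ℕ, StrictMono φ ∧ ∃ r γ ρ' ρ : ℕ → ℕ → ℝ,
      (∀ n, ρ' 1 n = 0) ∧
      ∀ k : ℕ, 1 ≤ k →
        -- the centres
        (∀ n, r k n ∈ Ioo (0 : ℝ) 1) ∧
        Tendsto (fun n => u (φ n) (r k n) / mu (φ n)) atTop (𝓝 (deltaSeq q k)) ∧
        Tendsto (fun n => lam (φ n) * r k n ^ 2 * h (r k n) * df f (u (φ n) (r k n)))
          atTop (𝓝 (aSeq q k ^ 2 / 2)) ∧
        -- the scales
        (∀ n, 0 < γ k n) ∧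
        (∀ᶠ n in atTop, lam (φ n) * h (r k n) * df f (u (φ n) (r k n)) * γ k n ^ 2 = 1) ∧
        Tendsto (γ k) atTop (𝓝 0) ∧
        -- the radii
        (∀ n, ρ k n ∈ Ioo (0 : ℝ) 1) ∧
        (2 ≤ k → ∀ n, ρ' k n ∈ Ioo (0 : ℝ) 1) ∧
        Tendsto (ρ k) atTop (𝓝 0) ∧
        Tendsto (fun n => ρ' k n / γ k n) atTop (𝓝 0) ∧
        Tendsto (fun n => ρ k n / γ k n) atTop atTop ∧
        Tendsto (fun n => u (φ n) (ρ' k n) / mu (φ n)) atTop (𝓝 (deltaSeq q k)) ∧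
        Tendsto (fun n => u (φ n) (ρ k n) / mu (φ n)) atTop (𝓝 (deltaSeq q k)) ∧
        -- convergence to the bubble
        Tendsto (fun n => c2Norm (ρ' k n / γ k n) (ρ k n / γ k n)
          (fun s => rescale f t₀ (u (φ n)) (r k n) (γ k n) s - bubble q k s)) atTop (𝓝 0) ∧
        -- the precise heights for `q = 1`
        (q = 1 →
          HasHeight f t₀ (mu ∘ φ) (Real.log (1 / etaSeq q k)) (fun n => u (φ n) (r k n)) ∧
          HasHeight f t₀ (mu ∘ φ) (Real.log (1 / etaSeq q k)) (fun n => u (φ n) (ρ k n)) ∧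
          HasHeight f t₀ (mu ∘ φ) (Real.log (1 / etaSeq q k)) (fun n => u (φ n) (ρ' k n))) ∧
        -- the local energies
        Tendsto (fun n => dg f t₀ (u (φ n) (r k n)) *
          ∫ s in (ρ' k n)..(ρ k n), lam (φ n) * h s * f (u (φ n) s) * s)
          atTop (𝓝 (2 * aSeq q k)) ∧
        Tendsto (fun n =>
          ∫ s in (ρ' k n)..(ρ k n), lam (φ n) * h s * df f (u (φ n) s) * s)
          atTop (𝓝 (2 * aSeq q k)) ∧
        -- no energy between consecutive bubbles
        Tendsto (fun n => dg f t₀ (mu (φ n)) *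
          ∫ s in (ρ k n)..(ρ' (k + 1) n), lam (φ n) * h s * f (u (φ n) s) * s)
          atTop (𝓝 0) := by
  obtain ⟨ra, rη, rk⟩ := recurrence_eta hq1 hq2
  -- The identity serves as the subsequence, since all limits hold along the whole sequence.
  refine ⟨fun k hk => ⟨fun s hs => bubble_liouville (rk k hk).1 hs, bubble_integral (rk k hk).1⟩,
    id, strictMono_id, ?_⟩
  choose! r γ ρ' ρ hc h1 h2 using exists_concentration hH0 hH1 hq2 hsol hmu
  refine ⟨r, γ, ρ', ρ, fun n => by rw [h1 1 le_rfl rfl], fun k hk => ?_⟩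
  have K := hc k hk
  have K' := hc (k + 1) (by omega)
  refine ⟨K.center_mem, K.center_height, K.center_density, K.scale_pos, K.scale_eq,
    K.scale_tendsto, K.outer_mem, fun hk2 n => ⟨h2 k hk hk2 n, (K.inner_mem n).2⟩,
    K.outer_tendsto, K.inner_div_tendsto, K.outer_div_tendsto, K.inner_height, K.outer_height,
    K.profile, K.hasHeight, K.energy, K.energy_df, ?_⟩
  obtain ⟨-, -, hη, -, y, hy0, -, hy, -, hay⟩ := rk k hk
  -- In units of 1/g'(μ), the flux leaving bubble k is (2 + a_k)/η_k^{1/q} and the flux entering the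
  -- next is (2 - a_{k+1})/η_{k+1}^{1/q}. The recurrence makes them equal, so no energy remains in
  -- between.
  have h3 := K'.inner_flux.sub K.outer_flux
  rw [hy, hay, Real.mul_rpow hη.le hy0.le, mul_comm (y ^ (1 / q)), mul_div_mul_right _ _
    (Real.rpow_pos_of_pos hy0 _).ne', sub_self] at h3
  refine h3.congr fun n => ?_
  rw [id, (hsol n).integral_eq_flux_sub hH0 (Ioo_subset_Icc_self (K.outer_mem n))
    (Ico_subset_Icc_self (K'.inner_mem n)), mul_sub]
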